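/- Let $n\ge 2$ and $k\in\{1,\dots,n-1\}$. Write points of parabolic space $\mathbb R^{n+1}=\mathbb R^n\times\mathbb R$ as $\mathbf X=(X,t)$, put $\|\mathbf X\|=(|X|^2+|t|)^{1/2}$, and use the distance $\|\mathbf X-\mathbf Y\|$ for open balls $B(\mathbf X,r)$, diameters, distances to sets, and Lipschitz constants. Measures are locally finite Borel measures. A measure $\mu$ on $\mathbb R^{n+1}$ is $(k+2)$-ADR with constant $C_0>0$ if $$C_0^{-1}r^{k+2}\le\mu(B(\mathbf X,r))\le C_0r^{k+2}\qquad\text{for all }\mathbf X\in\operatorname{supp}\mu,\ 0<r<\operatorname{diam}(\operatorname{supp}\mu).$$ *Singular integrals.* A smooth function $K:\mathbb R^{n+1}\setminus\{0\}\to\mathbb R$ is an admissible kernel of dimension $k+2$ if $K(X,t)=-K(-X,t)$ for all $(X,t)\neq 0$ and if for all integers $\ell,j\ge0$ there is a constant $C_{\ell,j}$ with $|\nabla_X^\ell\partial_t^jK(\mathbf X)|\le C_{\ell,j}\|\mathbf X\|^{-(k+2)-\ell-2j}$ for all $\mathbf X\ne0$. With $T_\epsilon f(\mathbf X)=\int_{\|\mathbf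 X-\mathbf Y\|>\epsilon}K(\mathbf X-\mathbf Y)f(\mathbf Y)\,d\mu(\mathbf Y)$, the CZO with kernel $K$ is bounded on $L^2(\mu)$ if there is a constant $C$ (which may depend on $K$) such that $\int\sup_{\epsilon>0}|T_\epsilon f|^2\,d\mu\le C\|f\|_{L^2(\mu)}^2$ for all $f\in L^2(\mu)$. *$\alpha$-numbers and HSDC.* Fix $C_0>0$. For $m\in\{k+1,k+2\}$ let $\mathcal M_m$ be the family of all translates of those product measures $\mathcal H^m|_L\times\nu$ that are $(k+2)$-ADR with constant $C_0$, where $L\subset\mathbb R^n$ is an $m$-dimensional linear subspace and $\nu$ is a measure on $\mathbb R$. Put $$\alpha_{\mu,m}(\mathbf X,r)=\inf_{\omega\in\mathcal M_m}\ \sup_f\ \frac1{r^{k+2}}\Bigl|\int f\,d(\mu-\omega)\Bigr|,$$ where the supremum is over all $f:\mathbb R^{n+1}\to\mathbb R$ supported in $B(\mathbf X,r)$ with Lipschitz constant at most $1/r$, and where $\alpha_{\mu,m}=\infty$ if $\mathcal M_m=\varnothing$ (in particular $\alpha_{\mu,n+1}=\infty$). The measure $\mu$ satisfies the $\varepsilon$-HSDC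 if there is $C>0$ such that for all $\mathbf X\in\operatorname{supp}\mu$ and $R>0$ $$\int_0^R\mu\bigl(\{\mathbf Y\in B(\mathbf X,R):\ \alpha_{\mu,k+1}(\mathbf Y,r)<\varepsilon\ \text{ or }\ \alpha_{\mu,k+2}(\mathbf Y,r)<\varepsilon\}\bigr)\frac{dr}r\le CR^{k+2}.$$ *Uniform rectifiability.* A $(k+2)$-dimensional vertical plane is an affine plane in $\mathbb R^{n+1}$ that contains a line parallel to the $t$-axis and whose projection to $\mathbb R^n$ is a $k$-dimensional affine plane. Put $$\beta_{\mu,k}(\mathbf X,r)^2=\inf_L\frac1{\mu(B(\mathbf X,r))}\int_{B(\mathbf X,r)}\Bigl(\frac{\operatorname{dist}(\mathbf Y,L)}r\Bigr)^2d\mu(\mathbf Y),$$ the infimum being over all $(k+2)$-dimensional vertical planes $L$. **Theorem.** Let $\mu$ be a $(k+2)$-ADR measure on $\mathbb R^{n+1}$ with constant $C_0$, and suppose that $\mu$ satisfies the $\varepsilon$-HSDC for some $\varepsilon>0$. If for every admissible kernel of dimension $k+2$ the associated CZO is bounded on $L^2(\mu)$, then $\mu$ is parabolically uniformly rectifiable: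 there is a constant $C>0$ such that $$\int_0^R\int_{B(\mathbf X,R)}\beta_{\mu,k}(\mathbf Y,r)^2\,d\mu(\mathbf Y)\,\frac{dr}r\le CR^{k+2}\qquad\text{for all }\mathbf X\in\operatorname{supp}\mu,\ R>0.$$ -/

import Mathlib

open MeasureTheory Set
open scoped ENNReal NNReal

noncomputable section

namespace ParabolicUR

/-- Parabolic space `ℝⁿ⁺¹ = ℝⁿ × ℝ`; a point is `𝐗 = (X, t)` with `X` in space and `t` in time.
The parabolic group law is ordinary addition. The (sup) metric that Mathlib puts on a product is
used only through the topology and the Borel σ-algebra; sizes are measured by `pnorm`. -/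
abbrev PSpace (n : ℕ) : Type := EuclideanSpace ℝ (Fin n) × ℝ

variable {n : ℕ}

/-- The parabolic norm: `‖(X, t)‖² = |X|² + |t|`. -/
def pnorm (X : PSpace n) : ℝ := Real.sqrt (‖X.1‖ ^ 2 + |X.2|)

/-- The open parabolic ball of center `X` and radius `r`. -/
def pball (X : PSpace n) (r : ℝ) : Set (PSpace n) := {Y | pnorm (X - Y) < r}

/-- The diameter of a set in the parabolic distance, possibly infinite. -/
def pdiam (S : Set (PSpace n)) : ℝ≥0∞ :=
  ⨆ X ∈ S, ⨆ Y ∈ S, ENNReal.ofReal (pnorm (X - Y))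

/-- The parabolic distance from a point to a set. -/
def pdistTo (X : PSpace n) (S : Set (PSpace n)) : ℝ≥0∞ :=
  ⨅ Y ∈ S, ENNReal.ofReal (pnorm (X - Y))

/-- `μ` is `(k+2)`-Ahlfors–David regular with constant `C₀`: a locally finite Borel measure with
`C₀⁻¹ r^{k+2} ≤ μ(B(𝐗, r)) ≤ C₀ r^{k+2}` for `𝐗 ∈ supp μ` and `0 < r < diam (supp μ)`. -/
structure IsADR (C₀ : ℝ) (k : ℕ) (μ : Measure (PSpace n)) : Prop where
  locallyFinite : IsLocallyFiniteMeasure μ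
  regular : ∀ X ∈ μ.support, ∀ r : ℝ, 0 < r → ENNReal.ofReal r < pdiam μ.support →
    ENNReal.ofReal (C₀⁻¹ * r ^ (k + 2)) ≤ μ (pball X r) ∧
      μ (pball X r) ≤ ENNReal.ofReal (C₀ * r ^ (k + 2))

/-! ### Singular integrals -/

/-- Admissible kernels of dimension `k+2`: smooth off the origin, odd in the spatial variable, with
`|∇_X^ℓ ∂_t^j K(𝐗)| ≤ C_{ℓ,j} ‖𝐗‖^{-(k+2)-ℓ-2j}` for all `ℓ, j ≥ 0`. -/
structure IsAdmissibleKernel (k : ℕ) (K : PSpace n → ℝ) : Prop where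
  smooth : ContDiffOn ℝ ((⊤ : ℕ∞) : WithTop ℕ∞) K {0}ᶜ
  odd : ∀ (X : EuclideanSpace ℝ (Fin n)) (t : ℝ), (X, t) ≠ 0 → K (X, t) = -K (-X, t)
  bound : ∀ l j : ℕ, ∃ C : ℝ, ∀ (X : EuclideanSpace ℝ (Fin n)) (t : ℝ), (X, t) ≠ 0 →
    ‖iteratedFDeriv ℝ l
        (fun X' : EuclideanSpace ℝ (Fin n) => iteratedDeriv j (fun s : ℝ => K (X', s)) t) X‖
      ≤ C / pnorm (X, t) ^ (k + 2 + l + 2 * j)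

/-- The truncation `T_ε f(𝐗) = ∫_{‖𝐗 - 𝐘‖ > ε} K(𝐗 - 𝐘) f(𝐘) dμ(𝐘)`. -/
def truncCZO (K : PSpace n → ℝ) (μ : Measure (PSpace n)) (ε : ℝ) (f : PSpace n → ℝ)
    (X : PSpace n) : ℝ :=
  ∫ Y in {Y | ε < pnorm (X - Y)}, K (X - Y) * f Y ∂μ

/-- The singular integral with kernel `K` is bounded on `L²(μ)`:
`∫ sup_{ε > 0} |T_ε f|² dμ ≤ C ‖f‖²_{L²(μ)}` for all `f ∈ L²(μ)`. -/
def CZOBounded (K : PSpace n → ℝ) (μ : Measure (PSpace n)) : Prop :=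
  ∃ C : ℝ≥0, ∀ f : PSpace n → ℝ, MemLp f 2 μ →
    ∫⁻ X, ⨆ (ε : ℝ) (_ : 0 < ε), ‖truncCZO K μ ε f X‖ₑ ^ 2 ∂μ ≤ C * eLpNorm f 2 μ ^ 2

/-! ### Vertical planes, `β`-numbers, uniform rectifiability -/

/-- `(k+2)`-dimensional vertical planes: affine planes whose spatial projection is a
`k`-dimensional affine plane and which contain a line in the time direction. -/
def IsVerticalPlane (k : ℕ) (L : AffineSubspace ℝ (PSpace n)) : Prop :=
  Module.finrank ℝ
      (L.map (LinearMap.fst ℝ (EuclideanSpace ℝ (Fin n)) ℝ).toAffineMap).direction = k ∧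
    ∃ X : EuclideanSpace ℝ (Fin n), ∀ t : ℝ, (X, t) ∈ L

/-- `β_{μ,k}(𝐗, r)² = inf_L μ(B(𝐗,r))⁻¹ ∫_{B(𝐗,r)} (dist(𝐘, L) / r)² dμ(𝐘)`, the infimum being over
`(k+2)`-dimensional vertical planes `L`. -/
def betaSq (k : ℕ) (μ : Measure (PSpace n)) (X : PSpace n) (r : ℝ) : ℝ≥0∞ :=
  ⨅ (L : AffineSubspace ℝ (PSpace n)) (_ : IsVerticalPlane k L),
    (μ (pball X r))⁻¹ *
      ∫⁻ Y in pball X r, (pdistTo Y (L : Set (PSpace n)) / ENNReal.ofReal r) ^ 2 ∂μ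

/-- The Carleson estimate that defines parabolic uniform rectifiability of a `(k+2)`-ADR measure:
`∫_0^R ∫_{B(𝐗,R)} β_{μ,k}(𝐘, r)² dμ(𝐘) dr/r ≤ C R^{k+2}` for all `𝐗 ∈ supp μ`, `R > 0`. -/
def IsUniformlyRectifiable (k : ℕ) (μ : Measure (PSpace n)) : Prop :=
  ∃ C : ℝ≥0, ∀ X ∈ μ.support, ∀ R : ℝ, 0 < R →
    ∫⁻ r in Ioo (0 : ℝ) R, (∫⁻ Y in pball X R, betaSq k μ Y r ∂μ) / ENNReal.ofReal r
      ≤ C * ENNReal.ofReal (R ^ (k + 2))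

/-! ### Product measures, `α`-numbers, the higher spatial dimension condition -/

/-- The product measure `ℋ^m|_L × ν`. -/
def planeProd (m : ℕ) (L : Submodule ℝ (EuclideanSpace ℝ (Fin n))) (ν : Measure ℝ) :
    Measure (PSpace n) :=
  ((Measure.hausdorffMeasure (m : ℝ)).restrict (L : Set (EuclideanSpace ℝ (Fin n)))).prod ν

/-- The family `𝓜_m`: all translates of the measures `ℋ^m|_L × ν` that are `(k+2)`-ADR with
constant `C₀`, where `L` is an `m`-dimensional linear subspace of `ℝⁿ` and `ν` is a locally finite
Borel measure on `ℝ`. It is empty for `m > n`. -/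
def productFamily (n : ℕ) (C₀ : ℝ) (k m : ℕ) : Set (Measure (PSpace n)) :=
  {ω | ∃ (L : Submodule ℝ (EuclideanSpace ℝ (Fin n))) (ν : Measure ℝ) (X : PSpace n),
    Module.finrank ℝ L = m ∧ IsLocallyFiniteMeasure ν ∧ IsADR C₀ k (planeProd m L ν) ∧
      ω = (planeProd m L ν).map (fun Y => Y + X)}

/-- `d_{𝐗,r}(μ, ω) = sup_f r^{-(k+2)} |∫ f d(μ - ω)|`, the supremum being over the functions `f`
supported in `B(𝐗, r)` that are `1/r`-Lipschitz for the parabolic distance. -/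
def transportDist (k : ℕ) (X : PSpace n) (r : ℝ) (μ ω : Measure (PSpace n)) : ℝ≥0∞ :=
  ⨆ (f : PSpace n → ℝ) (_ : Function.support f ⊆ pball X r)
    (_ : ∀ Y Z, |f Y - f Z| ≤ 1 / r * pnorm (Y - Z)),
    ENNReal.ofReal (|∫ Y, f Y ∂μ - ∫ Y, f Y ∂ω| / r ^ (k + 2))

/-- `α_{μ,m}(𝐗, r) = inf_{ω ∈ 𝓜_m} d_{𝐗,r}(μ, ω)`; it is `∞` when `𝓜_m` is empty, in particular for
`m = n + 1`. -/
def alphaNumber (C₀ : ℝ) (k m : ℕ) (μ : Measure (PSpace n)) (X : PSpace n) (r : ℝ) : ℝ≥0∞ :=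
  ⨅ ω ∈ productFamily n C₀ k m, transportDist k X r μ ω

/-- The `k`-dimensional `ε`-HSDC: for some constant `C`, for all `𝐗 ∈ supp μ` and `R > 0`,
`∫_0^R μ({𝐘 ∈ B(𝐗,R) : α_{μ,k+1}(𝐘,r) < ε or α_{μ,k+2}(𝐘,r) < ε}) dr/r ≤ C R^{k+2}`. -/
def HSDC (C₀ : ℝ) (k : ℕ) (ε : ℝ) (μ : Measure (PSpace n)) : Prop :=
  ∃ C : ℝ≥0, ∀ X ∈ μ.support, ∀ R : ℝ, 0 < R →
    ∫⁻ r in Ioo (0 : ℝ) R,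
        (∫⁻ Y in pball X R,
          indicator {Z | alphaNumber C₀ k (k + 1) μ Z r < ENNReal.ofReal ε ∨
            alphaNumber C₀ k (k + 2) μ Z r < ENNReal.ofReal ε} (fun _ => 1) Y ∂μ)
          / ENNReal.ofReal r
      ≤ C * ENNReal.ofReal (R ^ (k + 2))

end ParabolicUR

end

/-!
The convolutions of `μ` with dilates of smooth bumps that are odd in the spatial variable detect how
far `μ` is from a vertical plane. The proof bounds their square function by the singular integrals,
and the flatness of `μ` by their square function.

**Singular integrals and square functions.** For an odd bump `ψ` supported in a parabolic annulus and
a lacunary sequence of scales, the sum of the dilates of `ψ` with bounded coefficients `aⱼ` is an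
admissible kernel (`isAdmissibleKernel_bumpSum`). Differences of truncations of its operator, applied
to the indicator of a ball, are finite sums of convolutions with single bumps. The bounds are not
uniform in the kernel, but the uniform boundedness principle on `ℓ^∞(ℤ)` makes them uniform in
`‖a‖ ≤ 1`, and averaging over signs gives the square function estimate (`exists_square_bound`).

**Compactness.** Let the convolutions with sufficiently many bumps be small around a point and a
scale. Then `μ` is close there to a measure `ν` that is annihilated by all odd bumps at the points of
its support. So `ν` is symmetric under the spatial reflections in these points, and hence invariant
under the translations by twice their spatial components (`transInv_of_oddBump`). Blowing `ν` down,
these translations fill the span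
`W` of the projected support, and the limit is a product of Hausdorff measure on `W` with a measure
on `ℝ`, by uniqueness of Haar measure (`exists_blowDown`, `IsPlaneInv.exists_eq_planeProd`). Its growth
forces `dim W ≤ k + 2`. If `dim W` is `k + 1` or `k + 2`, an `α`-number of `μ` is small at some larger
scale; otherwise the support of `ν` lies in a vertical plane, and `μ` is close to it (`exists_flat`).

**Improvement.** Once `μ` is close to a vertical plane at scale one, convolve with the vector-valued
odd bump `x φ(x, t)`. The component normal to the plane is `h · (φ * μ) - φ * (h μ)`, where `h` is the
offset from the plane. Smoothness of `φ` shows that, up to second order errors, `h` is an affine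
function of the spatial variable on the support, which means that a nearby plane approximates `μ`
better: at scale `δ` the square of the flatness coefficient gains a factor `δ ^ 2`, at the expense of
the energy of the convolutions (`exists_improved_plane`, `exists_decay`).

**Packing.** At a point and scale either the decay estimate holds, or an `α`-number is small, or the
scale exceeds the diameter of the support. The energies satisfy a Carleson estimate by the square
function bound, the points with small `α`-numbers do by the HSDC, and the large scales give a
geometric series. For small `δ` the flatness at the larger scale is absorbed (`exists_sum_flat_le`).
Passing from dyadic scales to all scales gives the estimate for the `β`-numbers.
-/

/-! ### Parabolic geometry: balls, dilations, rescaled measures -/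

namespace ParabolicUR

open Filter Topology

variable {n : ℕ}

lemma pnorm_nonneg (X : PSpace n) : 0 ≤ pnorm X := Real.sqrt_nonneg _

lemma pnorm_sq (X : PSpace n) : pnorm X ^ 2 = ‖X.1‖ ^ 2 + |X.2| :=
  Real.sq_sqrt (by positivity)

@[simp] lemma pnorm_zero : pnorm (0 : PSpace n) = 0 := by simp [pnorm]

@[simp] lemma pnorm_neg (X : PSpace n) : pnorm (-X) = pnorm X := by simp [pnorm]

lemma pnorm_sub_comm (X Y : PSpace n) : pnorm (X - Y) = pnorm (Y - X) := by
  rw [← pnorm_neg, neg_sub]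

lemma norm_fst_le_pnorm (X : PSpace n) : ‖X.1‖ ≤ pnorm X :=
  Real.le_sqrt_of_sq_le (by linarith [abs_nonneg X.2])

lemma abs_snd_le_pnorm_sq (X : PSpace n) : |X.2| ≤ pnorm X ^ 2 := by
  rw [pnorm_sq]; nlinarith [sq_nonneg ‖X.1‖]

lemma norm_le_pnorm {X : PSpace n} (h : pnorm X ≤ 1) : ‖X‖ ≤ pnorm X := by
  rw [Prod.norm_def]
  refine max_le (norm_fst_le_pnorm X) ((abs_snd_le_pnorm_sq X).trans ?_)
  have := pnorm_nonneg X
  nlinarith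

lemma pnorm_pos {X : PSpace n} (h : X ≠ 0) : 0 < pnorm X := by
  refine (pnorm_nonneg X).lt_of_ne fun h0 => h ?_
  have h1 := pnorm_sq X
  rw [← h0] at h1
  have h2 : ‖X.1‖ ^ 2 = 0 := by nlinarith [sq_nonneg ‖X.1‖, abs_nonneg X.2]
  have h3 : |X.2| = 0 := by nlinarith [sq_nonneg ‖X.1‖, abs_nonneg X.2]
  exact Prod.ext (by simpa using h2) (by simpa using h3)

lemma pnorm_add_le (X Y : PSpace n) : pnorm (X + Y) ≤ pnorm X + pnorm Y := by
  refine Real.sqrt_le_iff.2 ⟨add_nonneg (pnorm_nonneg _) (pnorm_nonneg _), ?_⟩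
  have h1 : ‖(X + Y).1‖ ≤ ‖X.1‖ + ‖Y.1‖ := norm_add_le _ _
  have h2 : |(X + Y).2| ≤ |X.2| + |Y.2| := abs_add_le _ _
  have h3 := norm_fst_le_pnorm X
  have h4 := norm_fst_le_pnorm Y
  have h5 : ‖X.1‖ * ‖Y.1‖ ≤ pnorm X * pnorm Y :=
    mul_le_mul h3 h4 (norm_nonneg _) (pnorm_nonneg _)
  nlinarith [pnorm_sq X, pnorm_sq Y, norm_nonneg (X + Y).1, norm_nonneg X.1, norm_nonneg Y.1]

lemma pnorm_sub_le (X Y Z : PSpace n) : pnorm (X - Z) ≤ pnorm (X - Y) + pnorm (Y - Z) := by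
  simpa using pnorm_add_le (X - Y) (Y - Z)

lemma continuous_pnorm : Continuous (pnorm : PSpace n → ℝ) := by
  unfold pnorm; fun_prop

lemma mem_pball {X Y : PSpace n} {r : ℝ} : Y ∈ pball X r ↔ pnorm (X - Y) < r := Iff.rfl

lemma isOpen_pball (X : PSpace n) (r : ℝ) : IsOpen (pball X r) :=
  isOpen_lt (continuous_pnorm.comp (by fun_prop)) continuous_const

lemma measurableSet_pball (X : PSpace n) (r : ℝ) : MeasurableSet (pball X r) :=
  (isOpen_pball X r).measurableSet

lemma mem_pball_self (X : PSpace n) {r : ℝ} (hr : 0 < r) : X ∈ pball X r := by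
  simpa [mem_pball] using hr

lemma pball_subset_pball {X Y : PSpace n} {r s : ℝ} (h : pnorm (X - Y) + r ≤ s) :
    pball Y r ⊆ pball X s := fun Z hZ => by
  have := pnorm_sub_le X Y Z
  rw [mem_pball] at *; linarith

lemma pball_mono {X : PSpace n} {r s : ℝ} (h : r ≤ s) : pball X r ⊆ pball X s :=
  pball_subset_pball (by simpa using h)

lemma exists_pball_subset {X : PSpace n} {U : Set (PSpace n)} (hU : U ∈ 𝓝 X) :
    ∃ r > 0, pball X r ⊆ U := by
  obtain ⟨e, he, h⟩ := Metric.mem_nhds_iff.1 hU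
  refine ⟨min e (Real.sqrt e), lt_min he (Real.sqrt_pos.2 he), fun Y hY => h ?_⟩
  rw [mem_pball, lt_min_iff, pnorm_sub_comm] at hY
  rw [Metric.mem_ball, Prod.dist_eq, max_lt_iff, dist_eq_norm, Real.dist_eq]
  refine ⟨(norm_fst_le_pnorm (Y - X)).trans_lt hY.1, ?_⟩
  have h1 := abs_snd_le_pnorm_sq (Y - X)
  have h2 := Real.sq_sqrt he.le
  have h3 := pnorm_nonneg (Y - X)
  simp only [Prod.snd_sub] at h1
  nlinarith [hY.2]

lemma pball_mem_nhds (X : PSpace n) {r : ℝ} (hr : 0 < r) : pball X r ∈ 𝓝 X :=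
  (isOpen_pball X r).mem_nhds (mem_pball_self X hr)

lemma isCompact_closedPball (X : PSpace n) (r : ℝ) : IsCompact {Y | pnorm (X - Y) ≤ r} := by
  refine ((isCompact_closedBall X.1 r).prod (isCompact_closedBall X.2 (r ^ 2))).of_isClosed_subset
    (isClosed_le (continuous_pnorm.comp (by fun_prop)) continuous_const) fun Y hY => ?_
  have hY : pnorm (X - Y) ≤ r := hY
  rw [pnorm_sub_comm] at hY
  rw [mem_prod, Metric.mem_closedBall, Metric.mem_closedBall, dist_eq_norm, Real.dist_eq]
  exact ⟨(norm_fst_le_pnorm (Y - X)).trans hY, (abs_snd_le_pnorm_sq (Y - X)).trans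
    (pow_le_pow_left₀ (pnorm_nonneg _) hY 2)⟩

lemma pball_subset_closedPball (X : PSpace n) (r : ℝ) : pball X r ⊆ {Y | pnorm (X - Y) ≤ r} :=
  fun _ h => (mem_pball.1 h).le

lemma measure_pball_lt_top (μ : Measure (PSpace n)) [IsLocallyFiniteMeasure μ] (X : PSpace n)
    (r : ℝ) : μ (pball X r) < ∞ :=
  (measure_mono (pball_subset_closedPball X r)).trans_lt (isCompact_closedPball X r).measure_lt_top

lemma mem_support_iff_pball {μ : Measure (PSpace n)} {X : PSpace n} :
    X ∈ μ.support ↔ ∀ r > 0, 0 < μ (pball X r) := by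
  rw [Measure.mem_support_iff_forall]
  refine ⟨fun h r hr => h _ (pball_mem_nhds X hr), fun h U hU => ?_⟩
  obtain ⟨r, hr, hs⟩ := exists_pball_subset hU
  exact (h r hr).trans_le (measure_mono hs)

lemma exists_mem_support_of_pos {μ : Measure (PSpace n)} {X : PSpace n} {r : ℝ}
    (h : 0 < μ (pball X r)) : ∃ Y ∈ μ.support, pnorm (X - Y) < r := by
  obtain ⟨Y, hY, hs⟩ := Measure.nonempty_inter_support_of_pos h
  exact ⟨Y, hs, hY⟩

lemma ae_mem_support (μ : Measure (PSpace n)) : ∀ᵐ X ∂μ, X ∈ μ.support :=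
  Measure.support_mem_ae

/-! #### Dilations -/

/-- The parabolic dilation `(X, t) ↦ (s X, s² t)`. -/
noncomputable def dil (s : ℝ) (X : PSpace n) : PSpace n := (s • X.1, s ^ 2 * X.2)

@[simp] lemma dil_fst (s : ℝ) (X : PSpace n) : (dil s X).1 = s • X.1 := rfl

@[simp] lemma dil_snd (s : ℝ) (X : PSpace n) : (dil s X).2 = s ^ 2 * X.2 := rfl

@[simp] lemma dil_one (X : PSpace n) : dil 1 X = X := by ext1 <;> simp

@[simp] lemma dil_zero (s : ℝ) : dil s (0 : PSpace n) = 0 := by ext1 <;> simp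

lemma dil_dil (s r : ℝ) (X : PSpace n) : dil s (dil r X) = dil (s * r) X := by
  ext1
  · simp [smul_smul]
  · simp only [dil_snd]; ring

lemma dil_add (s : ℝ) (X Y : PSpace n) : dil s (X + Y) = dil s X + dil s Y := by
  ext1
  · simp
  · simp only [dil_snd, Prod.snd_add]; ring

lemma dil_neg (s : ℝ) (X : PSpace n) : dil s (-X) = -dil s X := by
  ext1 <;> simp

lemma dil_sub (s : ℝ) (X Y : PSpace n) : dil s (X - Y) = dil s X - dil s Y := by
  rw [sub_eq_add_neg, dil_add, dil_neg, ← sub_eq_add_neg]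

lemma pnorm_dil {s : ℝ} (hs : 0 ≤ s) (X : PSpace n) : pnorm (dil s X) = s * pnorm X := by
  rw [pnorm, dil_fst, dil_snd, norm_smul, abs_mul, Real.norm_of_nonneg hs, abs_of_nonneg (sq_nonneg s),
    mul_pow, ← mul_add, Real.sqrt_mul (sq_nonneg s), Real.sqrt_sq hs]
  rfl

lemma contDiff_dil (s : ℝ) {m : WithTop ℕ∞} : ContDiff ℝ m (dil s : PSpace n → PSpace n) := by
  unfold dil; fun_prop

lemma continuous_dil (s : ℝ) : Continuous (dil s : PSpace n → PSpace n) :=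
  (contDiff_dil s (m := 0)).continuous

/-- The change of variables `Z ↦ dil r⁻¹ (Z - Y)`, that maps `B(Y, r)` onto `B(0, 1)`. -/
noncomputable def zoom (Y : PSpace n) (r : ℝ) (hr : 0 < r) : PSpace n ≃ₜ PSpace n where
  toFun Z := dil r⁻¹ (Z - Y)
  invFun Z := Y + dil r Z
  left_inv Z := by simp [dil_dil, hr.ne']
  right_inv Z := by simp [dil_dil, hr.ne']
  continuous_toFun := (continuous_dil _).comp (by fun_prop)
  continuous_invFun := continuous_const.add (continuous_dil _)

/-- The rescaled measure `r^{-(k+2)} (zoom Y r)_* μ`. -/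
noncomputable def resc (k : ℕ) (μ : Measure (PSpace n)) (Y : PSpace n) (r : ℝ) : Measure (PSpace n) :=
  ENNReal.ofReal (r ^ (k + 2))⁻¹ • μ.map (fun Z => dil r⁻¹ (Z - Y))

section Rescaling

variable {k : ℕ} {μ : Measure (PSpace n)} {Y : PSpace n} {r : ℝ}

lemma resc_apply (hr : 0 < r) (s : Set (PSpace n)) :
    resc k μ Y r s = ENNReal.ofReal (r ^ (k + 2))⁻¹ * μ ((fun Z => dil r⁻¹ (Z - Y)) ⁻¹' s) := by
  rw [resc, Measure.smul_apply, smul_eq_mul]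
  congr 1
  exact (zoom Y r hr).measurableEmbedding.map_apply μ s

lemma zoom_preimage_pball (hr : 0 < r) (X : PSpace n) (ρ : ℝ) :
    (fun Z => dil r⁻¹ (Z - Y)) ⁻¹' pball X ρ = pball (Y + dil r X) (r * ρ) := by
  ext Z
  have : Y + dil r X - Z = dil r (X - dil r⁻¹ (Z - Y)) := by
    rw [dil_sub, dil_dil, mul_inv_cancel₀ hr.ne', dil_one]; abel
  rw [mem_preimage, mem_pball, mem_pball, this, pnorm_dil hr.le, mul_lt_mul_iff_right₀ hr]

lemma resc_pball (hr : 0 < r) (X : PSpace n) (ρ : ℝ) :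
    resc k μ Y r (pball X ρ) =
      ENNReal.ofReal (r ^ (k + 2))⁻¹ * μ (pball (Y + dil r X) (r * ρ)) := by
  rw [resc_apply hr, zoom_preimage_pball hr]

lemma mem_support_resc (hr : 0 < r) {X : PSpace n} :
    X ∈ (resc k μ Y r).support ↔ Y + dil r X ∈ μ.support := by
  have hc : ENNReal.ofReal (r ^ (k + 2))⁻¹ ≠ 0 := by
    simp only [ne_eq, ENNReal.ofReal_eq_zero, not_le]; positivity
  simp only [mem_support_iff_pball, resc_pball hr]
  constructor
  · intro h ρ hρ
    have := h (r⁻¹ * ρ) (by positivity)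
    rw [← mul_assoc, mul_inv_cancel₀ hr.ne', one_mul] at this
    exact pos_of_mul_pos_right this zero_le
  · intro h ρ hρ
    exact ENNReal.mul_pos hc (h _ (by positivity)).ne'

lemma integral_resc (hr : 0 < r) (f : PSpace n → ℝ) :
    ∫ Z, f Z ∂(resc k μ Y r) = (r ^ (k + 2))⁻¹ * ∫ Z, f (dil r⁻¹ (Z - Y)) ∂μ := by
  rw [resc, integral_smul_measure, ENNReal.toReal_ofReal (by positivity), smul_eq_mul]
  congr 1
  exact (zoom Y r hr).measurableEmbedding.integral_map f

lemma lintegral_resc (hr : 0 < r) (f : PSpace n → ℝ≥0∞) :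
    ∫⁻ Z, f Z ∂(resc k μ Y r) =
      ENNReal.ofReal (r ^ (k + 2))⁻¹ * ∫⁻ Z, f (dil r⁻¹ (Z - Y)) ∂μ := by
  rw [resc, lintegral_smul_measure, smul_eq_mul]
  congr 1
  exact (zoom Y r hr).measurableEmbedding.lintegral_map f

lemma setLIntegral_resc_pball (hr : 0 < r) (f : PSpace n → ℝ≥0∞) (X : PSpace n) (ρ : ℝ) :
    ∫⁻ Z in pball X ρ, f Z ∂(resc k μ Y r) = ENNReal.ofReal (r ^ (k + 2))⁻¹ *
      ∫⁻ Z in pball (Y + dil r X) (r * ρ), f (dil r⁻¹ (Z - Y)) ∂μ := by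
  rw [← lintegral_indicator (measurableSet_pball _ _), lintegral_resc hr,
    ← lintegral_indicator (measurableSet_pball _ _), ← zoom_preimage_pball hr]
  rfl

lemma resc_resc (hr : 0 < r) {s : ℝ} (hs : 0 < s) (X : PSpace n) :
    resc k (resc k μ Y r) X s = resc k μ (Y + dil r X) (r * s) := by
  ext A hA
  rw [resc_apply hs, resc_apply hr, resc_apply (mul_pos hr hs), ← mul_assoc,
    ← ENNReal.ofReal_mul (by positivity), ← mul_inv, ← mul_pow, mul_comm s r]
  congr 2
  ext Z
  simp only [mem_preimage]
  congr! 1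
  rw [mul_inv, mul_comm, ← dil_dil, sub_add_eq_sub_sub, dil_sub r⁻¹ _ (dil r X), dil_dil r⁻¹ r,
    inv_mul_cancel₀ hr.ne', dil_one]

lemma isLocallyFiniteMeasure_resc [IsLocallyFiniteMeasure μ] (hr : 0 < r) :
    IsLocallyFiniteMeasure (resc k μ Y r) := by
  refine ⟨fun X => ⟨pball X 1, pball_mem_nhds X one_pos, ?_⟩⟩
  rw [resc_pball hr]
  exact ENNReal.mul_lt_top ENNReal.ofReal_lt_top (measure_pball_lt_top μ _ _)

end Rescaling

/-- Ahlfors–David regularity at all scales below `ρ`, where `ρ` need not be tied to the diameter of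
the support. -/
structure AdrTo (C₀ : ℝ) (k : ℕ) (μ : Measure (PSpace n)) (ρ : ℝ≥0∞) : Prop where
  locallyFinite : IsLocallyFiniteMeasure μ
  regular : ∀ X ∈ μ.support, ∀ r : ℝ, 0 < r → ENNReal.ofReal r < ρ →
    ENNReal.ofReal (C₀⁻¹ * r ^ (k + 2)) ≤ μ (pball X r) ∧
      μ (pball X r) ≤ ENNReal.ofReal (C₀ * r ^ (k + 2))

section AdrTo

variable {C₀ : ℝ} {k : ℕ} {μ : Measure (PSpace n)} {ρ : ℝ≥0∞}

lemma IsADR.adrTo (h : IsADR C₀ k μ) : AdrTo C₀ k μ (pdiam μ.support) :=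
  ⟨h.locallyFinite, h.regular⟩

lemma AdrTo.isADR (h : AdrTo C₀ k μ ∞) : IsADR C₀ k μ :=
  ⟨h.locallyFinite, fun X hX r hr _ => h.regular X hX r hr ENNReal.ofReal_lt_top⟩

lemma AdrTo.mono (h : AdrTo C₀ k μ ρ) {σ : ℝ≥0∞} (hσ : σ ≤ ρ) : AdrTo C₀ k μ σ :=
  ⟨h.locallyFinite, fun X hX r hr hlt => h.regular X hX r hr (hlt.trans_le hσ)⟩

lemma AdrTo.resc (h : AdrTo C₀ k μ ρ) (Y : PSpace n) {r : ℝ} (hr : 0 < r) {σ : ℝ≥0∞}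
    (hσ : ENNReal.ofReal r * σ ≤ ρ) : AdrTo C₀ k (resc k μ Y r) σ := by
  have := h.locallyFinite
  refine ⟨isLocallyFiniteMeasure_resc hr, fun X hX s hs hlt => ?_⟩
  rw [mem_support_resc hr] at hX
  have h1 := h.regular _ hX (r * s) (by positivity) (lt_of_lt_of_le (by
    rw [ENNReal.ofReal_mul hr.le]
    exact (ENNReal.mul_lt_mul_iff_right (by simpa using hr) ENNReal.ofReal_ne_top).2 hlt) hσ)
  have hr' : (0 : ℝ) < r ^ (k + 2) := by positivity
  rw [resc_pball hr]
  constructor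
  · refine le_trans ?_ (mul_le_mul_right h1.1 _)
    rw [← ENNReal.ofReal_mul (by positivity)]
    refine ENNReal.ofReal_le_ofReal (le_of_eq ?_)
    rw [mul_pow]; field_simp
  · refine (mul_le_mul_right h1.2 _).trans ?_
    rw [← ENNReal.ofReal_mul (by positivity)]
    refine ENNReal.ofReal_le_ofReal (le_of_eq ?_)
    rw [mul_pow]; field_simp

end AdrTo

end ParabolicUR

/-! ### Vague limits of Ahlfors–David regular measures -/

namespace ParabolicUR

open Filter Topology
open scoped CompactlySupported

variable {n k : ℕ} {C₀ : ℝ}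

lemma hasCompactSupport_of_pnorm {f : PSpace n → ℝ} {X : PSpace n} {R : ℝ}
    (h : ∀ Y, f Y ≠ 0 → pnorm (X - Y) ≤ R) : HasCompactSupport f :=
  HasCompactSupport.of_support_subset_isCompact (isCompact_closedPball X R) fun Y hY => h Y hY

lemma exists_pball_of_hasCompactSupport {f : PSpace n → ℝ} (h : HasCompactSupport f) :
    ∃ R > 0, ∀ Y, f Y ≠ 0 → pnorm Y < R := by
  obtain ⟨R, hR⟩ := (h.image continuous_pnorm).bddAbove
  refine ⟨max R 0 + 1, by positivity, fun Y hY => ?_⟩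
  have := hR (mem_image_of_mem _ (subset_tsupport f hY))
  linarith [le_max_left R 0]

lemma integrable_of_hasCompactSupport (μ : Measure (PSpace n)) [IsLocallyFiniteMeasure μ]
    {f : PSpace n → ℝ} (hf : Continuous f) (h : HasCompactSupport f) : Integrable f μ :=
  hf.integrable_of_hasCompactSupport h

lemma abs_integral_le_of_pball (μ : Measure (PSpace n)) {f : PSpace n → ℝ} {X : PSpace n}
    {R M : ℝ} (h : ∀ Y, f Y ≠ 0 → pnorm (X - Y) < R) (hM : ∀ Y, |f Y| ≤ M)
    {A : ℝ} (hA : 0 ≤ A) (hμ : μ (pball X R) ≤ ENNReal.ofReal A) : |∫ Y, f Y ∂μ| ≤ M * A := by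
  have h0 : 0 ≤ M := (abs_nonneg _).trans (hM 0)
  rw [← setIntegral_eq_integral_of_forall_compl_eq_zero (s := pball X R)
    (fun Y hY => by by_contra h1; exact hY (h Y h1)), ← Real.norm_eq_abs]
  refine (norm_setIntegral_le_of_norm_le_const (C := M) (hμ.trans_lt ENNReal.ofReal_lt_top)
    fun Y _ => hM Y).trans ?_
  exact mul_le_mul_of_nonneg_left (ENNReal.toReal_le_of_le_ofReal hA hμ) h0

/-- A continuous cutoff that is `1` on `B(X, a)` and vanishes off `B(X, b)`. -/
noncomputable def tent (X : PSpace n) (a b : ℝ) (Y : PSpace n) : ℝ :=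
  max 0 (min 1 ((b - pnorm (X - Y)) / (b - a)))

lemma continuous_tent (X : PSpace n) (a b : ℝ) : Continuous (tent X a b) := by
  have := (continuous_pnorm (n := n)).comp (continuous_const.sub continuous_id : Continuous (X - ·))
  exact continuous_const.max (continuous_const.min ((continuous_const.sub this).div_const _))

lemma tent_nonneg (X : PSpace n) (a b : ℝ) (Y : PSpace n) : 0 ≤ tent X a b Y := le_max_left _ _

lemma tent_le_one (X : PSpace n) (a b : ℝ) (Y : PSpace n) : tent X a b Y ≤ 1 :=
  max_le zero_le_one (min_le_left _ _)

lemma tent_eq_one {X Y : PSpace n} {a b : ℝ} (hab : a < b) (h : pnorm (X - Y) ≤ a) :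
    tent X a b Y = 1 := by
  rw [tent, min_eq_left, max_eq_right zero_le_one]
  rw [one_le_div (by linarith)]; linarith

lemma tent_ne_zero {X Y : PSpace n} {a b : ℝ} (hab : a < b) (h : tent X a b Y ≠ 0) :
    pnorm (X - Y) < b := by
  by_contra! hb
  refine h (max_eq_left ((min_le_right _ _).trans ?_))
  exact div_nonpos_of_nonpos_of_nonneg (by linarith) (by linarith)

lemma hasCompactSupport_tent (X : PSpace n) {a b : ℝ} (hab : a < b) :
    HasCompactSupport (tent X a b) :=
  hasCompactSupport_of_pnorm fun _ hY => (tent_ne_zero hab hY).le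

lemma integral_tent_le (μ : Measure (PSpace n)) [IsLocallyFiniteMeasure μ] (X : PSpace n)
    {a b : ℝ} (hab : a < b) : ENNReal.ofReal (∫ Y, tent X a b Y ∂μ) ≤ μ (pball X b) := by
  rw [ofReal_integral_eq_lintegral_ofReal
    (integrable_of_hasCompactSupport μ (continuous_tent X a b) (hasCompactSupport_tent X hab))
    (Eventually.of_forall (tent_nonneg X a b)), ← lintegral_indicator_one (measurableSet_pball X b)]
  refine lintegral_mono fun Y => ?_
  by_cases h : Y ∈ pball X b
  · simpa [h] using tent_le_one X a b Y
  · have : tent X a b Y = 0 := by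
      by_contra h1; exact h (tent_ne_zero hab h1)
    simp [this]

lemma le_integral_tent (μ : Measure (PSpace n)) [IsLocallyFiniteMeasure μ] (X : PSpace n)
    {a b : ℝ} (hab : a < b) : μ (pball X a) ≤ ENNReal.ofReal (∫ Y, tent X a b Y ∂μ) := by
  rw [ofReal_integral_eq_lintegral_ofReal
    (integrable_of_hasCompactSupport μ (continuous_tent X a b) (hasCompactSupport_tent X hab))
    (Eventually.of_forall (tent_nonneg X a b)), ← lintegral_indicator_one (measurableSet_pball X a)]
  refine lintegral_mono fun Y => ?_
  by_cases h : Y ∈ pball X a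
  · simp [h, tent_eq_one hab (mem_pball.1 h).le]
  · simp [h]

/-- Vague convergence of measures along a filter. -/
def VagueLim {ι : Type*} (U : Filter ι) (m : ι → Measure (PSpace n)) (ν : Measure (PSpace n)) :
    Prop :=
  ∀ f : PSpace n → ℝ, Continuous f → HasCompactSupport f →
    Tendsto (fun i => ∫ Y, f Y ∂(m i)) U (𝓝 (∫ Y, f Y ∂ν))

lemma hasCompactSupport_comp_zoom {f : PSpace n → ℝ} (h : HasCompactSupport f) (Y : PSpace n)
    {r : ℝ} (hr : 0 < r) : HasCompactSupport fun Z => f (dil r⁻¹ (Z - Y)) :=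
  h.comp_homeomorph (zoom Y r hr)

lemma VagueLim.resc {ι : Type*} {U : Filter ι} {m : ι → Measure (PSpace n)}
    {ν : Measure (PSpace n)} (h : VagueLim U m ν) (Y : PSpace n) {r : ℝ} (hr : 0 < r) :
    VagueLim U (fun i => resc k (m i) Y r) (resc k ν Y r) := fun f hf hc => by
  simp only [integral_resc hr]
  exact (h _ (hf.comp (zoom Y r hr).continuous) (hasCompactSupport_comp_zoom hc Y hr)).const_mul _

section Limit

variable {ι : Type*} {m : ι → Measure (PSpace n)} {ν : Measure (PSpace n)}

lemma measure_pball_zero_le {μ : Measure (PSpace n)} {R : ℝ} (hR : 0 < R)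
    (h : AdrTo C₀ k μ (ENNReal.ofReal (R + 1))) (h0 : (0 : PSpace n) ∈ μ.support) :
    μ (pball 0 R) ≤ ENNReal.ofReal (C₀ * R ^ (k + 2)) :=
  (h.regular 0 h0 R hR (ENNReal.ofReal_lt_ofReal_iff'.2 ⟨by linarith, by linarith⟩)).2

/-- Measures that are uniformly regular at larger and larger scales converge along every
ultrafilter. -/
theorem exists_vagueLim (hC₀ : 0 < C₀) (U : Ultrafilter ι)
    (h : ∀ R : ℝ, ∀ᶠ i in U, AdrTo C₀ k (m i) (ENNReal.ofReal R))
    (h0 : ∀ᶠ i in U, (0 : PSpace n) ∈ (m i).support) :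
    ∃ ν : Measure (PSpace n), IsLocallyFiniteMeasure ν ∧ VagueLim U m ν := by
  have key : ∀ f : C_c(PSpace n, ℝ), ∃ l : ℝ, Tendsto (fun i => ∫ Y, f Y ∂(m i)) U (𝓝 l) := by
    intro f
    obtain ⟨R, hR, hf⟩ := exists_pball_of_hasCompactSupport f.hasCompactSupport
    obtain ⟨M, hM⟩ := f.hasCompactSupport.exists_bound_of_continuous f.continuous
    have hev : ∀ᶠ i in (U : Filter ι), (∫ Y, f Y ∂(m i)) ∈
        Icc (-(M * (C₀ * R ^ (k + 2)))) (M * (C₀ * R ^ (k + 2))) := by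
      filter_upwards [h (R + 1), h0] with i hi hi0
      exact abs_le.1 (abs_integral_le_of_pball (m i) (X := 0) (R := R) (by simpa using hf) hM
        (by positivity) (measure_pball_zero_le hR hi hi0))
    obtain ⟨l, -, hl⟩ := isCompact_Icc.ultrafilter_le_nhds (U.map fun i => ∫ Y, f Y ∂(m i))
      (le_principal_iff.2 hev)
    exact ⟨l, hl⟩
  choose L hL using key
  have hint : ∀ f : C_c(PSpace n, ℝ), ∀ᶠ i in (U : Filter ι), Integrable f (m i) := fun f => by
    filter_upwards [h 0] with i hi
    have := hi.locallyFinite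
    exact integrable_of_hasCompactSupport _ f.continuous f.hasCompactSupport
  let Λ : C_c(PSpace n, ℝ) →ₚ[ℝ] ℝ := PositiveLinearMap.mk₀
    { toFun := L
      map_add' := fun f g => by
        refine tendsto_nhds_unique (hL (f + g)) (((hL f).add (hL g)).congr' ?_)
        filter_upwards [hint f, hint g] with i hf hg
        exact (integral_add hf hg).symm
      map_smul' := fun c f => by
        refine tendsto_nhds_unique (hL (c • f)) (((hL f).const_mul c).congr fun i => ?_)
        exact (integral_const_mul c _).symm }
    (fun f hf => ge_of_tendsto (hL f) (Eventually.of_forall fun i => integral_nonneg hf))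
  have hreg : (RealRMK.rieszMeasure Λ).Regular := inferInstance
  refine ⟨RealRMK.rieszMeasure Λ, inferInstance, fun f hf hc => ?_⟩
  have := RealRMK.integral_rieszMeasure Λ ⟨⟨f, hf⟩, hc⟩
  have h2 : ∫ Y, f Y ∂(RealRMK.rieszMeasure Λ) = L ⟨⟨f, hf⟩, hc⟩ := this
  rw [h2]
  exact hL ⟨⟨f, hf⟩, hc⟩

/-- Points of the support of a vague limit are limits of points of the supports. -/
lemma VagueLim.exists_near [IsLocallyFiniteMeasure ν] {U : Filter ι} (hν : VagueLim U m ν)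
    {X : PSpace n} (hX : X ∈ ν.support) {ρ : ℝ} (hρ : 0 < ρ) :
    ∀ᶠ i in U, ∃ Y ∈ (m i).support, pnorm (X - Y) < ρ := by
  have hab : ρ / 2 < ρ := by linarith
  have h1 : 0 < ∫ Y, tent X (ρ / 2) ρ Y ∂ν := by
    have := ((mem_support_iff_pball.1 hX) (ρ / 2) (by positivity)).trans_le
      (le_integral_tent ν X hab)
    simpa using this
  filter_upwards [(hν _ (continuous_tent X _ _) (hasCompactSupport_tent X hab)).eventually_const_lt
    h1] with i hi
  refine exists_mem_support_of_pos (pos_iff_ne_zero.2 fun h0 => hi.ne' ?_)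
  refine integral_eq_zero_of_ae ?_
  filter_upwards [measure_eq_zero_iff_ae_notMem.1 h0] with Y hY
  by_contra h2
  exact hY (tent_ne_zero hab h2)

lemma VagueLim.lower [IsLocallyFiniteMeasure ν] {U : Filter ι} [U.NeBot] (hν : VagueLim U m ν)
    (h : ∀ R : ℝ, ∀ᶠ i in U, AdrTo C₀ k (m i) (ENNReal.ofReal R)) {X : PSpace n}
    (hX : ∀ ρ > 0, ∀ᶠ i in U, ∃ Y ∈ (m i).support, pnorm (X - Y) < ρ) {r : ℝ} (hr : 0 < r) :
    ENNReal.ofReal (C₀⁻¹ * r ^ (k + 2)) ≤ ν (pball X r) := by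
  have hlim : Tendsto (fun a : ℝ => ENNReal.ofReal (C₀⁻¹ * a ^ (k + 2))) (𝓝[<] r)
      (𝓝 (ENNReal.ofReal (C₀⁻¹ * r ^ (k + 2)))) :=
    (ENNReal.continuous_ofReal.comp (by fun_prop : Continuous fun a : ℝ => C₀⁻¹ * a ^ (k + 2))
      ).continuousAt.continuousWithinAt
  refine le_of_tendsto hlim ?_
  filter_upwards [Ioo_mem_nhdsLT hr] with a ha
  have hab : (a + r) / 2 < r := by linarith [ha.2]
  refine le_trans ?_ (integral_tent_le ν X hab)
  refine ge_of_tendsto ((ENNReal.continuous_ofReal.tendsto _).comp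
    (hν _ (continuous_tent X _ _) (hasCompactSupport_tent X hab))) ?_
  filter_upwards [h (a + 1), hX ((r - a) / 2) (by linarith [ha.2])] with i hi ⟨Y, hY, hXY⟩
  have := hi.locallyFinite
  refine le_trans ?_ (le_integral_tent (m i) X hab)
  refine (hi.regular Y hY a ha.1 (ENNReal.ofReal_lt_ofReal_iff'.2
    ⟨by linarith, by linarith [ha.1]⟩)).1.trans (measure_mono (pball_subset_pball ?_))
  linarith

lemma VagueLim.upper [IsLocallyFiniteMeasure ν] {U : Filter ι} [U.NeBot] (hν : VagueLim U m ν)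
    (h : ∀ R : ℝ, ∀ᶠ i in U, AdrTo C₀ k (m i) (ENNReal.ofReal R)) {X : PSpace n}
    (hX : ∀ ρ > 0, ∀ᶠ i in U, ∃ Y ∈ (m i).support, pnorm (X - Y) < ρ) {r : ℝ} (hr : 0 < r) :
    ν (pball X r) ≤ ENNReal.ofReal (C₀ * r ^ (k + 2)) := by
  have hU : pball X r = ⋃ j : ℕ, pball X (r - 1 / ((j : ℝ) + 1)) := by
    ext Y
    simp only [mem_iUnion, mem_pball]
    constructor
    · intro hY
      obtain ⟨j, hj⟩ := exists_nat_one_div_lt (sub_pos.2 hY)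
      exact ⟨j, by linarith⟩
    · rintro ⟨j, hj⟩
      have : (0 : ℝ) < 1 / ((j : ℝ) + 1) := by positivity
      linarith
  have hmono : Monotone fun j : ℕ => pball X (r - 1 / ((j : ℝ) + 1)) := fun i j hij =>
    pball_mono (sub_le_sub_left (one_div_le_one_div_of_le (by positivity) (by gcongr)) _)
  rw [hU, hmono.measure_iUnion]
  refine iSup_le fun j => ?_
  set a := r - 1 / ((j : ℝ) + 1)
  have har : a < r := sub_lt_self _ (by positivity)
  have hab : a < (a + r) / 2 := by linarith
  refine (le_integral_tent ν X hab).trans ?_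
  refine le_of_tendsto ((ENNReal.continuous_ofReal.tendsto _).comp
    (hν _ (continuous_tent X _ _) (hasCompactSupport_tent X hab))) ?_
  filter_upwards [h (r + 1), hX ((r - a) / 2) (by linarith)] with i hi ⟨Y, hY, hXY⟩
  have := hi.locallyFinite
  refine (integral_tent_le (m i) X hab).trans (le_trans (measure_mono (pball_subset_pball ?_))
    (hi.regular Y hY r hr (ENNReal.ofReal_lt_ofReal_iff'.2 ⟨by linarith, by linarith⟩)).2)
  rw [pnorm_sub_comm]; linarith

/-- A vague limit of measures that are regular at larger and larger scales is regular at all scales,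
with the same constant. -/
theorem VagueLim.adrTo [IsLocallyFiniteMeasure ν] {U : Filter ι} [U.NeBot] (hν : VagueLim U m ν)
    (h : ∀ R : ℝ, ∀ᶠ i in U, AdrTo C₀ k (m i) (ENNReal.ofReal R)) : AdrTo C₀ k ν ∞ :=
  ⟨inferInstance, fun _ hX _ hr _ => ⟨hν.lower h (fun _ hρ => hν.exists_near hX hρ) hr,
    hν.upper h (fun _ hρ => hν.exists_near hX hρ) hr⟩⟩

lemma VagueLim.zero_mem_support (hC₀ : 0 < C₀) [IsLocallyFiniteMeasure ν] {U : Filter ι} [U.NeBot]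
    (hν : VagueLim U m ν) (h : ∀ R : ℝ, ∀ᶠ i in U, AdrTo C₀ k (m i) (ENNReal.ofReal R))
    (h0 : ∀ᶠ i in U, (0 : PSpace n) ∈ (m i).support) : (0 : PSpace n) ∈ ν.support := by
  refine mem_support_iff_pball.2 fun r hr => lt_of_lt_of_le ?_ (hν.lower h (fun ρ hρ => ?_) hr)
  · simp only [ENNReal.ofReal_pos]; positivity
  · filter_upwards [h0] with i hi
    exact ⟨0, hi, by simpa using hρ⟩

/-- The test functions of the transport distance at scale one, up to a fixed enlargement of the ball
that makes the class serve all nearby balls at once. -/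
structure LipTest (f : PSpace n → ℝ) : Prop where
  supp : ∀ Y, f Y ≠ 0 → pnorm Y < 2
  lip : ∀ Y Z, |f Y - f Z| ≤ pnorm (Y - Z)

lemma continuous_of_abs_sub_le {f : PSpace n → ℝ} {L : ℝ}
    (h : ∀ Y Z, |f Y - f Z| ≤ L * pnorm (Y - Z)) : Continuous f := by
  refine continuous_iff_continuousAt.2 fun X => ?_
  rw [ContinuousAt, tendsto_iff_dist_tendsto_zero]
  refine squeeze_zero (fun _ => dist_nonneg) (fun Y => h Y X) ?_
  have hc : Continuous fun Y : PSpace n => L * pnorm (Y - X) :=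
    continuous_const.mul (continuous_pnorm.comp (by fun_prop))
  simpa using hc.tendsto X

namespace LipTest

variable {f g : PSpace n → ℝ}

lemma continuous (hf : LipTest f) : Continuous f :=
  continuous_of_abs_sub_le (L := 1) (by simpa using hf.lip)

lemma hasCompactSupport (hf : LipTest f) : HasCompactSupport f :=
  hasCompactSupport_of_pnorm (X := 0) (R := 2) fun Y hY => by simpa using (hf.supp Y hY).le

lemma abs_le (hf : LipTest f) (Y : PSpace n) : |f Y| ≤ 4 := by
  by_cases h : f Y = 0
  · simp [h]
  have hp : pnorm ((0, 4) : PSpace n) = 2 := by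
    rw [pnorm, show ‖((0, 4) : PSpace n).1‖ ^ 2 + |((0, 4) : PSpace n).2| = 2 ^ 2 by norm_num]
    exact Real.sqrt_sq (by norm_num)
  have h0 : f (0, 4) = 0 := by
    by_contra h1
    have := hf.supp _ h1
    linarith
  have h1 := hf.lip Y (0, 4)
  have h2 := pnorm_sub_le Y 0 ((0, 4) : PSpace n)
  have h3 := hf.supp Y h
  rw [h0, sub_zero] at h1
  simp only [sub_zero, zero_sub, pnorm_neg] at h2
  linarith

lemma zero : LipTest (0 : PSpace n → ℝ) :=
  ⟨fun _ h => absurd rfl h, fun Y Z => by simpa using pnorm_nonneg (Y - Z)⟩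

end LipTest

lemma abs_integral_sub_le {μ : Measure (PSpace n)} [IsLocallyFiniteMeasure μ] {f g : PSpace n → ℝ}
    (hf : LipTest f) (hg : LipTest g) {η M : ℝ} (hM : 0 ≤ M) (h : ∀ Y, |f Y - g Y| ≤ η)
    (hμ : μ (pball 0 2) ≤ ENNReal.ofReal M) : |∫ Y, f Y ∂μ - ∫ Y, g Y ∂μ| ≤ η * M := by
  rw [← integral_sub (integrable_of_hasCompactSupport μ hf.continuous hf.hasCompactSupport)
    (integrable_of_hasCompactSupport μ hg.continuous hg.hasCompactSupport)]
  refine abs_integral_le_of_pball μ (X := 0) (R := 2) (fun Y hY => ?_) h hM hμ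
  rw [zero_sub, pnorm_neg]
  by_contra hY2
  have h1 : f Y = 0 := by by_contra h1; exact hY2 (hf.supp Y h1)
  have h2 : g Y = 0 := by by_contra h1; exact hY2 (hg.supp Y h1)
  exact hY (by rw [h1, h2, sub_zero])

/-- Along an ultrafilter, vague convergence is uniform over the Lipschitz test functions: these
form a compact family. -/
theorem VagueLim.eventually_lipTest [IsLocallyFiniteMeasure ν] {U : Ultrafilter ι}
    (hν : VagueLim U m ν) {M : ℝ} (hm : ∀ᶠ i in U, IsLocallyFiniteMeasure (m i))
    (hM : ∀ᶠ i in U, m i (pball 0 2) ≤ ENNReal.ofReal M) {ε : ℝ} (hε : 0 < ε) :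
    ∀ᶠ i in U, ∀ f, LipTest f → |∫ Y, f Y ∂(m i) - ∫ Y, f Y ∂ν| ≤ ε := by
  by_contra hcon
  rw [← Ultrafilter.eventually_not] at hcon
  have hch : ∀ i, ∃ f, LipTest f ∧
      ((¬ ∀ f, LipTest f → |∫ Y, f Y ∂(m i) - ∫ Y, f Y ∂ν| ≤ ε) →
        ε < |∫ Y, f Y ∂(m i) - ∫ Y, f Y ∂ν|) := by
    intro i
    by_cases h : ∀ f, LipTest f → |∫ Y, f Y ∂(m i) - ∫ Y, f Y ∂ν| ≤ ε
    · exact ⟨0, LipTest.zero, fun h1 => absurd h h1⟩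
    · push Not at h
      obtain ⟨f, hf, h⟩ := h
      exact ⟨f, hf, fun _ => h⟩
  choose F hF hFε using hch
  have key : ∀ Y, ∃ l : ℝ, Tendsto (fun i => F i Y) U (𝓝 l) := fun Y => by
    obtain ⟨l, -, hl⟩ := isCompact_Icc.ultrafilter_le_nhds (U.map fun i => F i Y)
      (le_principal_iff.2 (show ∀ᶠ i in (U : Filter ι), F i Y ∈ Icc (-4 : ℝ) 4 from
        Eventually.of_forall fun i => _root_.abs_le.1 ((hF i).abs_le Y)))
    exact ⟨l, hl⟩
  choose f hf using key
  have hfL : LipTest f := by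
    refine ⟨fun Y hY => ?_, fun Y Z => ?_⟩
    · by_contra h
      refine hY (tendsto_nhds_unique (hf Y) (tendsto_const_nhds.congr fun i => ?_))
      by_contra h1
      exact h ((hF i).supp Y (Ne.symm h1))
    · exact le_of_tendsto ((hf Y).sub (hf Z)).abs (Eventually.of_forall fun i => (hF i).lip Y Z)
  set M' : ℝ := max M (ν (pball 0 2)).toReal
  have hM'0 : 0 ≤ M' := ENNReal.toReal_nonneg.trans (le_max_right _ _)
  have hνM : ν (pball 0 2) ≤ ENNReal.ofReal M' := by
    rw [← ENNReal.ofReal_toReal (measure_pball_lt_top ν 0 2).ne]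
    exact ENNReal.ofReal_le_ofReal (le_max_right _ _)
  obtain ⟨η, hη, hηε⟩ : ∃ η > 0, 3 * η * M' * 2 < ε / 2 := by
    refine ⟨ε / (24 * (M' + 1)), by positivity, ?_⟩
    have : 3 * (ε / (24 * (M' + 1))) * M' * 2 = ε / 4 * (M' / (M' + 1)) := by field_simp; ring
    rw [this]
    have : M' / (M' + 1) ≤ 1 := by rw [div_le_one (by positivity)]; linarith
    nlinarith
  obtain ⟨t, -, ht⟩ := (isCompact_closedPball (0 : PSpace n) 2).elim_nhds_subcover
    (fun c => pball c η) (fun c _ => pball_mem_nhds c hη)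
  have hev : ∀ᶠ i in (U : Filter ι), ∀ c ∈ t, |F i c - f c| ≤ η := by
    rw [Finset.eventually_all]
    intro c _
    have := (tendsto_iff_dist_tendsto_zero.1 (hf c)).eventually (gt_mem_nhds hη)
    filter_upwards [this] with i hi
    exact hi.le
  have hev2 : ∀ᶠ i in (U : Filter ι), |∫ Y, f Y ∂(m i) - ∫ Y, f Y ∂ν| < ε / 2 :=
    (tendsto_iff_dist_tendsto_zero.1 (hν f hfL.continuous hfL.hasCompactSupport)).eventually
      (gt_mem_nhds (half_pos hε))
  obtain ⟨i, h1, h2, h3, h4, h5⟩ :=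
    (hcon.and (hev.and (hev2.and (hm.and hM)))).exists
  have hunif : ∀ Y, |F i Y - f Y| ≤ 3 * η := by
    intro Y
    by_cases hY : pnorm Y ≤ 2
    · have hY' : Y ∈ {Y | pnorm ((0 : PSpace n) - Y) ≤ 2} := by simpa using hY
      obtain ⟨c, hc, hcY⟩ := mem_iUnion₂.1 (ht hY')
      have e1 := (hF i).lip Y c
      have e2 := hfL.lip c Y
      have e3 := h2 c hc
      have e4 : pnorm (c - Y) < η := hcY
      rw [pnorm_sub_comm] at e1
      rw [_root_.abs_le] at *
      constructor <;> linarith [e1.1, e1.2, e2.1, e2.2, e3.1, e3.2]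
    · have e1 : F i Y = 0 := by by_contra h; exact hY ((hF i).supp Y h).le
      have e2 : f Y = 0 := by by_contra h; exact hY (hfL.supp Y h).le
      rw [e1, e2]; simpa using hη.le
  have a1 := abs_integral_sub_le (hF i) hfL hM'0 hunif
    (h5.trans (ENNReal.ofReal_le_ofReal (le_max_left _ _)))
  have a2 := abs_integral_sub_le (hF i) hfL hM'0 hunif hνM
  have a3 := hFε i h1
  have := abs_sub_le (∫ Y, F i Y ∂(m i)) (∫ Y, f Y ∂(m i)) (∫ Y, F i Y ∂ν)
  have := abs_sub_le (∫ Y, f Y ∂(m i)) (∫ Y, f Y ∂ν) (∫ Y, F i Y ∂ν)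
  rw [abs_sub_comm (∫ Y, f Y ∂ν)] at this
  linarith

end Limit

end ParabolicUR

/-! ### Odd bumps, spatial symmetry and translation invariance -/

namespace ParabolicUR

open Filter Topology
open scoped CompactlySupported ContDiff

variable {n k : ℕ} {C₀ : ℝ}

/-- The smooth gauge `|X|⁴ + t²`, comparable to `‖𝐗‖⁴`. -/
noncomputable def quart (X : PSpace n) : ℝ := (‖X.1‖ ^ 2) ^ 2 + X.2 ^ 2

lemma contDiff_quart : ContDiff ℝ ∞ (quart : PSpace n → ℝ) := by
  unfold quart
  exact ((contDiff_fst.norm_sq ℝ).pow 2).add (contDiff_snd.pow 2)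

lemma quart_le (X : PSpace n) : quart X ≤ pnorm X ^ 4 := by
  have h := pnorm_sq X
  have : pnorm X ^ 4 = (‖X.1‖ ^ 2 + |X.2|) ^ 2 := by rw [← h]; ring
  rw [this, quart, ← sq_abs X.2]
  nlinarith [mul_nonneg (sq_nonneg ‖X.1‖) (abs_nonneg X.2)]

lemma le_quart (X : PSpace n) : pnorm X ^ 4 ≤ 2 * quart X := by
  have h := pnorm_sq X
  have : pnorm X ^ 4 = (‖X.1‖ ^ 2 + |X.2|) ^ 2 := by rw [← h]; ring
  rw [this, quart, ← sq_abs X.2]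
  nlinarith [sq_nonneg (‖X.1‖ ^ 2 - |X.2|)]

lemma quart_reflect (x : EuclideanSpace ℝ (Fin n)) (t : ℝ) : quart (-x, t) = quart (x, t) := by
  simp [quart]

/-- A smooth cutoff that vanishes for `quart ≤ c` and is `1` for `quart ≥ 2c`. -/
noncomputable def lowCut (c : ℝ) (X : PSpace n) : ℝ := Real.smoothTransition (quart X / c - 1)

/-- A smooth cutoff that is `1` for `quart ≤ c` and vanishes for `quart ≥ 2c`. -/
noncomputable def highCut (c : ℝ) (X : PSpace n) : ℝ := Real.smoothTransition (2 - quart X / c)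

lemma contDiff_lowCut (c : ℝ) : ContDiff ℝ ∞ (lowCut c : PSpace n → ℝ) :=
  Real.smoothTransition.contDiff.comp ((contDiff_quart.div_const c).sub contDiff_const)

lemma contDiff_highCut (c : ℝ) : ContDiff ℝ ∞ (highCut c : PSpace n → ℝ) :=
  Real.smoothTransition.contDiff.comp (contDiff_const.sub (contDiff_quart.div_const c))

lemma lt_quart_of_lowCut {c : ℝ} (hc : 0 < c) {X : PSpace n} (h : lowCut c X ≠ 0) :
    c < quart X := by
  by_contra! h1
  refine h (Real.smoothTransition.zero_of_nonpos ?_)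
  have : quart X / c ≤ 1 := by rw [div_le_one hc]; exact h1
  linarith

lemma lowCut_eq_one {c : ℝ} (hc : 0 < c) {X : PSpace n} (h : 2 * c ≤ quart X) :
    lowCut c X = 1 := by
  refine Real.smoothTransition.one_of_one_le ?_
  have : 2 ≤ quart X / c := by rw [le_div_iff₀ hc]; exact h
  linarith

lemma quart_lt_of_highCut {c : ℝ} (hc : 0 < c) {X : PSpace n} (h : highCut c X ≠ 0) :
    quart X < 2 * c := by
  by_contra! h1
  refine h (Real.smoothTransition.zero_of_nonpos ?_)
  have : 2 ≤ quart X / c := by rw [le_div_iff₀ hc]; exact h1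
  linarith

lemma highCut_eq_one {c : ℝ} (hc : 0 < c) {X : PSpace n} (h : quart X ≤ c) :
    highCut c X = 1 := by
  refine Real.smoothTransition.one_of_one_le ?_
  have : quart X / c ≤ 1 := by rw [div_le_one hc]; exact h
  linarith

lemma lowCut_mem (c : ℝ) (X : PSpace n) : lowCut c X ∈ Icc (0 : ℝ) 1 :=
  ⟨Real.smoothTransition.nonneg _, Real.smoothTransition.le_one _⟩

lemma highCut_mem (c : ℝ) (X : PSpace n) : highCut c X ∈ Icc (0 : ℝ) 1 :=
  ⟨Real.smoothTransition.nonneg _, Real.smoothTransition.le_one _⟩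

/-- Smooth functions, odd in the spatial variable and supported in a parabolic annulus. The dilates
of such a function can be summed to admissible kernels. -/
structure IsOddBump (ψ : PSpace n → ℝ) : Prop where
  smooth : ContDiff ℝ ∞ ψ
  odd : ∀ (x : EuclideanSpace ℝ (Fin n)) (t : ℝ), ψ (-x, t) = -ψ (x, t)
  annular : ∃ ρ : ℝ, 0 < ρ ∧ ∀ X, ψ X ≠ 0 → ρ < pnorm X ∧ pnorm X < ρ⁻¹

lemma isOddBump_of_bounds {ψ : PSpace n → ℝ} (hs : ContDiff ℝ ∞ ψ)
    (ho : ∀ (x : EuclideanSpace ℝ (Fin n)) (t : ℝ), ψ (-x, t) = -ψ (x, t)) {a b : ℝ} (ha : 0 < a)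
    (h : ∀ X, ψ X ≠ 0 → a < pnorm X ∧ pnorm X < b) : IsOddBump ψ := by
  refine ⟨hs, ho, min a (max b 1)⁻¹, lt_min ha (by positivity), fun X hX => ?_⟩
  refine ⟨(min_le_left _ _).trans_lt (h X hX).1, ((h X hX).2.trans_le (le_max_left b 1)).trans_le ?_⟩
  rw [le_inv_comm₀ (by positivity) (lt_min ha (by positivity))]
  exact min_le_right _ _

lemma IsOddBump.hasCompactSupport {ψ : PSpace n → ℝ} (h : IsOddBump ψ) : HasCompactSupport ψ := by
  obtain ⟨ρ, -, h⟩ := h.annular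
  exact hasCompactSupport_of_pnorm (X := 0) (R := ρ⁻¹) fun Y hY => by simpa using (h Y hY).2.le

/-- The spatial reflection `(y, s) ↦ (2x - y, s)` in the point `x`. -/
noncomputable def refl (x : EuclideanSpace ℝ (Fin n)) (Y : PSpace n) : PSpace n :=
  ((2 : ℝ) • x - Y.1, Y.2)

lemma contDiff_refl (x : EuclideanSpace ℝ (Fin n)) : ContDiff ℝ ∞ (refl x) := by
  unfold refl; fun_prop

lemma refl_refl (x y : EuclideanSpace ℝ (Fin n)) (Y : PSpace n) :
    refl x (refl y Y) = Y + ((2 : ℝ) • (x - y), 0) := by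
  ext1
  · simp only [refl, Prod.fst_add, smul_sub]; abel
  · simp [refl]

/-- The reflection as a homeomorphism. -/
noncomputable def reflHomeo (x : EuclideanSpace ℝ (Fin n)) : PSpace n ≃ₜ PSpace n where
  toFun := refl x
  invFun := refl x
  left_inv Y := by simp [refl_refl]
  right_inv Y := by simp [refl_refl]
  continuous_toFun := (contDiff_refl x).continuous
  continuous_invFun := (contDiff_refl x).continuous

/-- If the convolutions of `ν` with all odd bumps vanish at `X`, then `ν` does not distinguish a
smooth test function from its reflection in `X`. -/
lemma integral_refl_of_smooth (ν : Measure (PSpace n)) [IsLocallyFiniteMeasure ν] (X : PSpace n)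
    (h : ∀ ψ : PSpace n → ℝ, IsOddBump ψ → ∫ Y, ψ (X - Y) ∂ν = 0)
    {f : PSpace n → ℝ} (hf : ContDiff ℝ ∞ f) (hc : HasCompactSupport f) :
    ∫ Y, f (refl X.1 Y) ∂ν = ∫ Y, f Y ∂ν := by
  have hfr : Continuous fun Y => f (refl X.1 Y) := hf.continuous.comp (contDiff_refl _).continuous
  have hcr : HasCompactSupport fun Y => f (refl X.1 Y) := hc.comp_homeomorph (reflHomeo X.1)
  have hi1 := integrable_of_hasCompactSupport ν hf.continuous hc
  have hi2 := integrable_of_hasCompactSupport ν hfr hcr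
  set g : PSpace n → ℝ := fun Z => f (X - Z) - f (refl X.1 (X - Z)) with hg
  have hgs : ContDiff ℝ ∞ g :=
    (hf.comp (contDiff_const.sub contDiff_id)).sub
      (hf.comp ((contDiff_refl _).comp (contDiff_const.sub contDiff_id)))
  have hgo : ∀ (x : EuclideanSpace ℝ (Fin n)) (t : ℝ), g (-x, t) = -g (x, t) := by
    intro x t
    have e1 : X - (-x, t) = refl X.1 (X - (x, t)) := by
      ext1
      · simp only [refl, Prod.fst_sub, two_smul]; abel
      · simp [refl]
    have e2 : refl X.1 (X - (-x, t)) = X - (x, t) := by rw [e1, refl_refl]; simp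
    simp only [hg]
    rw [e2, e1]; ring
  have hgX : ∀ Y, g (X - Y) = f Y - f (refl X.1 Y) := fun Y => by simp [hg]
  obtain ⟨R, hR, hgR⟩ : ∃ R > 0, ∀ Z, g Z ≠ 0 → pnorm Z < R := by
    refine exists_pball_of_hasCompactSupport ?_
    have h1 : HasCompactSupport fun Y => f Y - f (refl X.1 Y) := hc.sub hcr
    exact h1.comp_homeomorph (Homeomorph.subLeft X)
  -- cutting `g` off near the origin gives odd bumps; the cutoffs tend to `1` where `g ≠ 0`, since
  -- `g 0 = 0`
  have hzero : ∀ j : ℕ, ∫ Y, lowCut (1 / ((j : ℝ) + 1)) (X - Y) * g (X - Y) ∂ν = 0 := by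
    intro j
    have hcj : (0 : ℝ) < 1 / ((j : ℝ) + 1) := by positivity
    refine h (fun Z => lowCut (1 / ((j : ℝ) + 1)) Z * g Z) ?_
    obtain ⟨a, ha, hac⟩ : ∃ a : ℝ, 0 < a ∧ a ^ 4 = 1 / ((j : ℝ) + 1) :=
      ⟨(1 / ((j : ℝ) + 1)) ^ ((1 : ℝ) / 4), Real.rpow_pos_of_pos hcj _, by
        rw [← Real.rpow_natCast, ← Real.rpow_mul hcj.le]; norm_num⟩
    refine isOddBump_of_bounds (a := a) (b := R) ((contDiff_lowCut _).mul hgs) (fun x t => ?_) ha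
      fun Z hZ => ⟨?_, hgR Z (right_ne_zero_of_mul hZ)⟩
    · rw [hgo, lowCut, lowCut, quart_reflect]; ring
    · have h1 := lt_quart_of_lowCut hcj (left_ne_zero_of_mul hZ)
      refine lt_of_pow_lt_pow_left₀ 4 (pnorm_nonneg Z) ?_
      rw [hac]; exact h1.trans_le (quart_le Z)
  have hlim : Tendsto (fun j : ℕ => ∫ Y, lowCut (1 / ((j : ℝ) + 1)) (X - Y) * g (X - Y) ∂ν) atTop
      (𝓝 (∫ Y, g (X - Y) ∂ν)) := by
    refine tendsto_integral_of_dominated_convergence (fun Y => |g (X - Y)|) (fun j => ?_) ?_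
      (fun j => Eventually.of_forall fun Y => ?_) (Eventually.of_forall fun Y => ?_)
    · exact (((contDiff_lowCut _).continuous.comp (by fun_prop)).mul
        (hgs.continuous.comp (by fun_prop))).aestronglyMeasurable
    · simp only [hgX]; exact (hi1.sub hi2).abs
    · rw [norm_mul, Real.norm_eq_abs, Real.norm_eq_abs, abs_of_nonneg (lowCut_mem _ _).1]
      exact mul_le_of_le_one_left (abs_nonneg _) (lowCut_mem _ _).2
    · by_cases hXY : X - Y = 0
      · have : g (X - Y) = 0 := by
          have := hgo 0 0
          rw [hXY, show (0 : PSpace n) = (0, 0) from rfl]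
          simp only [neg_zero] at this; linarith
        simp [this]
      · have hq : 0 < quart (X - Y) := by
          have := le_quart (X - Y)
          have := pow_pos (pnorm_pos hXY) 4
          linarith
        refine tendsto_const_nhds.congr' ?_
        have h2 : Tendsto (fun j : ℕ => 2 * (1 / ((j : ℝ) + 1))) atTop (𝓝 (2 * 0)) :=
          tendsto_one_div_add_atTop_nhds_zero_nat.const_mul 2
        rw [mul_zero] at h2
        filter_upwards [h2.eventually_lt_const hq] with j hj
        rw [lowCut_eq_one (by positivity) hj.le, one_mul]
  have h0 : ∫ Y, g (X - Y) ∂ν = 0 := by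
    simp only [hzero] at hlim
    exact tendsto_nhds_unique hlim tendsto_const_nhds |>.symm ▸ rfl
  simp only [hgX] at h0
  rw [integral_sub hi1 hi2] at h0
  linarith

/-- Uniform approximation of compactly supported continuous functions by smooth ones with supports in
a common ball. -/
lemma exists_smooth_approx {f : PSpace n → ℝ} (hf : Continuous f) (hc : HasCompactSupport f) :
    ∃ R > 0, (∀ Y, f Y ≠ 0 → pnorm Y < R) ∧ ∀ η > 0, ∃ g : PSpace n → ℝ, ContDiff ℝ ∞ g ∧
      (∀ Y, g Y ≠ 0 → pnorm Y < R) ∧ ∀ Y, |g Y - f Y| ≤ η := by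
  obtain ⟨R, hR, hfR⟩ := exists_pball_of_hasCompactSupport hc
  refine ⟨4 * R, by positivity, fun Y hY => (hfR Y hY).trans (by linarith), fun η hη => ?_⟩
  obtain ⟨g, hg, hgf⟩ := (hc.uniformContinuous_of_continuous hf).exists_contDiff_dist_le hη
  refine ⟨fun Y => highCut (R ^ 4) Y * g Y, (contDiff_highCut _).mul hg, fun Y hY => ?_, fun Y => ?_⟩
  · have h1 := quart_lt_of_highCut (by positivity) (left_ne_zero_of_mul hY)
    have h2 := le_quart Y
    refine lt_of_pow_lt_pow_left₀ 4 (by positivity) (h2.trans_lt ?_)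
    have : (0 : ℝ) < R ^ 4 := by positivity
    nlinarith
  · have h3 : highCut (R ^ 4) Y * f Y = f Y := by
      by_cases h : f Y = 0
      · simp [h]
      · rw [highCut_eq_one (by positivity), one_mul]
        exact (quart_le Y).trans (pow_le_pow_left₀ (pnorm_nonneg Y) (hfR Y h).le 4)
    rw [← h3, ← mul_sub, abs_mul, abs_of_nonneg (highCut_mem _ _).1]
    have h4 := hgf Y
    rw [Real.dist_eq] at h4
    exact (mul_le_of_le_one_left (abs_nonneg _) (highCut_mem _ _).2).trans h4.le

/-- A homeomorphism that preserves the integrals of smooth test functions preserves those of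
continuous ones. -/
lemma integral_comp_of_smooth (ν : Measure (PSpace n)) [IsLocallyFiniteMeasure ν]
    (T : PSpace n ≃ₜ PSpace n)
    (h : ∀ f : PSpace n → ℝ, ContDiff ℝ ∞ f → HasCompactSupport f →
      ∫ Y, f (T Y) ∂ν = ∫ Y, f Y ∂ν)
    {f : PSpace n → ℝ} (hf : Continuous f) (hc : HasCompactSupport f) :
    ∫ Y, f (T Y) ∂ν = ∫ Y, f Y ∂ν := by
  obtain ⟨R, hR, hfR, happ⟩ := exists_smooth_approx hf hc
  have hcomp : ∀ g : PSpace n → ℝ, (∀ Y, g Y ≠ 0 → pnorm Y < R) → HasCompactSupport g := fun g hg =>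
    hasCompactSupport_of_pnorm (X := 0) (R := R) fun Y hY => by simpa using (hg Y hY).le
  obtain ⟨R', hR', hTR⟩ : ∃ R' > 0, ∀ Y, pnorm (T Y) < R → pnorm Y < R' := by
    have hK : IsCompact (T.symm '' {Y | pnorm ((0 : PSpace n) - Y) ≤ R}) :=
      (isCompact_closedPball 0 R).image T.symm.continuous
    obtain ⟨R', hR'⟩ := (hK.image continuous_pnorm).bddAbove
    refine ⟨max R' 0 + 1, by positivity, fun Y hY => ?_⟩
    have := hR' (mem_image_of_mem pnorm ⟨T Y, by simpa using hY.le, T.symm_apply_apply Y⟩)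
    linarith [le_max_left R' 0]
  set A := (ν (pball 0 R)).toReal
  set B := (ν (pball 0 R')).toReal
  have hA : ν (pball 0 R) ≤ ENNReal.ofReal A :=
    (ENNReal.ofReal_toReal (measure_pball_lt_top ν 0 R).ne).ge
  have hB : ν (pball 0 R') ≤ ENNReal.ofReal B :=
    (ENNReal.ofReal_toReal (measure_pball_lt_top ν 0 R').ne).ge
  have hbound : ∀ η > 0, |∫ Y, f (T Y) ∂ν - ∫ Y, f Y ∂ν| ≤ η * (A + B) := by
    intro η hη
    obtain ⟨g, hg, hgR, hgf⟩ := happ η hη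
    have hgc := hcomp g hgR
    have i1 := integrable_of_hasCompactSupport ν hf hc
    have i2 := integrable_of_hasCompactSupport ν hg.continuous hgc
    have i3 := integrable_of_hasCompactSupport ν (hf.comp T.continuous) (hc.comp_homeomorph T)
    have i4 := integrable_of_hasCompactSupport ν (hg.continuous.comp T.continuous)
      (hgc.comp_homeomorph T)
    have hne : ∀ Y, g Y - f Y ≠ 0 → pnorm Y < R := fun Y hY => by
      by_contra h1
      have e1 : f Y = 0 := by by_contra h2; exact h1 (hfR Y h2)
      have e2 : g Y = 0 := by by_contra h2; exact h1 (hgR Y h2)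
      exact hY (by rw [e1, e2, sub_zero])
    have b1 : |∫ Y, (g Y - f Y) ∂ν| ≤ η * A :=
      abs_integral_le_of_pball ν (X := 0) (R := R) (fun Y hY => by simpa using hne Y hY) hgf
        ENNReal.toReal_nonneg hA
    have b2 : |∫ Y, (g (T Y) - f (T Y)) ∂ν| ≤ η * B :=
      abs_integral_le_of_pball ν (X := 0) (R := R')
        (fun Y hY => by simpa using hTR Y (hne (T Y) hY)) (fun Y => hgf (T Y))
        ENNReal.toReal_nonneg hB
    rw [integral_sub i2 i1] at b1
    have e := integral_sub i4 i3
    simp only [Function.comp_apply] at e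
    rw [e, h g hg hgc] at b2
    rw [abs_le] at *
    constructor <;> linarith [b1.1, b1.2, b2.1, b2.2]
  have hAB : 0 ≤ A + B := add_nonneg ENNReal.toReal_nonneg ENNReal.toReal_nonneg
  by_contra hne
  have hpos : 0 < |∫ Y, f (T Y) ∂ν - ∫ Y, f Y ∂ν| := abs_pos.2 (sub_ne_zero.2 hne)
  have h1 := hbound (|∫ Y, f (T Y) ∂ν - ∫ Y, f Y ∂ν| / (2 * (A + B + 1))) (by positivity)
  have h2 : |∫ Y, f (T Y) ∂ν - ∫ Y, f Y ∂ν| / (2 * (A + B + 1)) * (A + B) =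
      |∫ Y, f (T Y) ∂ν - ∫ Y, f Y ∂ν| / 2 * ((A + B) / (A + B + 1)) := by
    field_simp
  have h3 : (A + B) / (A + B + 1) ≤ 1 := by rw [div_le_one (by positivity)]; linarith
  rw [h2] at h1
  nlinarith

/-- Invariance of a measure under the spatial translation by `w`. -/
def TransInv (ν : Measure (PSpace n)) (w : EuclideanSpace ℝ (Fin n)) : Prop :=
  ∀ f : PSpace n → ℝ, Continuous f → HasCompactSupport f →
    ∫ Y, f (Y + (w, 0)) ∂ν = ∫ Y, f Y ∂ν

lemma hasCompactSupport_add {f : PSpace n → ℝ} (hc : HasCompactSupport f) (w : PSpace n) :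
    HasCompactSupport fun Y => f (Y + w) :=
  hc.comp_homeomorph (Homeomorph.addRight w)

namespace TransInv

variable {ν : Measure (PSpace n)} {v w : EuclideanSpace ℝ (Fin n)}

lemma zero : TransInv ν 0 := fun f _ _ => by
  have : ((0 : EuclideanSpace ℝ (Fin n)), (0 : ℝ)) = 0 := rfl
  simp [this]

lemma add (hv : TransInv ν v) (hw : TransInv ν w) : TransInv ν (v + w) := fun f hf hc => by
  rw [← hw f hf hc, ← hv (fun Y => f (Y + (w, 0))) (by fun_prop)
    (hasCompactSupport_add hc _)]
  refine integral_congr_ae (Eventually.of_forall fun Y => ?_)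
  simp [add_assoc]

lemma neg (hw : TransInv ν w) : TransInv ν (-w) := fun f hf hc => by
  rw [← hw (fun Y => f (Y + (-w, 0))) (by fun_prop)
    (hasCompactSupport_add hc _)]
  refine integral_congr_ae (Eventually.of_forall fun Y => ?_)
  have : ((w, (0 : ℝ)) : PSpace n) + (-w, 0) = 0 := by ext1 <;> simp
  simp [add_assoc, this]

lemma nsmul (hw : TransInv ν w) (j : ℕ) : TransInv ν ((j : ℝ) • w) := by
  induction j with
  | zero => simpa using zero
  | succ j ih => rw [Nat.cast_succ, add_smul, one_smul]; exact ih.add hw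

lemma zsmul (hw : TransInv ν w) (j : ℤ) : TransInv ν ((j : ℝ) • w) := by
  obtain ⟨m, rfl | rfl⟩ := j.eq_nat_or_neg
  · simpa using hw.nsmul m
  · simpa using (hw.nsmul m).neg

lemma resc (hw : TransInv ν w) {r : ℝ} (hr : 0 < r) (X : PSpace n) :
    TransInv (resc k ν X r) (r⁻¹ • w) := fun f hf hc => by
  rw [integral_resc hr, integral_resc hr, ← hw (fun Z => f (dil r⁻¹ (Z - X))) (hf.comp (zoom X r hr).continuous)
    (hasCompactSupport_comp_zoom hc X hr)]
  congr 1
  refine integral_congr_ae (Eventually.of_forall fun Y => ?_)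
  change f _ = f _
  congr 1
  have : Y + (w, 0) - X = (Y - X) + (w, 0) := by abel
  rw [this, dil_add]
  congr 1
  ext1 <;> simp

end TransInv

/-- A measure that is annihilated by all odd bumps at the points of its support is invariant under
twice the spatial components of these points, if the origin is one of them. -/
theorem transInv_of_oddBump (ν : Measure (PSpace n)) [IsLocallyFiniteMeasure ν]
    (h : ∀ X ∈ ν.support, ∀ ψ : PSpace n → ℝ, IsOddBump ψ → ∫ Y, ψ (X - Y) ∂ν = 0)
    (h0 : (0 : PSpace n) ∈ ν.support) {X : PSpace n} (hX : X ∈ ν.support) :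
    TransInv ν ((2 : ℝ) • X.1) := fun f hf hc => by
  have hsym : ∀ Z ∈ ν.support, ∀ f : PSpace n → ℝ, Continuous f → HasCompactSupport f →
      ∫ Y, f (refl Z.1 Y) ∂ν = ∫ Y, f Y ∂ν := fun Z hZ f hf hc =>
    integral_comp_of_smooth ν (reflHomeo Z.1)
      (fun f hf hc => integral_refl_of_smooth ν Z (h Z hZ) hf hc) hf hc
  rw [← hsym X hX f hf hc, ← hsym 0 h0 (fun Y => f (refl X.1 Y)) (hf.comp (contDiff_refl X.1).continuous)
    (hc.comp_homeomorph (reflHomeo X.1))]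
  refine integral_congr_ae (Eventually.of_forall fun Y => ?_)
  simp [refl_refl]

section Limit

variable {ι : Type*} {m : ι → Measure (PSpace n)} {ν : Measure (PSpace n)}

/-- Integrals of translates of a test function by vectors that converge. -/
lemma VagueLim.tendsto_shift {U : Filter ι} (hν : VagueLim U m ν)
    (hm : ∀ᶠ i in U, IsLocallyFiniteMeasure (m i))
    (hM : ∀ R : ℝ, ∃ A : ℝ, 0 ≤ A ∧ ∀ᶠ i in U, m i (pball 0 R) ≤ ENNReal.ofReal A)
    {f : PSpace n → ℝ} (hf : Continuous f) (hc : HasCompactSupport f)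
    {W : ι → PSpace n} {w : PSpace n} (hW : Tendsto W U (𝓝 w)) :
    Tendsto (fun i => ∫ Y, f (Y + W i) ∂(m i)) U (𝓝 (∫ Y, f (Y + w) ∂ν)) := by
  have h1 := hν _ (hf.comp (by fun_prop : Continuous fun Y : PSpace n => Y + w))
    (hasCompactSupport_add hc w)
  obtain ⟨R, hR, hfR⟩ := exists_pball_of_hasCompactSupport hc
  obtain ⟨A, hA0, hA⟩ := hM (R + pnorm w + 1)
  have h2 : Tendsto (fun i => ∫ Y, f (Y + W i) ∂(m i) - ∫ Y, f (Y + w) ∂(m i)) U (𝓝 0) := by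
    rw [Metric.tendsto_nhds]
    intro ε hε
    obtain ⟨η, hη, hηε⟩ : ∃ η > 0, η * A < ε := by
      refine ⟨ε / (2 * (A + 1)), by positivity, ?_⟩
      rw [div_mul_eq_mul_div, div_lt_iff₀ (by positivity)]; nlinarith
    obtain ⟨δ, hδ, huc⟩ := Metric.uniformContinuous_iff.1
      (hc.uniformContinuous_of_continuous hf) η hη
    filter_upwards [hm, hA, hW (Metric.ball_mem_nhds w hδ), hW (pball_mem_nhds w one_pos)]
      with i hmi hAi hWi hWi'
    have i1 := integrable_of_hasCompactSupport (m i)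
      (hf.comp (by fun_prop : Continuous fun Y : PSpace n => Y + W i)) (hasCompactSupport_add hc _)
    have i2 := integrable_of_hasCompactSupport (m i)
      (hf.comp (by fun_prop : Continuous fun Y : PSpace n => Y + w)) (hasCompactSupport_add hc _)
    rw [dist_zero_right, Real.norm_eq_abs]
    have e := integral_sub i1 i2
    simp only [Function.comp_apply] at e
    rw [← e]
    refine lt_of_le_of_lt (abs_integral_le_of_pball (m i) (X := 0) (R := R + pnorm w + 1) (M := η)
      (fun Y hY => ?_) (fun Y => ?_) hA0 hAi) hηε
    · rw [zero_sub, pnorm_neg]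
      have hw1 : pnorm (w - W i) < 1 := hWi'
      by_cases hz : f (Y + w) = 0
      · have h4 : f (Y + W i) ≠ 0 := fun h5 => hY (by rw [hz, h5, sub_zero])
        have h5 := hfR _ h4
        have h6 := pnorm_add_le (Y + W i) (w - W i)
        have h7 := pnorm_add_le (Y + W i + (w - W i)) (-w)
        rw [show Y + W i + (w - W i) + -w = Y by abel, pnorm_neg] at h7
        linarith
      · have h5 := hfR _ hz
        have h7 := pnorm_add_le (Y + w) (-w)
        rw [show Y + w + -w = Y by abel, pnorm_neg] at h7
        linarith
    · have := huc (a := Y + W i) (b := Y + w) (by rw [dist_add_left]; exact hWi)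
      rw [Real.dist_eq] at this
      exact this.le
  simpa using h2.add h1

end Limit

end ParabolicUR

/-! ### Blow-downs and product measures -/

namespace ParabolicUR

open Filter Topology Module
open scoped CompactlySupported

variable {n k : ℕ} {C₀ : ℝ}

/-- The conditions that make a measure a product `ℋ^m|_W × ν`: it lives on `W × ℝ` and is invariant
under the translations by `W`. -/
structure IsPlaneInv (W : Submodule ℝ (EuclideanSpace ℝ (Fin n))) (ω : Measure (PSpace n)) :
    Prop where
  supp : ∀ X ∈ ω.support, X.1 ∈ W
  inv : ∀ w ∈ W, TransInv ω w

lemma IsPlaneInv.resc {W : Submodule ℝ (EuclideanSpace ℝ (Fin n))} {ω : Measure (PSpace n)}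
    (h : IsPlaneInv W ω) {r : ℝ} (hr : 0 < r) : IsPlaneInv W (resc k ω 0 r) := by
  refine ⟨fun X hX => ?_, fun w hw => ?_⟩
  · have := h.supp _ ((mem_support_resc hr).1 hX)
    simp only [zero_add, dil_fst] at this
    exact (W.smul_mem_iff hr.ne').1 this
  · have := (h.inv (r • w) (W.smul_mem r hw)).resc (k := k) hr 0
    rwa [smul_smul, inv_mul_cancel₀ hr.ne', one_smul] at this

/-- If `ν` is invariant under the spatial translations by twice the points of the projected support,
then at large scales it looks like a measure that is invariant under the whole span `W` of the
projected support: the lattice generated by these translations becomes dense in `W`. -/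
theorem exists_blowDown (hC₀ : 0 < C₀) {ν : Measure (PSpace n)} (hν : AdrTo C₀ k ν ∞)
    (h0 : (0 : PSpace n) ∈ ν.support) (hinv : ∀ X ∈ ν.support, TransInv ν ((2 : ℝ) • X.1)) :
    ∃ ω : Measure (PSpace n), AdrTo C₀ k ω ∞ ∧ (0 : PSpace n) ∈ ω.support ∧
      IsPlaneInv (Submodule.span ℝ (Prod.fst '' ν.support)) ω ∧
      VagueLim (hyperfilter ℕ : Filter ℕ) (fun j => resc k ν 0 (2 ^ j)) ω := by
  set W := Submodule.span ℝ (Prod.fst '' ν.support)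
  have h2 : ∀ j : ℕ, (0 : ℝ) < 2 ^ j := fun j => by positivity
  have hadr : ∀ j : ℕ, AdrTo C₀ k (resc k ν 0 (2 ^ j)) ∞ := fun j => hν.resc 0 (h2 j) le_top
  have hadr' : ∀ R : ℝ, ∀ᶠ j in (hyperfilter ℕ : Filter ℕ),
      AdrTo C₀ k (resc k ν 0 (2 ^ j)) (ENNReal.ofReal R) := fun R =>
    Eventually.of_forall fun j => (hadr j).mono le_top
  have h0' : ∀ j : ℕ, (0 : PSpace n) ∈ (resc k ν 0 (2 ^ j)).support := fun j =>
    (mem_support_resc (h2 j)).2 (by simpa using h0)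
  obtain ⟨ω, hωl, hω⟩ := exists_vagueLim hC₀ (hyperfilter ℕ) hadr' (Eventually.of_forall h0')
  refine ⟨ω, hω.adrTo hadr', hω.zero_mem_support hC₀ hadr' (Eventually.of_forall h0'),
    ⟨fun X hX => ?_, fun w hw => ?_⟩, hω⟩
  -- the rescaled measures live on `W × ℝ`, which is closed
  · have hcl : IsClosed (W : Set (EuclideanSpace ℝ (Fin n))) := W.closed_of_finiteDimensional
    by_contra hXW
    obtain ⟨e, he, hball⟩ := Metric.isOpen_iff.1 hcl.isOpen_compl X.1 hXW
    obtain ⟨j, Y, hY, hXY⟩ := (hω.exists_near hX he).exists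
    have hYs := (mem_support_resc (h2 j)).1 hY
    have hYW : Y.1 ∈ W := by
      have : (0 + dil (2 ^ j) Y).1 ∈ W := Submodule.subset_span (mem_image_of_mem _ hYs)
      simp only [zero_add, dil_fst] at this
      exact (W.smul_mem_iff (h2 j).ne').1 this
    refine hball (?_ : Y.1 ∈ _) hYW
    rw [Metric.mem_ball, dist_comm, dist_eq_norm]
    exact (norm_fst_le_pnorm (X - Y)).trans_lt hXY
  · have hM : ∀ R : ℝ, ∃ A : ℝ, 0 ≤ A ∧ ∀ᶠ j in (hyperfilter ℕ : Filter ℕ),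
        resc k ν 0 (2 ^ j) (pball 0 R) ≤ ENNReal.ofReal A := by
      intro R
      refine ⟨C₀ * (max R 1) ^ (k + 2), by positivity, Eventually.of_forall fun j => ?_⟩
      exact (measure_mono (pball_mono (le_max_left R 1))).trans
        ((hadr j).regular 0 (h0' j) _ (by positivity) ENNReal.ofReal_lt_top).2
    -- every `w ∈ W` is a limit of translations that leave the `j`-th rescaled measure invariant: the
    -- multiple `c x` is approximated by even multiples of `2⁻ʲ x`
    have key : ∃ v : ℕ → EuclideanSpace ℝ (Fin n),
        (∀ j, TransInv (resc k ν 0 (2 ^ j)) (v j)) ∧ Tendsto v atTop (𝓝 w) := by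
      induction hw using Submodule.closure_induction with
      | zero => exact ⟨0, fun _ => TransInv.zero, tendsto_const_nhds⟩
      | add x y _ _ hx hy =>
        obtain ⟨u, hu, hux⟩ := hx
        obtain ⟨v, hv, hvy⟩ := hy
        exact ⟨u + v, fun j => (hu j).add (hv j), hux.add hvy⟩
      | smul_mem c x hx =>
        obtain ⟨X, hX, rfl⟩ := hx
        refine ⟨fun j => ((2 ^ j : ℝ)⁻¹ * (⌊2 ^ j * (c / 2)⌋ * 2)) • X.1, fun j => ?_, ?_⟩
        · have := ((hinv X hX).zsmul ⌊(2 : ℝ) ^ j * (c / 2)⌋).resc (k := k) (h2 j) 0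
          rwa [smul_smul, smul_smul, mul_assoc] at this
        · refine Tendsto.smul_const ?_ _
          have h1 : Tendsto (fun j : ℕ => (⌊(c / 2) * (2 : ℝ) ^ j⌋ : ℝ) / 2 ^ j) atTop
              (𝓝 (c / 2)) := by
            have h4 : Tendsto (fun j : ℕ => c / 2 - (1 / 2 : ℝ) ^ j) atTop (𝓝 (c / 2 - 0)) :=
              tendsto_const_nhds.sub (tendsto_pow_atTop_nhds_zero_of_lt_one (by norm_num)
                (by norm_num))
            rw [sub_zero] at h4
            refine tendsto_of_tendsto_of_tendsto_of_le_of_le h4 tendsto_const_nhds (fun j => ?_)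
              fun j => ?_
            · have := Int.lt_floor_add_one ((c / 2) * (2 : ℝ) ^ j)
              simp only [one_div, inv_pow]
              rw [le_div_iff₀ (h2 j), sub_mul, inv_mul_cancel₀ (h2 j).ne']
              linarith
            · have := Int.floor_le ((c / 2) * (2 : ℝ) ^ j)
              simp only
              rwa [div_le_iff₀ (h2 j)]
          have h3 := h1.mul_const 2
          rw [div_mul_cancel₀ c two_ne_zero] at h3
          refine h3.congr fun j => ?_
          rw [mul_comm (c / 2)]; field_simp
    obtain ⟨v, hv, hvw⟩ := key
    intro f hf hc
    have hvw' : Tendsto (fun j => ((v j, 0) : PSpace n)) (hyperfilter ℕ : Filter ℕ) (𝓝 (w, 0)) :=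
      (hvw.prodMk_nhds tendsto_const_nhds).mono_left Nat.hyperfilter_le_atTop
    refine tendsto_nhds_unique (hω.tendsto_shift (Eventually.of_forall fun j =>
      (hadr j).locallyFinite) hM hf hc hvw') ((hω f hf hc).congr fun j => ?_)
    exact (hv j f hf hc).symm

lemma TransInv.map_eq {ω : Measure (PSpace n)} [IsLocallyFiniteMeasure ω]
    {w : EuclideanSpace ℝ (Fin n)} (h : TransInv ω w) : ω.map (fun Y => Y + (w, 0)) = ω := by
  have : (ω.map (Homeomorph.addRight ((w, 0) : PSpace n))).Regular := Measure.Regular.map _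
  refine Measure.ext_of_integral_eq_on_compactlySupported
    (μ := ω.map (Homeomorph.addRight ((w, 0) : PSpace n))) fun f => ?_
  rw [(Homeomorph.addRight ((w, 0) : PSpace n)).measurableEmbedding.integral_map]
  exact h f f.continuous f.hasCompactSupport

/-- A locally finite measure on `W × ℝ` that is invariant under `W` is a product `ℋ^m|_W × ν`, by
uniqueness of Haar measure on `W`. -/
theorem IsPlaneInv.exists_eq_planeProd {W : Submodule ℝ (EuclideanSpace ℝ (Fin n))}
    {ω : Measure (PSpace n)} [IsLocallyFiniteMeasure ω] (h : IsPlaneInv W ω) :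
    ∃ ν : Measure ℝ, IsLocallyFiniteMeasure ν ∧ ω = planeProd (finrank ℝ W) W ν := by
  have hHaar : (Measure.hausdorffMeasure (finrank ℝ W : ℝ) : Measure W).IsAddHaarMeasure :=
    isAddHaarMeasure_hausdorffMeasure
  set η : Measure W := Measure.hausdorffMeasure (finrank ℝ W : ℝ) with hη
  set p : EuclideanSpace ℝ (Fin n) → W := fun x => W.orthogonalProjectionOnto x with hp
  have hpc : Continuous p := W.orthogonalProjectionOnto.continuous
  have hpW : ∀ w : W, p w = w := fun w => by simp [hp]
  have hae : ∀ᵐ Y ∂ω, ((p Y.1 : W) : EuclideanSpace ℝ (Fin n)) = Y.1 := by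
    filter_upwards [ae_mem_support ω] with Y hY
    have := hpW ⟨Y.1, h.supp Y hY⟩
    simp only [this]
  -- for a set `E` of times, `σ E` is the projection to `W` of the part of `ω` with times in `E`; it is
  -- a multiple of Haar measure, and the multiple is the value `ν E` of the second factor
  set σ : Set ℝ → Measure W := fun E => (ω.restrict (Prod.snd ⁻¹' E)).map fun Y => p Y.1 with hσ
  have hpm : Measurable fun Y : PSpace n => p Y.1 := (hpc.comp continuous_fst).measurable
  have hσA : ∀ E, MeasurableSet E → ∀ A : Set W, MeasurableSet A →
      σ E A = ω {Y | p Y.1 ∈ A ∧ Y.2 ∈ E} := by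
    intro E hE A hA
    rw [hσ, Measure.map_apply hpm hA, Measure.restrict_apply (hpm hA)]
    rfl
  have hinv : ∀ E, MeasurableSet E → (σ E).IsAddLeftInvariant := by
    intro E hE
    refine ⟨fun w => ?_⟩
    ext A hA
    rw [Measure.map_apply (measurable_const_add w) hA, hσA E hE _ (measurable_const_add w hA),
      hσA E hE A hA]
    conv_rhs => rw [← (h.inv w w.2).map_eq]
    have hmeas : MeasurableSet {Y : PSpace n | p Y.1 ∈ A ∧ Y.2 ∈ E} :=
      (hpm hA).inter (measurable_snd hE)
    rw [Measure.map_apply (measurable_add_const _) hmeas]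
    congr 1
    ext Y
    have : p (Y.1 + (w : EuclideanSpace ℝ (Fin n))) = w + p Y.1 := by
      simp only [hp, map_add]
      rw [add_comm]; congr 1; exact hpW w
    simp only [mem_ofPred_eq, mem_preimage, Prod.fst_add, Prod.snd_add, add_zero, this]
  have hfin : ∀ E, MeasurableSet E → Bornology.IsBounded E → IsFiniteMeasureOnCompacts (σ E) := by
    intro E hE hEb
    refine ⟨fun A hA => ?_⟩
    rw [hσA E hE A hA.measurableSet]
    have hle : ω {Y | p Y.1 ∈ A ∧ Y.2 ∈ E} ≤
        ω (((fun w : W => (w : EuclideanSpace ℝ (Fin n))) '' A) ×ˢ closure E) := by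
      refine measure_mono_ae ?_
      filter_upwards [hae] with Y hY hYA
      exact ⟨⟨p Y.1, hYA.1, hY⟩, subset_closure hYA.2⟩
    exact hle.trans_lt ((hA.image continuous_subtype_val).prod hEb.isCompact_closure).measure_lt_top
  set K : Set W := Metric.closedBall 0 1
  have hK0 : η K ≠ 0 := (Metric.measure_closedBall_pos η 0 one_pos).ne'
  have hKt : η K ≠ ∞ := (isCompact_closedBall (0 : W) 1).measure_lt_top.ne
  have hbdd : ∀ E, MeasurableSet E → Bornology.IsBounded E → ∀ A : Set W,
      σ E A = η A * ((η K)⁻¹ * σ E K) := by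
    intro E hE hEb A
    have i1 := hinv E hE
    have i2 := hfin E hE hEb
    have := Measure.isAddLeftInvariant_eq_smul (σ E) η
    set c := Measure.addHaarScalarFactor (σ E) η
    have hc : ∀ A, σ E A = c * η A := fun A => by
      conv_lhs => rw [this]
      rfl
    rw [hc A, hc K, mul_left_comm (η K)⁻¹, ENNReal.inv_mul_cancel hK0 hKt, mul_one, mul_comm]
  set ν : Measure ℝ := (η K)⁻¹ • (ω.restrict ((fun Y : PSpace n => p Y.1) ⁻¹' K)).map Prod.snd
    with hν
  have hKm : MeasurableSet K := measurableSet_closedBall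
  have hνE : ∀ E, MeasurableSet E → ν E = (η K)⁻¹ * σ E K := by
    intro E hE
    rw [hν, Measure.smul_apply, smul_eq_mul, Measure.map_apply measurable_snd hE,
      Measure.restrict_apply (measurable_snd hE), hσA E hE K hKm, inter_comm]
    rfl
  have hνl : IsLocallyFiniteMeasure ν := by
    refine ⟨fun t => ⟨Metric.ball t 1, Metric.ball_mem_nhds t one_pos, ?_⟩⟩
    have i2 := hfin _ (measurableSet_ball (x := t) (ε := 1)) Metric.isBounded_ball
    rw [hνE _ measurableSet_ball]
    exact ENNReal.mul_lt_top (ENNReal.inv_lt_top.2 hK0.bot_lt)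
      (isCompact_closedBall (0 : W) 1).measure_lt_top
  -- `σ E` need not be finite on compact sets when `E` is unbounded: cut `E` into bounded pieces
  have hrect : ∀ E, MeasurableSet E → ∀ A : Set W, MeasurableSet A → σ E A = η A * ν E := by
    intro E hE A hA
    have hEu : E = ⋃ i : ℤ, E ∩ Ico (i : ℝ) (i + 1) := by
      rw [← inter_iUnion, iUnion_Ico_intCast, inter_univ]
    have hdisj : Pairwise (Function.onFun Disjoint fun i : ℤ => E ∩ Ico (i : ℝ) (i + 1)) :=
      fun i j hij => ((pairwise_disjoint_Ico_intCast ℝ) hij).mono inter_subset_right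
        inter_subset_right
    have hm : ∀ i : ℤ, MeasurableSet (E ∩ Ico (i : ℝ) (i + 1)) := fun i => hE.inter measurableSet_Ico
    have hb : ∀ i : ℤ, Bornology.IsBounded (E ∩ Ico (i : ℝ) (i + 1)) := fun i =>
      (Metric.isBounded_Ico _ _).subset inter_subset_right
    have hsum : σ E A = ∑' i : ℤ, σ (E ∩ Ico (i : ℝ) (i + 1)) A := by
      have e : {Y : PSpace n | p Y.1 ∈ A ∧ Y.2 ∈ E} =
          ⋃ i : ℤ, {Y | p Y.1 ∈ A ∧ Y.2 ∈ E ∩ Ico (i : ℝ) (i + 1)} := by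
        conv_lhs => rw [hEu]
        ext Y
        simp only [mem_ofPred_eq, mem_iUnion, exists_and_left]
      rw [hσA E hE A hA, e, measure_iUnion]
      · exact tsum_congr fun i => (hσA _ (hm i) A hA).symm
      · exact fun i j hij => Set.disjoint_left.2 fun Y h1 h2 =>
          Set.disjoint_left.1 (hdisj hij) h1.2 h2.2
      · exact fun i => (hpm hA).inter (measurable_snd (hm i))
    rw [hsum]
    have hνs : ν E = ∑' i : ℤ, ν (E ∩ Ico (i : ℝ) (i + 1)) := by
      conv_lhs => rw [hEu]
      exact measure_iUnion hdisj hm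
    rw [hνs, ← ENNReal.tsum_mul_left]
    exact tsum_congr fun i => by rw [hbdd _ (hm i) (hb i) A, hνE _ (hm i)]
  refine ⟨ν, hνl, ?_⟩
  have hiso : Isometry (Subtype.val : W → EuclideanSpace ℝ (Fin n)) := isometry_subtype_coe
  have hmap : η.map Subtype.val = (Measure.hausdorffMeasure (finrank ℝ W : ℝ)).restrict
      (W : Set (EuclideanSpace ℝ (Fin n))) := by
    rw [hη, hiso.map_hausdorffMeasure (Or.inl (by positivity)), Subtype.range_coe]
  have hme : MeasurableEmbedding (Subtype.val : W → EuclideanSpace ℝ (Fin n)) :=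
    MeasurableEmbedding.subtype_coe W.closed_of_finiteDimensional.measurableSet
  have hsf : SigmaFinite (η.map (Subtype.val : W → EuclideanSpace ℝ (Fin n))) := hme.sigmaFinite_map
  rw [planeProd, ← hmap]
  refine (Measure.prod_eq fun S E hS hE => ?_).symm
  rw [hme.map_apply, ← hrect E hE _ (measurable_subtype_coe hS), hσA E hE _
    (measurable_subtype_coe hS)]
  refine measure_congr ?_
  filter_upwards [hae] with Y hY
  refine propext ?_
  change Y.1 ∈ S ∧ Y.2 ∈ E ↔ ((p Y.1 : W) : EuclideanSpace ℝ (Fin n)) ∈ S ∧ Y.2 ∈ E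
  rw [hY]

/-- A product measure over a plane of spatial dimension larger than `k + 2` grows too fast. -/
theorem IsPlaneInv.finrank_le (hC₀ : 0 < C₀) {W : Submodule ℝ (EuclideanSpace ℝ (Fin n))}
    {ω : Measure (PSpace n)} (h : IsPlaneInv W ω) (hω : AdrTo C₀ k ω ∞)
    (h0 : (0 : PSpace n) ∈ ω.support) : finrank ℝ W ≤ k + 2 := by
  have := hω.locallyFinite
  obtain ⟨ν, hν, hων⟩ := h.exists_eq_planeProd
  set d := finrank ℝ W with hd
  have hHaar : (Measure.hausdorffMeasure (d : ℝ) : Measure W).IsAddHaarMeasure :=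
    isAddHaarMeasure_hausdorffMeasure
  set η : Measure W := Measure.hausdorffMeasure (d : ℝ) with hη
  have hiso : Isometry (Subtype.val : W → EuclideanSpace ℝ (Fin n)) := isometry_subtype_coe
  have hball : ∀ R : ℝ, 0 < R → ((Measure.hausdorffMeasure (d : ℝ)).restrict
      (W : Set (EuclideanSpace ℝ (Fin n)))) (Metric.ball 0 R) =
      ENNReal.ofReal (R ^ d) * η (Metric.ball 0 1) := by
    intro R hR
    have hmap : η.map Subtype.val = (Measure.hausdorffMeasure (d : ℝ)).restrict
        (W : Set (EuclideanSpace ℝ (Fin n))) := by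
      rw [hη, hiso.map_hausdorffMeasure (Or.inl (by positivity)), Subtype.range_coe]
    rw [← hmap, Measure.map_apply measurable_subtype_coe measurableSet_ball]
    have : (Subtype.val ⁻¹' Metric.ball (0 : EuclideanSpace ℝ (Fin n)) R : Set W) =
        Metric.ball 0 R := by ext w; simp
    rw [this, Measure.addHaar_ball_of_pos η 0 hR, hd]
  -- `B(0, R)` contains the product of the ball of radius `R / 2` in `W` and a fixed interval, whose
  -- mass is comparable to `R ^ d`
  have hub : ∀ R : ℝ, 2 ≤ R → ENNReal.ofReal ((R / 2) ^ d) * η (Metric.ball 0 1) *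
      ν (Metric.ball 0 1) ≤ ENNReal.ofReal (C₀ * R ^ (k + 2)) := by
    intro R hR
    rw [← hball (R / 2) (by linarith), ← Measure.prod_prod]
    refine le_trans ?_ (hω.regular 0 h0 R (by linarith) ENNReal.ofReal_lt_top).2
    conv_rhs => rw [hων]
    refine measure_mono fun Y hY => ?_
    have h1 : ‖Y.1‖ < R / 2 := by simpa using hY.1
    have h2 : |Y.2| < 1 := by simpa using hY.2
    rw [mem_pball, zero_sub, pnorm_neg]
    refine lt_of_pow_lt_pow_left₀ 2 (by linarith) ?_
    rw [pnorm_sq]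
    nlinarith [norm_nonneg Y.1]
  have hb0 : η (Metric.ball 0 1) ≠ 0 := (Metric.measure_ball_pos η 0 one_pos).ne'
  have hbt : η (Metric.ball 0 1) ≠ ∞ := measure_ball_lt_top.ne
  have hν0 : ν (Metric.ball 0 1) ≠ 0 := by
    intro hν0
    have h1 := (mem_support_iff_pball.1 h0) 1 one_pos
    rw [hων] at h1
    have h2 : (pball 0 1 : Set (PSpace n)) ⊆ Metric.ball 0 1 ×ˢ Metric.ball 0 1 := by
      intro Y hY
      rw [mem_pball, zero_sub, pnorm_neg] at hY
      have h3 := norm_fst_le_pnorm Y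
      have h4 := abs_snd_le_pnorm_sq Y
      have h5 := pnorm_nonneg Y
      refine ⟨by simpa using h3.trans_lt hY, ?_⟩
      rw [mem_ball_zero_iff, Real.norm_eq_abs]
      nlinarith
    have h3 := h1.trans_le (measure_mono h2)
    rw [planeProd, Measure.prod_prod, hν0, mul_zero] at h3
    exact lt_irrefl _ h3
  have hνt : ν (Metric.ball 0 1) ≠ ∞ := measure_ball_lt_top.ne
  by_contra! hlt
  set c : ℝ := (η (Metric.ball 0 1)).toReal * (ν (Metric.ball 0 1)).toReal with hc
  have hcpos : 0 < c := mul_pos (ENNReal.toReal_pos hb0 hbt) (ENNReal.toReal_pos hν0 hνt)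
  have hreal : ∀ R : ℝ, 2 ≤ R → (R / 2) ^ d * c ≤ C₀ * R ^ (k + 2) := by
    intro R hR
    have h1 := ENNReal.toReal_mono ENNReal.ofReal_ne_top (hub R hR)
    rw [ENNReal.toReal_mul, ENNReal.toReal_mul, ENNReal.toReal_ofReal (by positivity),
      ENNReal.toReal_ofReal (by positivity), mul_assoc] at h1
    exact h1
  set R : ℝ := 2 * (1 + C₀ * 2 ^ (k + 2) / c) with hR
  have hq : 0 ≤ C₀ * 2 ^ (k + 2) / c := by positivity
  have h1 := hreal R (by rw [hR]; linarith)
  have hR2 : R / 2 = 1 + C₀ * 2 ^ (k + 2) / c := by rw [hR]; ring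
  have hR1 : 1 ≤ R / 2 := by rw [hR2]; linarith
  have h2 : (R / 2) ^ (k + 3) ≤ (R / 2) ^ d := pow_le_pow_right₀ hR1 hlt
  have h3 : C₀ * R ^ (k + 2) = C₀ * 2 ^ (k + 2) * (R / 2) ^ (k + 2) := by
    rw [mul_assoc, ← mul_pow]; congr 2; ring
  have h4 : (R / 2) ^ (k + 3) * c = (R / 2) ^ (k + 2) * (c + C₀ * 2 ^ (k + 2)) := by
    rw [pow_succ, mul_assoc, hR2]; congr 1; field_simp
  have h5 : (0 : ℝ) < (R / 2) ^ (k + 2) := by positivity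
  nlinarith [mul_le_mul_of_nonneg_right h2 hcpos.le, mul_pos h5 hcpos]

end ParabolicUR

/-! ### Flatness at good points, by compactness -/

namespace ParabolicUR

open Filter Topology Module

variable {n k : ℕ} {C₀ : ℝ}

/-- Closeness to a measure that is invariant along a plane `W` bounds the `α`-numbers of dimension
`dim W`, at all nearby points and scales. -/
theorem alphaNumber_le_of_lipTest {W : Submodule ℝ (EuclideanSpace ℝ (Fin n))}
    {ω μ : Measure (PSpace n)} (hW : IsPlaneInv W ω) (hω : AdrTo C₀ k ω ∞) {Y : PSpace n} {r η : ℝ}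
    (hr : 0 < r) (hη : 0 ≤ η)
    (h : ∀ f, LipTest f → |∫ A, f A ∂(resc k μ Y r) - ∫ A, f A ∂ω| ≤ η) {Z : PSpace n}
    (hZ : Z ∈ pball Y (r / 2)) {s : ℝ} (hs : s ∈ Ioo r (3 / 2 * r)) :
    alphaNumber C₀ k (finrank ℝ W) μ Z s ≤ ENNReal.ofReal η := by
  have hri : 0 < r⁻¹ := inv_pos.2 hr
  have hω1 : AdrTo C₀ k (resc k ω 0 r⁻¹) ∞ := hω.resc 0 hri le_top
  have hl := hω1.locallyFinite
  obtain ⟨ν, hν, hων⟩ := (hW.resc (k := k) hri).exists_eq_planeProd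
  have hmem : (planeProd (finrank ℝ W) W ν).map (fun A => A + Y) ∈
      productFamily n C₀ k (finrank ℝ W) :=
    ⟨W, ν, Y, rfl, hν, hων ▸ hω1.isADR, rfl⟩
  refine (iInf₂_le _ hmem).trans ?_
  refine iSup_le fun f => iSup₂_le fun hfs hfl => ENNReal.ofReal_le_ofReal ?_
  have hs0 : 0 < s := hr.trans hs.1
  have hg : LipTest fun A => f (Y + dil r A) := by
    constructor
    · intro A hA
      have h1 : pnorm (Z - (Y + dil r A)) < s := hfs hA
      have h2 : pnorm (Y - Z) < r / 2 := hZ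
      have h3 := pnorm_add_le (Y - Z) (Z - (Y + dil r A))
      rw [show Y - Z + (Z - (Y + dil r A)) = -dil r A by abel, pnorm_neg, pnorm_dil hr.le] at h3
      have h4 := hs.2
      by_contra! h5
      nlinarith
    · intro A B
      refine (hfl _ _).trans ?_
      rw [add_sub_add_left_eq_sub, ← dil_sub, pnorm_dil hr.le, ← mul_assoc]
      refine mul_le_of_le_one_left (pnorm_nonneg _) ?_
      rw [one_div, inv_mul_le_one₀ hs0]
      exact hs.1.le
  have h1 := h _ hg
  have e1 : ∫ A, f (Y + dil r A) ∂(resc k μ Y r) = (r ^ (k + 2))⁻¹ * ∫ A, f A ∂μ := by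
    rw [integral_resc hr]
    congr 1
    refine integral_congr_ae (Eventually.of_forall fun A => ?_)
    simp [dil_dil, hr.ne']
  have e2 : ∫ A, f A ∂((planeProd (finrank ℝ W) W ν).map fun A => A + Y) =
      r ^ (k + 2) * ∫ A, f (Y + dil r A) ∂ω := by
    have := (Homeomorph.addRight Y).measurableEmbedding.integral_map
      (μ := planeProd (finrank ℝ W) W ν) f
    simp only [Homeomorph.coe_addRight] at this
    rw [this, ← hων, integral_resc hri]
    simp only [inv_pow, inv_inv, sub_zero]
    congr 1
    exact integral_congr_ae (Eventually.of_forall fun A => by simp [add_comm])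
  have hrk : (0 : ℝ) < r ^ (k + 2) := by positivity
  rw [e1] at h1
  rw [e2, div_le_iff₀ (by positivity)]
  have e3 : ∫ A, f A ∂μ - r ^ (k + 2) * ∫ A, f (Y + dil r A) ∂ω =
      r ^ (k + 2) * ((r ^ (k + 2))⁻¹ * ∫ A, f A ∂μ - ∫ A, f (Y + dil r A) ∂ω) := by
    field_simp
  rw [e3, abs_mul, abs_of_pos hrk]
  calc r ^ (k + 2) * |(r ^ (k + 2))⁻¹ * ∫ A, f A ∂μ - ∫ A, f (Y + dil r A) ∂ω|
      ≤ r ^ (k + 2) * η := by gcongr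
    _ ≤ η * s ^ (k + 2) := by
        rw [mul_comm]; gcongr; exact hs.1.le

/-- The convolution of `μ` with the kernel `ψ` at scale `r`. -/
noncomputable def convo (k : ℕ) (ψ : PSpace n → ℝ) (μ : Measure (PSpace n)) (r : ℝ)
    (X : PSpace n) : ℝ :=
  (r ^ (k + 2))⁻¹ * ∫ Z, ψ (dil r⁻¹ (X - Z)) ∂μ

lemma integral_resc_sub {r : ℝ} (hr : 0 < r) (ψ : PSpace n → ℝ) (μ : Measure (PSpace n))
    (Y X : PSpace n) : ∫ Z, ψ (X - Z) ∂(resc k μ Y r) = convo k ψ μ r (Y + dil r X) := by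
  rw [integral_resc hr (fun Z => ψ (X - Z)), convo]
  congr 1
  refine integral_congr_ae (Eventually.of_forall fun Z => ?_)
  change ψ _ = ψ _
  congr 1
  have : Y + dil r X - Z = dil r X - (Z - Y) := by abel
  rw [this, dil_sub r⁻¹ (dil r X), dil_dil, inv_mul_cancel₀ hr.ne', dil_one]

lemma exists_submodule_of_le_finrank {W : Submodule ℝ (EuclideanSpace ℝ (Fin n))} {d : ℕ}
    (hW : finrank ℝ W ≤ d) (hd : d ≤ n) :
    ∃ V : Submodule ℝ (EuclideanSpace ℝ (Fin n)), W ≤ V ∧ finrank ℝ V = d := by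
  induction d, hW using Nat.le_induction with
  | base => exact ⟨W, le_rfl, rfl⟩
  | succ j _ ih =>
    obtain ⟨V, hWV, hV⟩ := ih (by omega)
    obtain ⟨v, hv⟩ := V.exists_of_finrank_lt (by rw [hV, finrank_euclideanSpace_fin]; omega)
    refine ⟨V ⊔ Submodule.span ℝ {v}, hWV.trans le_sup_left, ?_⟩
    have hv0 : v ≠ 0 := fun h0 => hv 1 one_ne_zero (by simp [h0])
    have hdis : V ⊓ Submodule.span ℝ {v} = ⊥ := by
      rw [eq_bot_iff]
      rintro x ⟨hxV, hx⟩
      obtain ⟨c, rfl⟩ := Submodule.mem_span_singleton.1 hx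
      by_cases hc : c = 0
      · simp [hc]
      · exact absurd hxV (hv c hc)
    have := Submodule.finrank_sup_add_finrank_inf_eq V (Submodule.span ℝ {v})
    rw [hdis, finrank_bot, finrank_span_singleton hv0, hV] at this
    omega

/-- The spatial offset of `x` from the affine plane through `a` with direction `V`. -/
noncomputable def offset (V : Submodule ℝ (EuclideanSpace ℝ (Fin n)))
    (a x : EuclideanSpace ℝ (Fin n)) : EuclideanSpace ℝ (Fin n) :=
  Vᗮ.starProjection (x - a)

lemma continuous_offset (V : Submodule ℝ (EuclideanSpace ℝ (Fin n)))
    (a : EuclideanSpace ℝ (Fin n)) : Continuous (offset V a) :=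
  Vᗮ.starProjection.continuous.comp (by fun_prop)

/-- The `α`-numbers of dimension `m` are smaller than `ε` around `Y`, at the scales just above
`2 ^ J * r`. -/
def AlphaSmall (C₀ : ℝ) (k : ℕ) (ε : ℝ) (μ : Measure (PSpace n)) (m J : ℕ) (Y : PSpace n)
    (r : ℝ) : Prop :=
  ∀ Z ∈ pball Y (r / 2), ∀ s ∈ Ioo (2 ^ J * r) (3 / 2 * (2 ^ J * r)),
    alphaNumber C₀ k m μ Z s < ENNReal.ofReal ε

/-- If all odd bump convolutions vanish on the support of a regular measure, then either the support
lies in a vertical plane of spatial dimension `k`, or the measure is close, at some large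
scale, to a product measure over a plane of spatial dimension `k + 1` or `k + 2`. -/
theorem flat_or_close (hC₀ : 0 < C₀) (hkn : k ≤ n) {ν : Measure (PSpace n)}
    (hν : AdrTo C₀ k ν ∞) (h0 : (0 : PSpace n) ∈ ν.support)
    (hodd : ∀ X ∈ ν.support, ∀ ψ : PSpace n → ℝ, IsOddBump ψ → ∫ Y, ψ (X - Y) ∂ν = 0)
    {η : ℝ} (hη : 0 < η) :
    (∃ V : Submodule ℝ (EuclideanSpace ℝ (Fin n)), finrank ℝ V = k ∧ ∀ X ∈ ν.support, X.1 ∈ V) ∨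
    ∃ (W : Submodule ℝ (EuclideanSpace ℝ (Fin n))) (ω : Measure (PSpace n)) (J : ℕ),
      (finrank ℝ W = k + 1 ∨ finrank ℝ W = k + 2) ∧ AdrTo C₀ k ω ∞ ∧ IsPlaneInv W ω ∧
      ∀ f, LipTest f → |∫ A, f A ∂(resc k ν 0 (2 ^ J)) - ∫ A, f A ∂ω| ≤ η := by
  have hνl := hν.locallyFinite
  obtain ⟨ω, hω, hω0, hWω, hlim⟩ := exists_blowDown hC₀ hν h0
    fun X hX => transInv_of_oddBump ν hodd h0 hX
  set W := Submodule.span ℝ (Prod.fst '' ν.support)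
  rcases le_or_gt (finrank ℝ W) k with hd | hd
  · left
    obtain ⟨V, hWV, hV⟩ := exists_submodule_of_le_finrank hd hkn
    exact ⟨V, hV, fun X hX => hWV (Submodule.subset_span (mem_image_of_mem _ hX))⟩
  · right
    have hd2 := hWω.finrank_le hC₀ hω hω0
    have hωl := hω.locallyFinite
    have h2 : ∀ j : ℕ, (0 : ℝ) < 2 ^ j := fun j => by positivity
    have hev := hlim.eventually_lipTest (M := C₀ * 2 ^ (k + 2))
      (Eventually.of_forall fun j => isLocallyFiniteMeasure_resc (h2 j))
      (Eventually.of_forall fun j => ((hν.resc 0 (h2 j) (σ := ∞) le_top).regular 0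
        ((mem_support_resc (h2 j)).2 (by simpa using h0)) 2 two_pos ENNReal.ofReal_lt_top).2) hη
    obtain ⟨J, hJ⟩ := hev.exists
    exact ⟨W, ω, J, by omega, hω, hWω, hJ⟩

/-- At the points and scales where finitely many odd bump convolutions are small on the support and
no `α`-number of dimension `k + 1` or `k + 2` is small, the measure is close to a vertical plane. -/
theorem exists_flat (hC₀ : 0 < C₀) (hkn : k ≤ n) {μ : Measure (PSpace n)} {ρ : ℝ≥0∞}
    (hμ : AdrTo C₀ k μ ρ) {ε b M : ℝ} (hε : 0 < ε) (hb : 0 < b) :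
    ∃ (S : Finset {ψ : PSpace n → ℝ // IsOddBump ψ}) (N : ℕ), ∀ Y ∈ μ.support, ∀ r : ℝ, 0 < r →
      ENNReal.ofReal (N * r) < ρ →
      (∀ ψ ∈ S, ∀ X ∈ μ.support, pnorm (X - Y) < N * r → |convo k ψ.1 μ r X| ≤ 1 / N) →
      (∀ J ≤ N, ∀ m, m = k + 1 ∨ m = k + 2 → ¬ AlphaSmall C₀ k ε μ m J Y r) →
      ∃ V : Submodule ℝ (EuclideanSpace ℝ (Fin n)), finrank ℝ V = k ∧
        ∫⁻ Z in pball 0 M, ENNReal.ofReal (‖offset V 0 Z.1‖ ^ 2) ∂(resc k μ Y r) ≤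
          ENNReal.ofReal b := by
  classical
  by_contra hcon
  push Not at hcon
  choose Y hY r hr hN hS hA hV using hcon
  have := hμ.locallyFinite
  -- along an ultrafilter finer than `atTop` every bump eventually belongs to the finite set, and `N`
  -- tends to infinity; `ν` is the limit of the counterexamples
  let U : Ultrafilter (Finset {ψ : PSpace n → ℝ // IsOddBump ψ} × ℕ) := Ultrafilter.of atTop
  have hUle : (U : Filter (Finset {ψ : PSpace n → ℝ // IsOddBump ψ} × ℕ)) ≤ atTop := Ultrafilter.of_le _
  have hUN : ∀ j : ℝ, ∀ᶠ i in (U : Filter (Finset {ψ : PSpace n → ℝ // IsOddBump ψ} × ℕ)),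
      j ≤ (i.2 : ℝ) := fun j => by
    refine hUle ?_
    filter_upwards [eventually_ge_atTop ((∅, ⌈j⌉₊) : Finset _ × ℕ)] with i hi
    exact Nat.ceil_le.1 hi.2
  have hUψ : ∀ ψ, ∀ᶠ i in (U : Filter (Finset {ψ : PSpace n → ℝ // IsOddBump ψ} × ℕ)),
      ψ ∈ i.1 := fun ψ => by
    refine hUle ?_
    filter_upwards [eventually_ge_atTop (({ψ}, 0) : Finset _ × ℕ)] with i hi
    exact hi.1 (Finset.mem_singleton_self ψ)
  set m : Finset {ψ : PSpace n → ℝ // IsOddBump ψ} × ℕ → Measure (PSpace n) :=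
    fun i => resc k μ (Y i.1 i.2) (r i.1 i.2) with hm
  have hadr : ∀ R : ℝ, ∀ᶠ i in (U : Filter (Finset {ψ : PSpace n → ℝ // IsOddBump ψ} × ℕ)),
      AdrTo C₀ k (m i) (ENNReal.ofReal R) := fun R => by
    filter_upwards [hUN R] with i hi
    refine hμ.resc _ (hr _ _) ?_
    rw [← ENNReal.ofReal_mul (hr _ _).le]
    refine le_trans (ENNReal.ofReal_le_ofReal ?_) (hN i.1 i.2).le
    rw [mul_comm]
    exact mul_le_mul_of_nonneg_right hi (hr _ _).le
  have h0 : ∀ i, (0 : PSpace n) ∈ (m i).support := fun i =>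
    (mem_support_resc (hr _ _)).2 (by simpa using hY i.1 i.2)
  have hml : ∀ i, IsLocallyFiniteMeasure (m i) := fun i => isLocallyFiniteMeasure_resc (hr _ _)
  obtain ⟨ν, hνl, hν⟩ := exists_vagueLim hC₀ U hadr (Eventually.of_forall h0)
  have hνa := hν.adrTo hadr
  have hν0 := hν.zero_mem_support hC₀ hadr (Eventually.of_forall h0)
  have hmass : ∀ R : ℝ, 0 < R →
      ∀ᶠ i in (U : Filter (Finset {ψ : PSpace n → ℝ // IsOddBump ψ} × ℕ)),
      m i (pball 0 R) ≤ ENNReal.ofReal (C₀ * R ^ (k + 2)) := fun R hR => by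
    filter_upwards [hadr (R + 1)] with i hi
    exact measure_pball_zero_le hR hi (h0 i)
  -- in the limit the convolutions vanish: a point `X` of the support of `ν` is a limit of points `X'`
  -- of the supports of the `m i`, where they are at most `1 / N`
  have hodd : ∀ X ∈ ν.support, ∀ ψ : PSpace n → ℝ, IsOddBump ψ → ∫ Y, ψ (X - Y) ∂ν = 0 := by
    intro X hX ψ hψ
    have hψc := hψ.smooth.continuous
    have hψs := hψ.hasCompactSupport
    obtain ⟨R, hR, hψR⟩ := exists_pball_of_hasCompactSupport hψs
    set A := C₀ * (R + pnorm X + 1) ^ (k + 2) with hAdef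
    have hRX : 0 < R + pnorm X + 1 := by have := pnorm_nonneg X; positivity
    have hA0 : 0 ≤ A := by positivity
    have hlim := (hν (fun Z => ψ (X - Z)) (hψc.comp (by fun_prop))
      (hψs.comp_homeomorph (Homeomorph.subLeft X))).abs
    have hle : ∀ η > 0, |∫ Z, ψ (X - Z) ∂ν| ≤ η * (1 + A) := by
      intro η hη
      obtain ⟨δ, hδ, huc⟩ := Metric.uniformContinuous_iff.1
        (hψs.uniformContinuous_of_continuous hψc) η hη
      obtain ⟨δ', hδ', hsub⟩ := exists_pball_subset (Metric.ball_mem_nhds X hδ)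
      refine le_of_tendsto hlim ?_
      filter_upwards [hν.exists_near hX (lt_min hδ' one_pos), hmass _ hRX, hUψ ⟨ψ, hψ⟩,
        hUN (pnorm X + 1), hUN (1 / η)] with i ⟨X', hX', hXX'⟩ hmi hψi hNi hNi'
      have := hml i
      have i1 := integrable_of_hasCompactSupport (m i)
        (hψc.comp (by fun_prop : Continuous fun Z => X - Z))
        (hψs.comp_homeomorph (Homeomorph.subLeft X))
      have i2 := integrable_of_hasCompactSupport (m i)
        (hψc.comp (by fun_prop : Continuous fun Z => X' - Z))
        (hψs.comp_homeomorph (Homeomorph.subLeft X'))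
      have b1 : |∫ Z, (ψ (X - Z) - ψ (X' - Z)) ∂(m i)| ≤ η * A := by
        refine abs_integral_le_of_pball (m i) (X := 0) (fun Z hZ => ?_) (fun Z => ?_) hA0 hmi
        · rw [zero_sub, pnorm_neg]
          by_cases hz : ψ (X - Z) = 0
          · have h4 : ψ (X' - Z) ≠ 0 := fun h5 => hZ (by rw [hz, h5, sub_zero])
            have h5 := hψR _ h4
            have h6 := pnorm_add_le (X - X') (X' - Z)
            have h7 := pnorm_add_le X (-((X - X') + (X' - Z)))
            rw [pnorm_neg, show X + -((X - X') + (X' - Z)) = Z by abel] at h7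
            have h8 := hXX'.trans_le (min_le_right _ _)
            linarith
          · have h5 := hψR _ hz
            have h7 := pnorm_add_le X (-(X - Z))
            rw [pnorm_neg, show X + -(X - Z) = Z by abel] at h7
            linarith
        · have hd : dist (X - Z) (X' - Z) < δ := by
            have hb : X' ∈ Metric.ball X δ := hsub (hXX'.trans_le (min_le_left _ _))
            rw [dist_sub_right, dist_comm]; exact hb
          have := huc hd
          rw [Real.dist_eq] at this
          exact this.le
      have e := integral_sub i1 i2
      simp only [Function.comp_apply] at e
      rw [e] at b1
      have b2 : |∫ Z, ψ (X' - Z) ∂(m i)| ≤ η := by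
        rw [hm, integral_resc_sub (hr _ _)]
        have hX's := (mem_support_resc (hr _ _)).1 hX'
        refine (hS i.1 i.2 _ hψi _ hX's ?_).trans ?_
        · rw [add_sub_cancel_left, pnorm_dil (hr _ _).le, mul_comm]
          refine mul_lt_mul_of_pos_right (lt_of_lt_of_le ?_ hNi) (hr _ _)
          have h6 := pnorm_add_le X (-(X - X'))
          rw [pnorm_neg, show X + -(X - X') = X' by abel] at h6
          have h8 := hXX'.trans_le (min_le_right _ _)
          linarith
        · have : (0 : ℝ) < i.2 := (by positivity : (0 : ℝ) < 1 / η).trans_le hNi'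
          rw [div_le_iff₀ this]
          rw [div_le_iff₀ hη] at hNi'
          linarith
      rw [abs_le] at *
      constructor <;> linarith [b1.1, b1.2, b2.1, b2.2]
    by_contra hne
    have hpos := abs_pos.2 hne
    have h1 := hle (|∫ Z, ψ (X - Z) ∂ν| / (2 * (1 + A))) (by positivity)
    rw [div_mul_eq_mul_div, le_div_iff₀ (by positivity)] at h1
    nlinarith
  rcases flat_or_close hC₀ hkn hνa hν0 hodd (η := ε / 3) (by positivity) with
    ⟨V, hVk, hVs⟩ | ⟨W, ω, J, hWd, hω, hWω, hJ⟩
  -- the limit is flat, so the `m i` are eventually close to the same plane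
  · set g : PSpace n → ℝ := fun Z => tent 0 M (M + 1) Z * ‖offset V 0 Z.1‖ ^ 2 with hg
    have hgc : Continuous g := (continuous_tent _ _ _).mul
      (((continuous_offset V 0).comp continuous_fst).norm.pow 2)
    have hgs : HasCompactSupport g := (hasCompactSupport_tent 0 (by linarith)).mul_right
    have hg0 : ∀ Z, 0 ≤ g Z := fun Z => mul_nonneg (tent_nonneg _ _ _ _) (by positivity)
    have hgν : ∫ Z, g Z ∂ν = 0 := by
      refine integral_eq_zero_of_ae ?_
      filter_upwards [ae_mem_support ν] with Z hZ
      have : offset V 0 Z.1 = 0 := by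
        rw [offset, sub_zero]
        exact Submodule.starProjection_orthogonal_apply_eq_zero (hVs Z hZ)
      simp [hg, this]
    have hev := (hν g hgc hgs).eventually_lt_const (u := b) (by rw [hgν]; exact hb)
    obtain ⟨i, hi⟩ := hev.exists
    have h1 := hV i.1 i.2 V hVk
    have := hml i
    refine absurd (lt_of_lt_of_le h1 ?_) (not_lt.2 (ENNReal.ofReal_le_ofReal hi.le))
    rw [ofReal_integral_eq_lintegral_ofReal (integrable_of_hasCompactSupport _ hgc hgs)
      (Eventually.of_forall hg0), ← lintegral_indicator (measurableSet_pball _ _)]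
    refine lintegral_mono fun Z => ?_
    by_cases hZ : Z ∈ pball 0 M
    · rw [indicator_of_mem hZ, hg]
      simp only
      rw [tent_eq_one (by linarith) (mem_pball.1 hZ).le, one_mul]
    · rw [indicator_of_notMem hZ]; exact zero_le
  -- the limit is close to a product measure, so the `α`-numbers of the `m i` are eventually small
  · have h2J : (0 : ℝ) < 2 ^ J := by positivity
    have hνl2 : IsLocallyFiniteMeasure (resc k ν 0 (2 ^ J)) := isLocallyFiniteMeasure_resc h2J
    have hev := (hν.resc (k := k) 0 h2J).eventually_lipTest (M := C₀ * 2 ^ (k + 2))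
      (Eventually.of_forall fun i => by
        have := hml i
        exact isLocallyFiniteMeasure_resc h2J) ?_ (ε := ε / 3) (by positivity)
    · obtain ⟨i, hi, hNi⟩ := (hev.and (hUN J)).exists
      refine hA i.1 i.2 J (by exact_mod_cast hNi) (finrank ℝ W) hWd fun Z hZ s hs => ?_
      have hri := hr i.1 i.2
      have hclose : ∀ f, LipTest f →
          |∫ A, f A ∂(resc k μ (Y i.1 i.2) (2 ^ J * r i.1 i.2)) - ∫ A, f A ∂ω| ≤ 2 * ε / 3 := by
        intro f hf
        have e : resc k μ (Y i.1 i.2) (2 ^ J * r i.1 i.2) = resc k (m i) 0 (2 ^ J) := by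
          rw [hm, resc_resc hri h2J, dil_zero, add_zero, mul_comm]
        rw [e]
        have b1 := hi f hf
        have b2 := hJ f hf
        rw [abs_le] at *
        constructor <;> linarith [b1.1, b1.2, b2.1, b2.2]
      refine (alphaNumber_le_of_lipTest hWω hω (by positivity) (by positivity) hclose
        (pball_mono ?_ hZ) hs).trans_lt ?_
      · have : (1 : ℝ) ≤ 2 ^ J := one_le_pow₀ one_le_two
        nlinarith
      · exact ENNReal.ofReal_lt_ofReal_iff'.2 ⟨by linarith, hε⟩
    · filter_upwards [hadr (2 ^ J * 3)] with i hi
      refine ((hi.resc (σ := ENNReal.ofReal 3) 0 h2J ?_).regular 0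
        ((mem_support_resc h2J).2 (by simpa using h0 i)) 2 two_pos ?_).2
      · rw [← ENNReal.ofReal_mul h2J.le]
      · exact ENNReal.ofReal_lt_ofReal_iff'.2 ⟨by norm_num, by norm_num⟩

end ParabolicUR

/-! ### Admissible kernels as sums of dilated bumps -/

namespace ParabolicUR

open Filter Topology
open scoped ContDiff

variable {n k : ℕ}

/-- The time derivative of order `j`. -/
noncomputable def timeDeriv (j : ℕ) (ψ : PSpace n → ℝ) (X : PSpace n) : ℝ :=
  iteratedDeriv j (fun s : ℝ => ψ (X.1, s)) X.2

lemma timeDeriv_succ {ψ : PSpace n → ℝ} (hψ : ContDiff ℝ ∞ ψ) (j : ℕ) :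
    timeDeriv (j + 1) ψ = timeDeriv j fun X => fderiv ℝ ψ X (0, 1) := by
  funext X
  rw [timeDeriv, timeDeriv, iteratedDeriv_succ']
  congr 1
  funext s
  have h1 : HasFDerivAt ψ (fderiv ℝ ψ (X.1, s)) (X.1, s) :=
    (hψ.differentiable (by simp) _).hasFDerivAt
  have h2 : HasDerivAt (fun s : ℝ => ((X.1, s) : PSpace n)) (0, 1) s :=
    (hasDerivAt_const s X.1).prodMk (hasDerivAt_id s)
  exact (h1.comp_hasDerivAt s h2).deriv

lemma timeDeriv_smooth {ψ : PSpace n → ℝ} (hψ : ContDiff ℝ ∞ ψ) (hc : HasCompactSupport ψ) (j : ℕ) :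
    ContDiff ℝ ∞ (timeDeriv j ψ) ∧ HasCompactSupport (timeDeriv j ψ) := by
  induction j generalizing ψ with
  | zero =>
    have : timeDeriv 0 ψ = ψ := by funext X; simp [timeDeriv]
    rw [this]; exact ⟨hψ, hc⟩
  | succ j ih =>
    rw [timeDeriv_succ hψ]
    refine ih ((hψ.fderiv_right (m := ∞) (by simp)).clm_apply contDiff_const) ?_
    exact (hc.fderiv ℝ).comp_left (g := fun L : PSpace n →L[ℝ] ℝ => L (0, 1)) (by simp)

lemma norm_iteratedFDeriv_slice_le {Φ : PSpace n → ℝ} (hΦ : ContDiff ℝ ∞ Φ) (l : ℕ) {C : ℝ}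
    (hC : ∀ Z, ‖iteratedFDeriv ℝ l Φ Z‖ ≤ C) {c : ℝ} (hc : 0 ≤ c) (τ : ℝ)
    (x : EuclideanSpace ℝ (Fin n)) :
    ‖iteratedFDeriv ℝ l (fun x' : EuclideanSpace ℝ (Fin n) => Φ (c • x', τ)) x‖ ≤ C * c ^ l := by
  set g : EuclideanSpace ℝ (Fin n) →L[ℝ] PSpace n :=
    c • ContinuousLinearMap.inl ℝ (EuclideanSpace ℝ (Fin n)) ℝ with hg
  set f : PSpace n → ℝ := fun Z => Φ (Z + (0, τ)) with hf
  have hfs : ContDiff ℝ ∞ f := hΦ.comp (contDiff_id.add contDiff_const)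
  have e : (fun x' : EuclideanSpace ℝ (Fin n) => Φ (c • x', τ)) = f ∘ g := by
    funext x'
    simp [hf, hg]
  have hgn : ‖g‖ ≤ c := by
    rw [hg, norm_smul, Real.norm_of_nonneg hc]
    exact mul_le_of_le_one_right hc (ContinuousLinearMap.norm_inl_le_one ℝ _ _)
  rw [e, g.iteratedFDeriv_comp_right hfs x (i := l) (by exact_mod_cast le_top)]
  refine (ContinuousMultilinearMap.norm_compContinuousLinearMap_le _ _).trans ?_
  rw [Finset.prod_const, Finset.card_univ, Fintype.card_fin]
  have h1 : ‖iteratedFDeriv ℝ l f (g x)‖ ≤ C := by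
    rw [hf, iteratedFDeriv_comp_add_right]; exact hC _
  exact mul_le_mul h1 (pow_le_pow_left₀ (norm_nonneg _) hgn l) (by positivity)
    ((norm_nonneg _).trans h1)

/-- The kernel `ψ` rescaled to scale `s`, with the normalisation of a density of dimension `k+2`. -/
noncomputable def scaled (k : ℕ) (ψ : PSpace n → ℝ) (s : ℝ) (X : PSpace n) : ℝ :=
  (s ^ (k + 2))⁻¹ * ψ (dil s⁻¹ X)

lemma convo_eq_integral_scaled (ψ : PSpace n → ℝ) (μ : Measure (PSpace n)) (r : ℝ) (X : PSpace n) :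
    convo k ψ μ r X = ∫ Z, scaled k ψ r (X - Z) ∂μ := by
  simp only [scaled, convo, integral_const_mul]

lemma contDiff_scaled {ψ : PSpace n → ℝ} (hψ : ContDiff ℝ ∞ ψ) (s : ℝ) :
    ContDiff ℝ ∞ (scaled k ψ s) :=
  contDiff_const.mul (hψ.comp (contDiff_dil _))

lemma scaled_ne_zero {ψ : PSpace n → ℝ} {ρ ρ' s : ℝ} (hs : 0 < s)
    (hψ : ∀ X, ψ X ≠ 0 → ρ < pnorm X ∧ pnorm X < ρ') {X : PSpace n} (h : scaled k ψ s X ≠ 0) :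
    s * ρ < pnorm X ∧ pnorm X < s * ρ' := by
  have := hψ _ (right_ne_zero_of_mul h)
  rw [pnorm_dil (inv_nonneg.2 hs.le), lt_inv_mul_iff₀ hs, inv_mul_lt_iff₀ hs] at this
  exact this

lemma scaled_odd {ψ : PSpace n → ℝ} (hψ : IsOddBump ψ) (s : ℝ) (x : EuclideanSpace ℝ (Fin n))
    (t : ℝ) : scaled k ψ s (-x, t) = -scaled k ψ s (x, t) := by
  have := hψ.odd (s⁻¹ • x) (s⁻¹ ^ 2 * t)
  simp only [scaled, dil, smul_neg, this]; ring

lemma IsOddBump.scaled {ψ : PSpace n → ℝ} (hψ : IsOddBump ψ) {s : ℝ} (hs : 0 < s) :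
    IsOddBump (scaled k ψ s) := by
  obtain ⟨ρ, hρ, h⟩ := hψ.annular
  exact isOddBump_of_bounds (contDiff_scaled hψ.smooth s) (scaled_odd hψ s) (mul_pos hs hρ)
    fun X hX => scaled_ne_zero hs h hX

lemma scaled_scaled (ψ : PSpace n → ℝ) (s r : ℝ) (X : PSpace n) :
    scaled k (scaled k ψ s) r X = scaled k ψ (s * r) X := by
  simp only [scaled, dil_dil, mul_inv, mul_pow]; ring

/-- All mixed derivatives of the rescaled kernel, bounded by the natural power of the scale. -/
lemma exists_bound_scaled {ψ : PSpace n → ℝ} (hψ : ContDiff ℝ ∞ ψ) (hc : HasCompactSupport ψ)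
    (l j : ℕ) : ∃ C : ℝ, 0 ≤ C ∧ ∀ (A s : ℝ), 0 < s → ∀ (x : EuclideanSpace ℝ (Fin n)) (t : ℝ),
      ‖iteratedFDeriv ℝ l (fun x' : EuclideanSpace ℝ (Fin n) =>
        iteratedDeriv j (fun τ : ℝ => A * scaled k ψ s (x', τ)) t) x‖ ≤
      |A| * C * (s⁻¹) ^ (k + 2 + l + 2 * j) := by
  obtain ⟨hΦ, hΦc⟩ := timeDeriv_smooth hψ hc j
  obtain ⟨C, hC⟩ := (hΦc.iteratedFDeriv (𝕜 := ℝ) l).exists_bound_of_continuous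
    (hΦ.continuous_iteratedFDeriv (m := l) (by exact_mod_cast le_top))
  refine ⟨C, (norm_nonneg _).trans (hC 0), fun A s hs x t => ?_⟩
  have e : (fun x' : EuclideanSpace ℝ (Fin n) =>
      iteratedDeriv j (fun τ : ℝ => A * scaled k ψ s (x', τ)) t) =
      fun x' => (A * (s⁻¹) ^ (k + 2) * (s⁻¹) ^ (2 * j)) •
        timeDeriv j ψ (s⁻¹ • x', s⁻¹ ^ 2 * t) := by
    funext x'
    have h1 : ContDiff ℝ j (fun τ : ℝ => ψ (s⁻¹ • x', τ)) :=
      (hψ.comp (contDiff_const.prodMk contDiff_id)).of_le (by exact_mod_cast le_top)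
    have h2 := congrFun (iteratedDeriv_comp_const_mul h1 (s⁻¹ ^ 2)) t
    simp only [scaled, dil, timeDeriv, smul_eq_mul]
    have h3 : (fun τ : ℝ => A * ((s ^ (k + 2))⁻¹ * ψ (s⁻¹ • x', s⁻¹ ^ 2 * τ))) =
        fun τ => (A * (s ^ (k + 2))⁻¹) * ψ (s⁻¹ • x', s⁻¹ ^ 2 * τ) := by
      funext τ; ring
    rw [h3, iteratedDeriv_const_mul_field, h2, inv_pow s (k + 2), pow_mul]
    ring
  rw [e]
  have h4 : ContDiff ℝ l fun x' : EuclideanSpace ℝ (Fin n) =>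
      timeDeriv j ψ (s⁻¹ • x', s⁻¹ ^ 2 * t) :=
    (hΦ.comp (by fun_prop : ContDiff ℝ ∞ fun x' : EuclideanSpace ℝ (Fin n) =>
      ((s⁻¹ • x', s⁻¹ ^ 2 * t) : PSpace n))).of_le (by exact_mod_cast le_top)
  have h5 := iteratedFDeriv_const_smul_apply (𝕜 := ℝ)
    (a := A * (s⁻¹) ^ (k + 2) * (s⁻¹) ^ (2 * j)) (h4.contDiffAt (x := x))
  have h6 : ‖iteratedFDeriv ℝ l ((A * (s⁻¹) ^ (k + 2) * (s⁻¹) ^ (2 * j)) •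
      fun x' : EuclideanSpace ℝ (Fin n) => timeDeriv j ψ (s⁻¹ • x', s⁻¹ ^ 2 * t)) x‖ ≤
      |A| * C * (s⁻¹) ^ (k + 2 + l + 2 * j) := by
    rw [h5, norm_smul]
    have h7 := norm_iteratedFDeriv_slice_le hΦ l hC (inv_nonneg.2 hs.le) (s⁻¹ ^ 2 * t) x
    have h8 : ‖A * (s⁻¹) ^ (k + 2) * (s⁻¹) ^ (2 * j)‖ = |A| * (s⁻¹) ^ (k + 2) * (s⁻¹) ^ (2 * j) := by
      rw [norm_mul, norm_mul, Real.norm_eq_abs, Real.norm_of_nonneg (by positivity),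
        Real.norm_of_nonneg (by positivity)]
    rw [h8]
    calc |A| * (s⁻¹) ^ (k + 2) * (s⁻¹) ^ (2 * j) * _
        ≤ |A| * (s⁻¹) ^ (k + 2) * (s⁻¹) ^ (2 * j) * (C * s⁻¹ ^ l) := by gcongr
      _ = _ := by ring
  exact h6

/-- The sum `∑ⱼ aⱼ λ^{-j(k+2)} ψ(λ^{-j} ·)`. For `λ` large, at most one term is nonzero at each
point. -/
noncomputable def bumpSum (k : ℕ) (ψ : PSpace n → ℝ) (lam : ℝ) (a : ℤ → ℝ) (X : PSpace n) : ℝ :=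
  ∑ᶠ j : ℤ, a j * scaled k ψ (lam ^ j) X

section BumpSum

variable {ψ : PSpace n → ℝ} {ρ ρ' lam : ℝ}

lemma lam_pow_mul_lt (hρ : 0 < ρ) (hlam : 4 * ρ' ≤ lam * ρ) (hl1 : 1 < lam)
    {i j : ℤ} (h : j < i) : lam ^ j * ρ' ≤ lam ^ i * (ρ / 4) := by
  have hl0 : 0 < lam := by linarith
  have h1 : lam ^ (j + 1) ≤ lam ^ i := zpow_le_zpow_right₀ hl1.le h
  rw [zpow_add_one₀ hl0.ne'] at h1
  have h2 : lam ^ j * ρ' ≤ lam ^ j * lam * (ρ / 4) := by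
    rw [mul_assoc]
    refine mul_le_mul_of_nonneg_left ?_ (zpow_pos hl0 _).le
    linarith
  exact h2.trans (mul_le_mul_of_nonneg_right h1 (by positivity))

lemma le_lam_pow_mul (hρ : 0 < ρ) (hl1 : 1 < lam) {i j : ℤ} (h : i ≤ j) :
    lam ^ i * ρ ≤ lam ^ j * ρ :=
  mul_le_mul_of_nonneg_right (zpow_le_zpow_right₀ hl1.le h) hρ.le

/-- Near each point off the origin, the sum has a single term, whose scale is comparable to the
distance to the origin. -/
lemma exists_local_index (hρ : 0 < ρ) (hψ : ∀ X, ψ X ≠ 0 → ρ < pnorm X ∧ pnorm X < ρ')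
    (hlam : 4 * ρ' ≤ lam * ρ) (hl1 : 1 < lam) {X₀ : PSpace n} (hX₀ : X₀ ≠ 0) :
    ∃ i : ℤ, pnorm X₀ < lam ^ i * (lam * (ρ / 2)) ∧
      ∀ᶠ X in 𝓝 X₀, ∀ j ≠ i, scaled k ψ (lam ^ j) X = 0 := by
  have hl0 : 0 < lam := by linarith
  have hu := pnorm_pos hX₀
  obtain ⟨i, hi1, hi2⟩ := exists_mem_Ico_zpow (x := pnorm X₀ / (ρ / 2)) (by positivity) hl1
  rw [le_div_iff₀ (by positivity)] at hi1
  rw [div_lt_iff₀ (by positivity), zpow_add_one₀ hl0.ne'] at hi2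
  refine ⟨i, by rw [← mul_assoc]; exact hi2, ?_⟩
  have hev : ∀ᶠ X in 𝓝 X₀, pnorm X ∈ Ioo (pnorm X₀ / 2) (2 * pnorm X₀) :=
    continuous_pnorm.continuousAt (Ioo_mem_nhds (by linarith) (by linarith))
  filter_upwards [hev] with X hX j hj
  by_contra hne
  obtain ⟨h1, h2⟩ := scaled_ne_zero (zpow_pos hl0 j) hψ hne
  rcases lt_or_gt_of_ne hj with hlt | hgt
  · have := lam_pow_mul_lt hρ hlam hl1 hlt
    linarith [hX.1]
  · have := le_lam_pow_mul hρ hl1 (show i + 1 ≤ j from hgt)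
    rw [zpow_add_one₀ hl0.ne'] at this
    linarith [hX.2]

lemma bumpSum_eventuallyEq (a : ℤ → ℝ) {X₀ : PSpace n} {i : ℤ}
    (h : ∀ᶠ X in 𝓝 X₀, ∀ j ≠ i, scaled k ψ (lam ^ j) X = 0) :
    bumpSum k ψ lam a =ᶠ[𝓝 X₀] fun X => a i * scaled k ψ (lam ^ i) X := by
  filter_upwards [h] with X hX
  exact finsum_eq_single _ i fun j hj => by rw [hX j hj, mul_zero]

/-- The sums of dilated odd bumps with bounded coefficients are admissible kernels. -/
theorem isAdmissibleKernel_bumpSum (hψ : IsOddBump ψ) (hρ : 0 < ρ)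
    (hψρ : ∀ X, ψ X ≠ 0 → ρ < pnorm X ∧ pnorm X < ρ') (hlam : 4 * ρ' ≤ lam * ρ) (hl1 : 1 < lam)
    {a : ℤ → ℝ} {A : ℝ} (ha : ∀ j, |a j| ≤ A) : IsAdmissibleKernel k (bumpSum k ψ lam a) := by
  have hl0 : 0 < lam := by linarith
  refine ⟨fun X₀ hX₀ => ?_, fun x t _ => ?_, fun l j => ?_⟩
  · obtain ⟨i, -, hi⟩ := exists_local_index (k := k) hρ hψρ hlam hl1 hX₀
    refine ContDiffAt.contDiffWithinAt (ContDiffAt.congr_of_eventuallyEq ?_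
      (bumpSum_eventuallyEq a hi))
    exact (contDiff_const.mul (contDiff_scaled hψ.smooth _)).contDiffAt
  · rw [bumpSum, bumpSum, ← finsum_neg_distrib]
    exact finsum_congr fun j => by rw [scaled_odd hψ]; ring
  · obtain ⟨C, hC0, hC⟩ := exists_bound_scaled (k := k) hψ.smooth hψ.hasCompactSupport l j
    have hA : 0 ≤ A := (abs_nonneg _).trans (ha 0)
    refine ⟨A * C * (lam * (ρ / 2)) ^ (k + 2 + l + 2 * j), fun x t hxt => ?_⟩
    obtain ⟨i, hi1, hi⟩ := exists_local_index (k := k) hρ hψρ hlam hl1 hxt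
    have hev := bumpSum_eventuallyEq a hi
    rw [EventuallyEq, nhds_prod_eq] at hev
    have hcur := hev.curry
    have hloc : (fun x' : EuclideanSpace ℝ (Fin n) =>
        iteratedDeriv j (fun s : ℝ => bumpSum k ψ lam a (x', s)) t) =ᶠ[𝓝 x]
        fun x' => iteratedDeriv j (fun s : ℝ => a i * scaled k ψ (lam ^ i) (x', s)) t := by
      filter_upwards [hcur] with x' hx'
      exact EventuallyEq.iteratedDeriv_eq j hx'
    rw [(hloc.iteratedFDeriv ℝ l).self_of_nhds]
    have hs : 0 < lam ^ i := zpow_pos hl0 i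
    refine (hC (a i) (lam ^ i) hs x t).trans ?_
    have hp := pnorm_pos hxt
    rw [le_div_iff₀ (by positivity)]
    have h2 : (lam ^ i)⁻¹ * pnorm (x, t) ≤ lam * (ρ / 2) := by
      rw [inv_mul_le_iff₀ hs]; exact hi1.le
    calc |a i| * C * (lam ^ i)⁻¹ ^ (k + 2 + l + 2 * j) * pnorm (x, t) ^ (k + 2 + l + 2 * j)
        = |a i| * C * ((lam ^ i)⁻¹ * pnorm (x, t)) ^ (k + 2 + l + 2 * j) := by
          rw [mul_assoc, ← mul_pow]
      _ ≤ A * C * (lam * (ρ / 2)) ^ (k + 2 + l + 2 * j) := by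
          gcongr
          exact ha i

/-- Truncating the sum between two of the gaps of its support leaves finitely many terms. -/
lemma indicator_bumpSum (hρ : 0 < ρ) (hψ : ∀ X, ψ X ≠ 0 → ρ < pnorm X ∧ pnorm X < ρ')
    (hlam : 4 * ρ' ≤ lam * ρ) (hl1 : 1 < lam) (a : ℤ → ℝ) (i i' : ℤ) (Z : PSpace n) :
    indicator {Z : PSpace n | lam ^ i * (ρ / 2) < pnorm Z ∧ ¬ lam ^ i' * (ρ / 2) < pnorm Z}
      (bumpSum k ψ lam a) Z = ∑ j ∈ Finset.Ico i i', a j * scaled k ψ (lam ^ j) Z := by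
  have hl0 : 0 < lam := by linarith
  have hp : ∀ j : ℤ, 0 < lam ^ j * ρ := fun j => mul_pos (zpow_pos hl0 j) hρ
  have hlow : ∀ j, scaled k ψ (lam ^ j) Z ≠ 0 → i ≤ j → lam ^ i * (ρ / 2) < pnorm Z := by
    intro j hj hij
    have h1 := (scaled_ne_zero (zpow_pos hl0 j) hψ hj).1
    have h2 := le_lam_pow_mul hρ hl1 hij
    linarith [hp i]
  have hhigh : ∀ j, scaled k ψ (lam ^ j) Z ≠ 0 → j < i' → pnorm Z < lam ^ i' * (ρ / 2) := by
    intro j hj hij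
    have h1 := (scaled_ne_zero (zpow_pos hl0 j) hψ hj).2
    have h2 := lam_pow_mul_lt hρ hlam hl1 hij
    linarith [hp i']
  by_cases hZ : lam ^ i * (ρ / 2) < pnorm Z ∧ ¬ lam ^ i' * (ρ / 2) < pnorm Z
  · rw [indicator_of_mem (by exact hZ), bumpSum]
    refine finsum_eq_sum_of_support_subset _ fun j hj => ?_
    have hj := right_ne_zero_of_mul hj
    rw [Finset.coe_Ico, mem_Ico]
    constructor
    · by_contra! hlt
      have h1 := (scaled_ne_zero (zpow_pos hl0 j) hψ hj).2
      have h2 := lam_pow_mul_lt hρ hlam hl1 hlt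
      linarith [hp i, hZ.1]
    · by_contra! hle
      have h1 := (scaled_ne_zero (zpow_pos hl0 j) hψ hj).1
      have h2 := le_lam_pow_mul hρ hl1 hle
      exact hZ.2 (by linarith [hp i'])
  · rw [indicator_of_notMem (by exact hZ)]
    refine (Finset.sum_eq_zero fun j hj => ?_).symm
    rw [Finset.mem_Ico] at hj
    by_contra hne
    have hne := right_ne_zero_of_mul hne
    exact hZ ⟨hlow j hne hj.1, not_lt.2 (hhigh j hne hj.2).le⟩

end BumpSum

end ParabolicUR

/-! ### The square function estimate -/

namespace ParabolicUR

open Filter Topology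
open scoped ContDiff BoundedContinuousFunction

variable {n k : ℕ}

/-- A choice of signs for which the sum of the vectors is at least as large as if they were
orthogonal: of `v + w` and `v - w`, one has norm squared at least `‖v‖² + ‖w‖²`. -/
lemma exists_signs {E ι : Type*} [NormedAddCommGroup E] [InnerProductSpace ℝ E] (s : Finset ι)
    (v : ι → E) : ∃ σ : ι → ℝ, (∀ j, |σ j| ≤ 1) ∧
      ∑ j ∈ s, ‖v j‖ ^ 2 ≤ ‖∑ j ∈ s, σ j • v j‖ ^ 2 := by
  classical
  induction s using Finset.induction_on with
  | empty => exact ⟨0, by simp, by simp⟩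
  | insert i s hi ih =>
    obtain ⟨σ, hσ, h⟩ := ih
    have hpar := parallelogram_law_with_norm ℝ (v i) (∑ j ∈ s, σ j • v j)
    have hsum : ∀ c : ℝ, ∑ j ∈ insert i s, Function.update σ i c j • v j =
        c • v i + ∑ j ∈ s, σ j • v j := by
      intro c
      rw [Finset.sum_insert hi, Function.update_self]
      congr 1
      exact Finset.sum_congr rfl fun j hj => by
        rw [Function.update_of_ne (fun h => hi (by rw [← h]; exact hj))]
    have hb : ∀ c : ℝ, |c| ≤ 1 → ∀ j, |Function.update σ i c j| ≤ 1 := by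
      intro c hc j
      by_cases hj : j = i
      · rw [hj, Function.update_self]; exact hc
      · rw [Function.update_of_ne hj]; exact hσ j
    rcases le_total (‖v i‖ ^ 2 + ‖∑ j ∈ s, σ j • v j‖ ^ 2) (‖v i + ∑ j ∈ s, σ j • v j‖ ^ 2)
      with hle | hle
    · refine ⟨Function.update σ i 1, hb 1 (by simp), ?_⟩
      rw [hsum, one_smul, Finset.sum_insert hi]
      linarith
    · refine ⟨Function.update σ i (-1), hb (-1) (by simp), ?_⟩
      rw [hsum, neg_one_smul, Finset.sum_insert hi]
      have : -v i + ∑ j ∈ s, σ j • v j = -(v i - ∑ j ∈ s, σ j • v j) := by abel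
      rw [this, norm_neg]
      nlinarith

lemma eLpNorm_two_sq {μ : Measure (PSpace n)} (g : PSpace n → ℝ) :
    eLpNorm g 2 μ ^ 2 = ∫⁻ X, ‖g X‖ₑ ^ 2 ∂μ := by
  have := eLpNorm_nnreal_pow_eq_lintegral (f := g) (μ := μ) (p := 2) two_ne_zero
  simpa using this

lemma ofReal_norm_sq_toLp {μ : Measure (PSpace n)} {v : Lp ℝ 2 μ} {g : PSpace n → ℝ} (h : v =ᵐ[μ] g) :
    ENNReal.ofReal (‖v‖ ^ 2) = ∫⁻ X, ‖g X‖ₑ ^ 2 ∂μ := by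
  rw [← eLpNorm_two_sq, ← eLpNorm_congr_ae h, Lp.norm_def, ENNReal.ofReal_pow ENNReal.toReal_nonneg,
    ENNReal.ofReal_toReal (Lp.eLpNorm_ne_top v)]

/-- The convolution of a dilated bump with the restriction of `μ` to a ball. -/
noncomputable def localConvo (k : ℕ) (ψ : PSpace n → ℝ) (μ : Measure (PSpace n)) (X₀ : PSpace n)
    (R s : ℝ) (X : PSpace n) : ℝ :=
  ∫ Y in pball X₀ R, scaled k ψ s (X - Y) ∂μ

lemma localConvo_scaled (ψ : PSpace n → ℝ) (μ : Measure (PSpace n)) (X₀ : PSpace n) (R s r : ℝ) (X : PSpace n) :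
    localConvo k (scaled k ψ s) μ X₀ R r X = localConvo k ψ μ X₀ R (s * r) X := by
  simp only [localConvo, scaled_scaled]

section

variable {μ : Measure (PSpace n)} [IsLocallyFiniteMeasure μ] {ψ : PSpace n → ℝ} {ρ ρ' lam : ℝ}

lemma integrable_scaled (hψ : IsOddBump ψ) {s : ℝ} (hs : 0 < s) (X : PSpace n) :
    Integrable (fun Y => scaled k ψ s (X - Y)) μ :=
  integrable_of_hasCompactSupport μ
    ((contDiff_scaled hψ.smooth s).continuous.comp (by fun_prop : Continuous fun Y => X - Y))
    ((hψ.scaled hs).hasCompactSupport.comp_homeomorph (Homeomorph.subLeft X))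

lemma measurable_localConvo (hψ : IsOddBump ψ) (X₀ : PSpace n) (R s : ℝ) :
    Measurable (localConvo k ψ μ X₀ R s) := by
  have h : StronglyMeasurable fun p : PSpace n × PSpace n => scaled k ψ s (p.1 - p.2) :=
    ((contDiff_scaled hψ.smooth s).continuous.comp (by fun_prop)).stronglyMeasurable
  exact (h.integral_prod_right' (ν := μ.restrict (pball X₀ R))).measurable

/-- With the radii of the truncations in the gaps of the support of the kernel, a difference of two
truncations of the operator is a finite sum of convolutions with single bumps. -/
lemma truncCZO_sub (hψ : IsOddBump ψ) (hρ : 0 < ρ)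
    (hψρ : ∀ X, ψ X ≠ 0 → ρ < pnorm X ∧ pnorm X < ρ') (hlam : 4 * ρ' ≤ lam * ρ) (hl1 : 1 < lam)
    {a : ℤ → ℝ} {A : ℝ} (ha : ∀ j, |a j| ≤ A) (X₀ : PSpace n) (R : ℝ) {i i' : ℤ} (hii : i ≤ i')
    (X : PSpace n) :
    truncCZO (bumpSum k ψ lam a) μ (lam ^ i * (ρ / 2)) (indicator (pball X₀ R) 1) X -
      truncCZO (bumpSum k ψ lam a) μ (lam ^ i' * (ρ / 2)) (indicator (pball X₀ R) 1) X =
    ∑ j ∈ Finset.Ico i i', a j * localConvo k ψ μ X₀ R (lam ^ j) X := by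
  have hl0 : 0 < lam := by linarith
  have hadm : IsAdmissibleKernel k (bumpSum k ψ lam a) :=
    isAdmissibleKernel_bumpSum hψ hρ hψρ hlam hl1 ha
  set K := bumpSum k ψ lam a with hK
  set S : ℝ → Set (PSpace n) := fun ε => {Y | ε < pnorm (X - Y)} with hS
  have hSm : ∀ ε, MeasurableSet (S ε) := fun ε =>
    (isOpen_lt continuous_const (continuous_pnorm.comp (by fun_prop))).measurableSet
  have hmul : ∀ Y, K (X - Y) * indicator (pball X₀ R) 1 Y =
      indicator (pball X₀ R) (fun Y => K (X - Y)) Y := fun Y => by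
    by_cases hY : Y ∈ pball X₀ R <;> simp [hY]
  have hε : 0 < lam ^ i * (ρ / 2) := mul_pos (zpow_pos hl0 i) (by positivity)
  have hεε : lam ^ i * (ρ / 2) ≤ lam ^ i' * (ρ / 2) :=
    mul_le_mul_of_nonneg_right (zpow_le_zpow_right₀ hl1.le hii) (by positivity)
  have hint : IntegrableOn (fun Y => K (X - Y) * indicator (pball X₀ R) 1 Y)
      (S (lam ^ i * (ρ / 2))) μ := by
    obtain ⟨C, hC⟩ := hadm.bound 0 0
    simp only [hmul]
    refine (integrable_indicator_iff (measurableSet_pball _ _)).2 ?_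
    refine Measure.integrableOn_of_bounded (M := |C| / (lam ^ i * (ρ / 2)) ^ (k + 2)) ?_ ?_ ?_
    · exact ((Measure.restrict_apply_le _ _).trans_lt (measure_pball_lt_top μ X₀ R)).ne
    · refine ContinuousOn.aestronglyMeasurable ?_ (hSm _)
      refine hadm.smooth.continuousOn.comp (by fun_prop) fun Y hY h0 => ?_
      have hY : lam ^ i * (ρ / 2) < pnorm (X - Y) := hY
      rw [mem_singleton_iff.1 h0, pnorm_zero] at hY
      linarith
    · refine ae_restrict_of_ae ((ae_restrict_mem (hSm _)).mono fun Y hY => ?_)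
      have hY : lam ^ i * (ρ / 2) < pnorm (X - Y) := hY
      have hne : ((X - Y).1, (X - Y).2) ≠ (0 : PSpace n) := fun h0 => by
        rw [show X - Y = 0 from h0, pnorm_zero] at hY
        linarith
      have h1 := hC _ _ hne
      simp only [norm_iteratedFDeriv_zero, iteratedDeriv_zero, mul_zero, add_zero] at h1
      refine h1.trans ((div_le_div_of_nonneg_right (le_abs_self C)
        (pow_nonneg (pnorm_nonneg _) _)).trans ?_)
      exact div_le_div_of_nonneg_left (abs_nonneg C) (pow_pos hε _)
        (pow_le_pow_left₀ hε.le hY.le _)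
  have hsub : S (lam ^ i' * (ρ / 2)) ⊆ S (lam ^ i * (ρ / 2)) := fun Y hY =>
    hεε.trans_lt hY
  rw [truncCZO, truncCZO]
  change ∫ Y in S (lam ^ i * (ρ / 2)), _ ∂μ - ∫ Y in S (lam ^ i' * (ρ / 2)), _ ∂μ = _
  rw [← setIntegral_sdiff (hSm _) hint hsub, ← integral_indicator ((hSm _).diff (hSm _))]
  have hpt : ∀ Y, indicator (S (lam ^ i * (ρ / 2)) \ S (lam ^ i' * (ρ / 2)))
      (fun Y => K (X - Y) * indicator (pball X₀ R) 1 Y) Y =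
      indicator (pball X₀ R)
        (fun Y => ∑ j ∈ Finset.Ico i i', a j * scaled k ψ (lam ^ j) (X - Y)) Y := by
    intro Y
    have h1 := indicator_bumpSum (k := k) hρ hψρ hlam hl1 a i i' (X - Y)
    by_cases hY : Y ∈ pball X₀ R
    · by_cases hY2 : Y ∈ S (lam ^ i * (ρ / 2)) \ S (lam ^ i' * (ρ / 2))
      · rw [indicator_of_mem (by exact hY2)] at h1
        rw [indicator_of_mem hY2, hmul, indicator_of_mem hY, indicator_of_mem hY, ← h1]
      · rw [indicator_of_notMem (by exact hY2)] at h1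
        rw [indicator_of_notMem hY2, indicator_of_mem hY, ← h1]
    · rw [indicator_of_notMem hY]
      simp [hY]
  simp only [hpt]
  rw [integral_indicator (measurableSet_pball _ _), integral_finsetSum]
  · exact Finset.sum_congr rfl fun j _ => integral_const_mul _ _
  · exact fun j _ => ((integrable_scaled hψ (zpow_pos hl0 j) X).restrict).const_mul _

/-- The bound for the maximal truncation, applied to the indicator of a ball. The constant depends on
the coefficients `a`, as it does on the kernel. -/
lemma lintegral_sum_le (hψ : IsOddBump ψ) (hρ : 0 < ρ)
    (hψρ : ∀ X, ψ X ≠ 0 → ρ < pnorm X ∧ pnorm X < ρ') (hlam : 4 * ρ' ≤ lam * ρ) (hl1 : 1 < lam)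
    (hCZO : ∀ K : PSpace n → ℝ, IsAdmissibleKernel k K → CZOBounded K μ)
    {a : ℤ → ℝ} {A : ℝ} (ha : ∀ j, |a j| ≤ A) :
    ∃ C : ℝ≥0, ∀ (X₀ : PSpace n) (R : ℝ) (i i' : ℤ),
      ∫⁻ X, ‖∑ j ∈ Finset.Ico i i', a j * localConvo k ψ μ X₀ R (lam ^ j) X‖ₑ ^ 2 ∂μ ≤
        C * μ (pball X₀ R) := by
  have hl0 : 0 < lam := by linarith
  obtain ⟨C, hC⟩ := hCZO _ (isAdmissibleKernel_bumpSum (k := k) hψ hρ hψρ hlam hl1 ha)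
  refine ⟨4 * C, fun X₀ R i i' => ?_⟩
  rcases le_or_gt i i' with hii | hii
  swap
  · simp [Finset.Ico_eq_empty_of_le hii.le]
  set f : PSpace n → ℝ := indicator (pball X₀ R) 1 with hf
  have hfm : MemLp f 2 μ :=
    memLp_indicator_const 2 (measurableSet_pball _ _) 1 (Or.inr (measure_pball_lt_top μ _ _).ne)
  have hfn : eLpNorm f 2 μ ^ 2 = μ (pball X₀ R) := by
    rw [eLpNorm_two_sq, ← lintegral_indicator_one (measurableSet_pball _ _)]
    refine lintegral_congr fun X => ?_
    by_cases hX : X ∈ pball X₀ R <;> simp [hf, hX]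
  have h1 := hC f hfm
  rw [hfn] at h1
  calc ∫⁻ X, ‖∑ j ∈ Finset.Ico i i', a j * localConvo k ψ μ X₀ R (lam ^ j) X‖ₑ ^ 2 ∂μ
      ≤ ∫⁻ X, 4 * ⨆ (ε : ℝ) (_ : 0 < ε), ‖truncCZO (bumpSum k ψ lam a) μ ε f X‖ₑ ^ 2 ∂μ := by
        refine lintegral_mono fun X => ?_
        rw [← truncCZO_sub hψ hρ hψρ hlam hl1 ha X₀ R hii X]
        set S := ⨆ (ε : ℝ) (_ : 0 < ε), ‖truncCZO (bumpSum k ψ lam a) μ ε f X‖ₑ ^ 2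
        have hle : ∀ i : ℤ,
            ‖truncCZO (bumpSum k ψ lam a) μ (lam ^ i * (ρ / 2)) f X‖ₑ ^ 2 ≤ S := fun i =>
          le_iSup₂_of_le (lam ^ i * (ρ / 2)) (mul_pos (zpow_pos hl0 i) (by positivity)) le_rfl
        set u := ‖truncCZO (bumpSum k ψ lam a) μ (lam ^ i * (ρ / 2)) f X‖ₑ
        set v := ‖truncCZO (bumpSum k ψ lam a) μ (lam ^ i' * (ρ / 2)) f X‖ₑ
        calc _ ≤ (u + v) ^ 2 := by gcongr; exact enorm_sub_le
          _ ≤ (2 * max u v) ^ 2 := by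
              gcongr
              rw [two_mul]
              exact add_le_add (le_max_left _ _) (le_max_right _ _)
          _ = 4 * (max u v) ^ 2 := by rw [mul_pow]; norm_num
          _ ≤ 4 * S := by
              gcongr
              rcases max_choice u v with h | h <;> rw [h]
              · exact hle i
              · exact hle i'
    _ = 4 * ∫⁻ X, ⨆ (ε : ℝ) (_ : 0 < ε), ‖truncCZO (bumpSum k ψ lam a) μ ε f X‖ₑ ^ 2 ∂μ :=
        lintegral_const_mul' _ _ (by norm_num)
    _ ≤ 4 * (C * μ (pball X₀ R)) := by gcongr
    _ = _ := by rw [ENNReal.coe_mul, mul_assoc]; norm_num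

/-- If all admissible kernels define bounded operators, then the convolutions with dilates of an odd
bump are square summable over the scales. By the uniform boundedness principle on `ℓ^∞(ℤ)` the
operators with kernels `∑ ±ψⱼ` are bounded uniformly in the signs. -/
theorem exists_square_bound_of_gap (hψ : IsOddBump ψ) (hρ : 0 < ρ)
    (hψρ : ∀ X, ψ X ≠ 0 → ρ < pnorm X ∧ pnorm X < ρ') (hlam : 4 * ρ' ≤ lam * ρ) (hl1 : 1 < lam)
    (hCZO : ∀ K : PSpace n → ℝ, IsAdmissibleKernel k K → CZOBounded K μ) :
    ∃ C : ℝ≥0, ∀ (X₀ : PSpace n) (R : ℝ) (i i' : ℤ),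
      ∑ j ∈ Finset.Ico i i', ∫⁻ X, ‖localConvo k ψ μ X₀ R (lam ^ j) X‖ₑ ^ 2 ∂μ ≤
        C * μ (pball X₀ R) := by
  have hG : ∀ X₀ R (j : ℤ), MemLp (localConvo k ψ μ X₀ R (lam ^ j)) 2 μ := by
    intro X₀ R j
    refine ⟨(measurable_localConvo hψ X₀ R _).aestronglyMeasurable, ?_⟩
    obtain ⟨C, hC⟩ := lintegral_sum_le (A := 1) hψ hρ hψρ hlam hl1 hCZO (a := fun _ => 1) (by simp)
    have h1 := hC X₀ R j (j + 1)
    have h2 : Finset.Ico j (j + 1) = {j} := by ext l; simp [Finset.mem_Ico]; omega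
    simp only [h2, Finset.sum_singleton, one_mul, ← eLpNorm_two_sq] at h1
    by_contra htop
    rw [not_lt, top_le_iff] at htop
    rw [htop] at h1
    exact (ENNReal.mul_lt_top ENNReal.coe_lt_top (measure_pball_lt_top μ X₀ R)).ne
      (top_le_iff.1 (by simpa using h1))
  set v : PSpace n → ℝ → ℤ → Lp ℝ 2 μ := fun X₀ R j => (hG X₀ R j).toLp _ with hv
  have hsum : ∀ X₀ R (a : ℤ → ℝ) (s : Finset ℤ), (∑ j ∈ s, a j • v X₀ R j : Lp ℝ 2 μ) =ᵐ[μ]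
      fun X => ∑ j ∈ s, a j * localConvo k ψ μ X₀ R (lam ^ j) X := by
    intro X₀ R a s
    induction s using Finset.induction_on with
    | empty =>
      filter_upwards [Lp.coeFn_zero ℝ 2 μ] with X hX
      simpa using hX
    | insert i s hi ih =>
      rw [Finset.sum_insert hi]
      filter_upwards [ih, Lp.coeFn_add (a i • v X₀ R i) (∑ j ∈ s, a j • v X₀ R j),
        Lp.coeFn_smul (a i) (v X₀ R i), (hG X₀ R i).coeFn_toLp] with X h1 h2 h3 h4
      rw [h2, Pi.add_apply, h1, h3, Pi.smul_apply, hv, h4, Finset.sum_insert hi, smul_eq_mul]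
  -- the normalised operators `a ↦ μ(B)^{-1/2} ∑ aⱼ (ψⱼ * 1_B μ)`, indexed by the ball and the range of
  -- scales, are pointwise bounded on `ℓ^∞(ℤ)`
  let T : PSpace n × ℝ × ℤ × ℤ → (ℤ →ᵇ ℝ) →L[ℝ] Lp ℝ 2 μ := fun p =>
    (Real.sqrt (μ (pball p.1 p.2.1)).toReal)⁻¹ • ∑ j ∈ Finset.Ico p.2.2.1 p.2.2.2,
      (BoundedContinuousFunction.evalCLM ℝ j).smulRight (v p.1 p.2.1 j)
  have hT : ∀ p a, T p a = (Real.sqrt (μ (pball p.1 p.2.1)).toReal)⁻¹ •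
      ∑ j ∈ Finset.Ico p.2.2.1 p.2.2.2, a j • v p.1 p.2.1 j := by
    intro p a
    simp [T]
  have hpt : ∀ a : ℤ →ᵇ ℝ, ∃ C : ℝ, ∀ p, ‖T p a‖ ≤ C := by
    intro a
    obtain ⟨C, hC⟩ := lintegral_sum_le (A := ‖a‖) hψ hρ hψρ hlam hl1 hCZO (a := a)
      (fun j => a.norm_coe_le_norm j)
    refine ⟨Real.sqrt C, fun ⟨X₀, R, i, i'⟩ => ?_⟩
    rw [hT, norm_smul, norm_inv, Real.norm_of_nonneg (Real.sqrt_nonneg _)]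
    have h1 := hC X₀ R i i'
    rw [← ofReal_norm_sq_toLp (hsum X₀ R a (Finset.Ico i i'))] at h1
    have hfin := (measure_pball_lt_top μ X₀ R).ne
    have h2 : ‖∑ j ∈ Finset.Ico i i', a j • v X₀ R j‖ ^ 2 ≤ C * (μ (pball X₀ R)).toReal := by
      rw [← ENNReal.ofReal_le_ofReal_iff (by positivity), ENNReal.ofReal_mul (by positivity),
        ENNReal.ofReal_toReal hfin, ENNReal.ofReal_coe_nnreal]
      exact h1
    simp only
    refine inv_mul_le_of_le_mul₀ (Real.sqrt_nonneg _) (Real.sqrt_nonneg _) ?_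
    rw [mul_comm, ← Real.sqrt_mul (by positivity)]
    exact Real.le_sqrt_of_sq_le h2
  obtain ⟨C', hC'⟩ := banach_steinhaus hpt
  refine ⟨(C' ^ 2).toNNReal, fun X₀ R i i' => ?_⟩
  have hfin := (measure_pball_lt_top μ X₀ R).ne
  by_cases hμ0 : μ (pball X₀ R) = 0
  · have : ∀ (j : ℤ) X, localConvo k ψ μ X₀ R (lam ^ j) X = 0 := fun j X => by
      rw [localConvo, Measure.restrict_eq_zero.2 hμ0, integral_zero_measure]
    simp [this]
  obtain ⟨σ, hσ, hle⟩ := exists_signs (Finset.Ico i i') (v X₀ R)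
  let a : ℤ →ᵇ ℝ := BoundedContinuousFunction.ofNormedAddCommGroupDiscrete σ 1 hσ
  have ha1 : ‖a‖ ≤ 1 := (BoundedContinuousFunction.norm_le zero_le_one).2 hσ
  have h1 := ((T (X₀, R, i, i')).le_opNorm a).trans (mul_le_mul (hC' _) ha1 (norm_nonneg _)
    ((norm_nonneg _).trans (hC' (X₀, R, i, i'))))
  have hpos : 0 < (μ (pball X₀ R)).toReal := ENNReal.toReal_pos hμ0 hfin
  rw [hT, norm_smul, norm_inv, Real.norm_of_nonneg (Real.sqrt_nonneg _), mul_one,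
    inv_mul_le_iff₀ (Real.sqrt_pos.2 hpos)] at h1
  have h2 : ‖∑ j ∈ Finset.Ico i i', σ j • v X₀ R j‖ ^ 2 ≤ C' ^ 2 * (μ (pball X₀ R)).toReal := by
    refine (pow_le_pow_left₀ (norm_nonneg _) h1 2).trans (le_of_eq ?_)
    rw [mul_pow, Real.sq_sqrt hpos.le, mul_comm]
  have h3 : ∀ j, ∫⁻ X, ‖localConvo k ψ μ X₀ R (lam ^ j) X‖ₑ ^ 2 ∂μ =
      ENNReal.ofReal (‖v X₀ R j‖ ^ 2) := fun j =>
    (ofReal_norm_sq_toLp (hG X₀ R j).coeFn_toLp).symm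
  simp only [h3]
  rw [← ENNReal.ofReal_sum_of_nonneg fun j _ => by positivity]
  refine (ENNReal.ofReal_le_ofReal (hle.trans h2)).trans (le_of_eq ?_)
  rw [ENNReal.ofReal_mul (by positivity), ENNReal.ofReal_toReal hfin]
  rfl

/-- The square function estimate over the dyadic scales. -/
theorem exists_square_bound (hψ : IsOddBump ψ)
    (hCZO : ∀ K : PSpace n → ℝ, IsAdmissibleKernel k K → CZOBounded K μ) :
    ∃ C : ℝ≥0, ∀ (X₀ : PSpace n) (R : ℝ) (s : Finset ℤ),
      ∑ j ∈ s, ∫⁻ X, ‖localConvo k ψ μ X₀ R (2 ^ j) X‖ₑ ^ 2 ∂μ ≤ C * μ (pball X₀ R) := by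
  obtain ⟨ρ, hρ, hψρ⟩ := hψ.annular
  -- the scales `2 ^ (i + M q)`, `q ∈ ℤ`, have gaps as soon as `2 ^ M` is large
  obtain ⟨M, hM⟩ := pow_unbounded_of_one_lt (max 1 (4 * ρ⁻¹ / ρ)) (one_lt_two : (1 : ℝ) < 2)
  have hM1 : (1 : ℝ) < 2 ^ M := (le_max_left _ _).trans_lt hM
  have hM2 : 4 * ρ⁻¹ ≤ 2 ^ M * ρ := by
    have := ((le_max_right _ _).trans_lt hM).le
    rwa [div_le_iff₀ hρ] at this
  have hM0 : 0 < M := Nat.pos_of_ne_zero fun h => by simp [h] at hM1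
  have key : ∀ i : ℤ, ∃ C : ℝ≥0, ∀ (X₀ : PSpace n) (R : ℝ) (q q' : ℤ),
      ∑ j ∈ Finset.Ico q q', ∫⁻ X, ‖localConvo k ψ μ X₀ R (2 ^ (i + M * j)) X‖ₑ ^ 2 ∂μ ≤
        C * μ (pball X₀ R) := by
    intro i
    have h2 : (0 : ℝ) < 2 ^ i := zpow_pos two_pos i
    obtain ⟨C, hC⟩ := exists_square_bound_of_gap (k := k) (hψ.scaled (k := k) h2)
      (mul_pos h2 hρ) (fun X hX => scaled_ne_zero h2 hψρ hX)
      (lam := 2 ^ M) (by nlinarith) hM1 hCZO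
    refine ⟨C, fun X₀ R q q' => ?_⟩
    simpa only [localConvo_scaled, ← zpow_natCast, ← zpow_mul,
      ← zpow_add₀ (two_ne_zero : (2 : ℝ) ≠ 0)] using hC X₀ R q q'
  choose C hC using key
  refine ⟨∑ i ∈ Finset.Ico (0 : ℤ) M, C i, fun X₀ R s => ?_⟩
  have hM0' : (0 : ℤ) < M := by exact_mod_cast hM0
  set f : ℤ → ℝ≥0∞ := fun j => ∫⁻ X, ‖localConvo k ψ μ X₀ R (2 ^ j) X‖ₑ ^ 2 ∂μ with hf
  rw [← Finset.sum_fiberwise_of_maps_to (g := fun j : ℤ => j % M) (t := Finset.Ico (0 : ℤ) M)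
    (fun j _ => Finset.mem_Ico.2 ⟨Int.emod_nonneg _ hM0'.ne', Int.emod_lt_of_pos _ hM0'⟩),
    ENNReal.ofNNReal_finsetSum, Finset.sum_mul]
  refine Finset.sum_le_sum fun i _ => ?_
  obtain ⟨B, hB⟩ : ∃ B : ℕ, ∀ j ∈ s, j.natAbs ≤ B :=
    ⟨s.sup Int.natAbs, fun j hj => Finset.le_sup hj⟩
  refine le_trans ?_ (hC i X₀ R (-(B : ℤ) - 1) (B + 1))
  have hinj : Set.InjOn (fun j : ℤ => j / M) (s.filter fun j => j % M = i) := by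
    intro a ha b hb hab
    have h1 := (Finset.mem_filter.1 (Finset.mem_coe.1 ha)).2
    have h2 := (Finset.mem_filter.1 (Finset.mem_coe.1 hb)).2
    have hab : a / M = b / M := hab
    rw [← Int.emod_add_mul_ediv a M, ← Int.emod_add_mul_ediv b M, h1, h2, hab]
  calc ∑ j ∈ s.filter (fun j => j % M = i), f j
      = ∑ j ∈ s.filter (fun j => j % M = i), f (i + M * (j / M)) :=
        Finset.sum_congr rfl fun j hj => by
          conv_lhs => rw [← Int.emod_add_mul_ediv j M, (Finset.mem_filter.1 hj).2]
    _ = ∑ q ∈ (s.filter fun j => j % M = i).image (fun j => j / (M : ℤ)), f (i + M * q) :=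
        (Finset.sum_image (f := fun q => f (i + M * q)) hinj).symm
    _ ≤ _ := Finset.sum_le_sum_of_subset fun q hq => by
        obtain ⟨j, hj, rfl⟩ := Finset.mem_image.1 hq
        have h1 := hB j (Finset.mem_filter.1 hj).1
        have hMz : (1 : ℤ) ≤ M := hM0'
        rw [Finset.mem_Ico, Int.le_ediv_iff_mul_le hM0', Int.ediv_lt_iff_lt_mul hM0']
        constructor <;> nlinarith [neg_abs_le j, le_abs_self j, Int.natCast_natAbs j]

end

end ParabolicUR

/-! ### Perturbation of planes -/

namespace ParabolicUR

open Module Filter Topology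
open scoped ContDiff

variable {n k : ℕ}

lemma norm_offset_le (V : Submodule ℝ (EuclideanSpace ℝ (Fin n)))
    (a x : EuclideanSpace ℝ (Fin n)) {v : EuclideanSpace ℝ (Fin n)} (hv : v ∈ V) :
    ‖offset V a x‖ ≤ ‖x - a - v‖ := by
  have h : offset V a x = Vᗮ.starProjection (x - a - v) := by
    rw [offset, map_sub _ (x - a) v,
      (Submodule.starProjection_apply_eq_zero_iff _).2 (V.le_orthogonal_orthogonal hv), sub_zero]
  rw [h]
  exact Submodule.norm_starProjection_apply_le _ _

/-- The zero set of a small linear perturbation of the offset from a plane contains a plane of the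
same dimension, and the perturbed offset controls the distance to it. -/
lemma exists_offset_le_perturbation {V : Submodule ℝ (EuclideanSpace ℝ (Fin n))}
    (a g : EuclideanSpace ℝ (Fin n)) (G : EuclideanSpace ℝ (Fin n) →L[ℝ] EuclideanSpace ℝ (Fin n))
    (hG : ‖G‖ ≤ 1 / 2) : ∃ (W : Submodule ℝ (EuclideanSpace ℝ (Fin n)))
      (b : EuclideanSpace ℝ (Fin n)), finrank ℝ W = finrank ℝ V ∧
        ∀ x, ‖offset W b x‖ ≤ 2 * ‖Vᗮ.starProjection (x - a + G x - g)‖ := by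
  set P := Vᗮ.starProjection with hP
  have hPP : ∀ x, P (P x) = P x := fun x =>
    Submodule.starProjection_eq_self_iff.2 (Submodule.starProjection_apply_mem _ _)
  have hPG : ∀ x, ‖P (G x)‖ ≤ 1 / 2 * ‖x‖ := fun x =>
    (Submodule.norm_starProjection_apply_le _ _).trans (G.le_of_opNorm_le hG x)
  let T : EuclideanSpace ℝ (Fin n) →ₗ[ℝ] EuclideanSpace ℝ (Fin n) :=
    LinearMap.id + P.toLinearMap ∘ₗ G.toLinearMap
  have hT : ∀ x, T x = x + P (G x) := fun x => rfl
  have hlow : ∀ x, ‖x‖ ≤ 2 * ‖T x‖ := fun x => by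
    have h1 : x = T x - P (G x) := by rw [hT]; abel
    have h2 := norm_sub_le (T x) (P (G x))
    rw [← h1] at h2
    linarith [hPG x]
  have hinj : Function.Injective T := by
    rw [← LinearMap.ker_eq_bot, LinearMap.ker_eq_bot']
    intro x hx
    have := hlow x
    rw [hx, norm_zero, mul_zero] at this
    exact norm_le_zero_iff.1 this
  let e : EuclideanSpace ℝ (Fin n) ≃ₗ[ℝ] EuclideanSpace ℝ (Fin n) :=
    LinearEquiv.ofInjectiveEndo T hinj
  have he : ∀ x, e x = T x := fun x => rfl
  refine ⟨V.map e.symm.toLinearMap, e.symm (a + g), LinearEquiv.finrank_map_eq e.symm V,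
    fun x => ?_⟩
  set w := x - e.symm (a + g) with hw
  have hTw : P (T w) = P (x - a + G x - g) := by
    have h1 : T (e.symm (a + g)) = a + g := e.apply_symm_apply _
    rw [hw, map_sub T, h1, hT]
    simp only [map_sub, map_add, hPP]
    abel
  have hmem : T w - P (T w) ∈ V := by
    have h1 : T w - P (T w) = V.starProjection (T w) := by
      rw [hP, Submodule.starProjection_orthogonal_val, sub_sub_cancel]
    rw [h1]
    exact Submodule.starProjection_apply_mem _ _
  refine (norm_offset_le _ _ _ (Submodule.mem_map_of_mem (f := e.symm.toLinearMap) hmem)).trans ?_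
  rw [← hw, ← hTw]
  refine (hlow _).trans (le_of_eq ?_)
  congr 2
  have h3 : T (e.symm (T w - P (T w))) = T w - P (T w) := e.apply_symm_apply _
  rw [map_sub T]
  change T w - T (e.symm (T w - P (T w))) = _
  rw [h3]; abel

/-! ### Averages with a smooth weight -/

/-- First order Taylor expansion in the spatial variable only: the increment in time is of second
order in the parabolic norm. -/
lemma exists_taylor_bound {φ : PSpace n → ℝ} (hφ : ContDiff ℝ ∞ φ) (hc : HasCompactSupport φ) :
    ∃ K : ℝ, 1 ≤ K ∧ (∀ Z, |φ Z| ≤ K) ∧ (∀ Z, ‖fderiv ℝ φ Z‖ ≤ K) ∧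
      ∀ Z X, pnorm X ≤ 1 → |φ (Z + X) - φ Z - fderiv ℝ φ Z (X.1, 0)| ≤ K * pnorm X ^ 2 := by
  obtain ⟨C₀, hC₀⟩ := hc.exists_bound_of_continuous hφ.continuous
  have hdφ : ContDiff ℝ 1 (fderiv ℝ φ) := hφ.fderiv_right (m := 1) (by norm_cast)
  obtain ⟨C₁, hC₁⟩ := (hc.fderiv ℝ).exists_bound_of_continuous hdφ.continuous
  obtain ⟨L, hL⟩ := hdφ.lipschitzWith_of_hasCompactSupport (hc.fderiv ℝ) one_ne_zero
  have h0 : 0 ≤ C₁ := (norm_nonneg _).trans (hC₁ 0)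
  refine ⟨max (max 1 C₀) (C₁ + L), le_max_of_le_left (le_max_left _ _),
    fun Z => (hC₀ Z).trans (le_max_of_le_left (le_max_right _ _)),
    fun Z => (hC₁ Z).trans (le_max_of_le_right (by linarith [L.2])), fun Z X hX => ?_⟩
  have hp := pnorm_nonneg X
  have h2 := abs_snd_le_pnorm_sq X
  have hXn := norm_le_pnorm hX
  have hmv := (convex_closedBall Z ‖X‖).norm_image_sub_le_of_norm_hasFDerivWithin_le'
    (f := φ) (f' := fderiv ℝ φ) (φ := fderiv ℝ φ Z) (C := L * ‖X‖) (x := Z) (y := Z + X)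
    (fun w _ => ((hφ.differentiable (by simp)) w).hasFDerivAt.hasFDerivWithinAt)
    (fun w hw => by
      rw [← dist_eq_norm]
      exact (hL.dist_le_mul w Z).trans (mul_le_mul_of_nonneg_left hw L.2))
    (Metric.mem_closedBall_self (norm_nonneg X)) (by simp [Metric.mem_closedBall, dist_eq_norm])
  rw [add_sub_cancel_left] at hmv
  have hsplit : fderiv ℝ φ Z X = fderiv ℝ φ Z (X.1, 0) + fderiv ℝ φ Z (0, X.2) := by
    rw [← map_add]; congr 1; ext <;> simp
  have ht : |fderiv ℝ φ Z (0, X.2)| ≤ C₁ * pnorm X ^ 2 := by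
    refine ((fderiv ℝ φ Z).le_of_opNorm_le (hC₁ Z) _).trans ?_
    have : ‖((0 : EuclideanSpace ℝ (Fin n)), X.2)‖ = |X.2| := by
      rw [Prod.norm_def]; simp
    rw [this]
    exact mul_le_mul_of_nonneg_left h2 h0
  have hq : L * ‖X‖ * ‖X‖ ≤ L * pnorm X ^ 2 := by
    rw [mul_assoc, ← sq]
    exact mul_le_mul_of_nonneg_left (pow_le_pow_left₀ (norm_nonneg _) hXn 2) L.2
  have : φ (Z + X) - φ Z - fderiv ℝ φ Z (X.1, 0) =
      (φ (Z + X) - φ Z - fderiv ℝ φ Z X) + fderiv ℝ φ Z (0, X.2) := by rw [hsplit]; ring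
  rw [this]
  refine (abs_add_le _ _).trans ?_
  rw [Real.norm_eq_abs] at hmv
  calc _ ≤ L * pnorm X ^ 2 + C₁ * pnorm X ^ 2 := add_le_add (hmv.trans hq) ht
    _ = (C₁ + L) * pnorm X ^ 2 := by ring
    _ ≤ _ := by gcongr; exact le_max_right _ _

lemma integrableOn_pball_of_continuous {E : Type*} [NormedAddCommGroup E]
    {m : Measure (PSpace n)} [IsLocallyFiniteMeasure m] {f : PSpace n → E} (hf : Continuous f) (X : PSpace n)
    (r : ℝ) : IntegrableOn f (pball X r) m :=
  (hf.continuousOn.integrableOn_compact (isCompact_closedPball X r)).mono_set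
    fun _ hY => (mem_pball.1 hY).le

section Average

variable {E : Type*} [NormedAddCommGroup E] [NormedSpace ℝ E] {m : Measure (PSpace n)}
  [IsLocallyFiniteMeasure m]

lemma norm_integral_le_of_weight {f g : PSpace n → E} (hg : Continuous g) {A R : ℝ}
    (h : ∀ Y, ‖f Y‖ ≤ A * ‖g Y‖) (hf : ∀ Y, f Y ≠ 0 → pnorm Y < R) :
    ‖∫ Y, f Y ∂m‖ ≤ A * ∫ Y in pball 0 R, ‖g Y‖ ∂m := by
  rw [← setIntegral_eq_integral_of_forall_compl_eq_zero (s := pball 0 R)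
    (fun Y hY => by by_contra h1; exact hY (by simpa [mem_pball] using hf Y h1)),
    ← integral_const_mul]
  exact norm_integral_le_of_norm_le ((integrableOn_pball_of_continuous hg.norm 0 R).const_mul A)
    (Eventually.of_forall h)

lemma integrable_weight {w : PSpace n → ℝ} {g : PSpace n → E} (hw : Continuous w)
    (hg : Continuous g) {R : ℝ} (h : ∀ Y, w Y ≠ 0 → pnorm Y < R) :
    Integrable (fun Y => w Y • g Y) m := by
  refine (hw.smul hg).integrable_of_hasCompactSupport ?_
  exact HasCompactSupport.smul_right (hasCompactSupport_of_pnorm (X := 0) (R := R)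
    fun Y hY => by simpa using (h Y hY).le)

/-- The first order expansion, in the spatial variable, of `X ↦ ∫ φ(X - Y) g(Y) dm(Y)`. -/
lemma exists_expansion {φ : PSpace n → ℝ} (hφ : ContDiff ℝ ∞ φ)
    (hsupp : ∀ X, φ X ≠ 0 → pnorm X < 2) {K : ℝ} (hK : ∀ Z, |φ Z| ≤ K)
    (hK1 : ∀ Z, ‖fderiv ℝ φ Z‖ ≤ K) (hK2 : ∀ Z X, pnorm X ≤ 1 →
      |φ (Z + X) - φ Z - fderiv ℝ φ Z (X.1, 0)| ≤ K * pnorm X ^ 2)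
    {g : PSpace n → E} (hg : Continuous g) :
    (∀ X, pnorm X ≤ 1 →
      ‖∫ Y, φ (X - Y) • g Y ∂m‖ ≤ K * ∫ Y in pball 0 4, ‖g Y‖ ∂m) ∧
    ∃ l : EuclideanSpace ℝ (Fin n) →L[ℝ] E, ‖l‖ ≤ K * ∫ Y in pball 0 4, ‖g Y‖ ∂m ∧
      ∀ X, pnorm X ≤ 1 → ‖(∫ Y, φ (X - Y) • g Y ∂m) - (∫ Y, φ (0 - Y) • g Y ∂m) - l X.1‖ ≤
        K * pnorm X ^ 2 * ∫ Y in pball 0 4, ‖g Y‖ ∂m := by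
  have hK0 : 0 ≤ K := (abs_nonneg _).trans (hK 0)
  have hsX : ∀ X, pnorm X ≤ 1 → ∀ Y, φ (X - Y) ≠ 0 → pnorm Y < 4 := fun X hX Y hY => by
    have h1 := hsupp _ hY
    have h2 := pnorm_add_le X (-(X - Y))
    rw [pnorm_neg, show X + -(X - Y) = Y by abel] at h2
    linarith
  have hD : ∀ Y, fderiv ℝ φ (0 - Y) ≠ 0 → pnorm Y < 4 := fun Y hY => by
    have h1 : 0 - Y ∈ tsupport φ := support_fderiv_subset ℝ hY
    have h2 : tsupport φ ⊆ {X | pnorm X ≤ 2} :=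
      closure_minimal (fun X hX => (hsupp X hX).le) (isClosed_le continuous_pnorm continuous_const)
    have h3 : pnorm (0 - Y) ≤ 2 := h2 h1
    rw [zero_sub, pnorm_neg] at h3
    linarith
  have hdφ : Continuous (fderiv ℝ φ) := hφ.continuous_fderiv (by simp)
  let inl := ContinuousLinearMap.inl ℝ (EuclideanSpace ℝ (Fin n)) ℝ
  let L : PSpace n → EuclideanSpace ℝ (Fin n) →L[ℝ] E := fun Y =>
    ((fderiv ℝ φ (0 - Y)).comp inl).smulRight (g Y)
  have hLapp : ∀ Y x, L Y x = fderiv ℝ φ (0 - Y) (x, 0) • g Y := fun Y x => rfl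
  have hLn : ∀ Y, ‖L Y‖ ≤ K * ‖g Y‖ := fun Y => by
    rw [ContinuousLinearMap.norm_smulRight_apply]
    refine mul_le_mul_of_nonneg_right ?_ (norm_nonneg _)
    refine (ContinuousLinearMap.opNorm_comp_le _ _).trans ?_
    exact (mul_le_mul (hK1 _) (ContinuousLinearMap.norm_inl_le_one ℝ _ _) (norm_nonneg _)
      hK0).trans_eq (mul_one K)
  have hLs : ∀ Y, L Y ≠ 0 → pnorm Y < 4 := fun Y hY => hD Y fun h0 => hY (by
    ext x; rw [hLapp, h0]; simp)
  have hLc : Continuous L := by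
    have h1 : Continuous fun Y : PSpace n => (fderiv ℝ φ (0 - Y)).comp inl :=
      (hdφ.comp (by fun_prop : Continuous fun Y : PSpace n => 0 - Y)).clm_comp continuous_const
    exact ((ContinuousLinearMap.smulRightL ℝ _ E).continuous.comp h1).clm_apply hg
  have hLi : Integrable L m := hLc.integrable_of_hasCompactSupport
    (HasCompactSupport.of_support_subset_isCompact (isCompact_closedPball 0 4)
      fun Y hY => by simpa using (hLs Y hY).le)
  have hi : ∀ X, pnorm X ≤ 1 → Integrable (fun Y => φ (X - Y) • g Y) m := fun X hX =>
    integrable_weight (hφ.continuous.comp (by fun_prop)) hg (hsX X hX)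
  have h0le : pnorm (0 : PSpace n) ≤ 1 := by rw [pnorm_zero]; exact zero_le_one
  refine ⟨fun X hX => norm_integral_le_of_weight hg (fun Y => ?_)
    fun Y hY => hsX X hX Y (left_ne_zero_of_smul hY), ∫ Y, L Y ∂m, ?_, fun X hX => ?_⟩
  · rw [norm_smul]
    exact mul_le_mul_of_nonneg_right (hK _) (norm_nonneg _)
  · rw [← setIntegral_eq_integral_of_forall_compl_eq_zero (s := pball 0 4)
      (fun Y hY => by by_contra h1; exact hY (by simpa [mem_pball] using hLs Y h1)),
      ← integral_const_mul]
    exact norm_integral_le_of_norm_le ((integrableOn_pball_of_continuous hg.norm 0 4).const_mul K)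
      (Eventually.of_forall hLn)
  · rw [ContinuousLinearMap.integral_apply hLi, ← integral_sub (hi X hX) (hi 0 h0le),
      ← integral_sub (by exact (hi X hX).sub (hi 0 h0le)) (hLi.apply_continuousLinearMap X.1)]
    refine norm_integral_le_of_weight hg (fun Y => ?_) fun Y hY => ?_
    · rw [hLapp, ← sub_smul, ← sub_smul, norm_smul]
      refine mul_le_mul_of_nonneg_right ?_ (norm_nonneg _)
      have := hK2 (0 - Y) X hX
      rwa [show 0 - Y + X = X - Y by abel] at this
    · by_contra hlt
      refine hY ?_
      have h1 : φ (X - Y) = 0 := by by_contra h; exact hlt (hsX X hX Y h)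
      have h2 : φ (0 - Y) = 0 := by by_contra h; exact hlt (hsX 0 h0le Y h)
      have h3 : L Y = 0 := by by_contra h; exact hlt (hLs Y h)
      rw [h1, h2, h3]; simp

end Average

end ParabolicUR

/-! ### Improvement of approximating planes -/

namespace ParabolicUR

open Module Filter Topology
open scoped ContDiff

variable {n k : ℕ} {C₀ : ℝ}

/-- A smooth cutoff to a parabolic annulus, equal to `1` where `κ ≤ ‖X‖ ≤ 1`. -/
noncomputable def annularCut (κ : ℝ) (X : PSpace n) : ℝ := lowCut (κ ^ 4 / 4) X * highCut 1 X

lemma contDiff_annularCut (κ : ℝ) : ContDiff ℝ ∞ (annularCut κ : PSpace n → ℝ) :=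
  (contDiff_lowCut _).mul (contDiff_highCut _)

lemma annularCut_ne_zero {κ : ℝ} (hκ : 0 < κ) {X : PSpace n} (h : annularCut κ X ≠ 0) :
    κ / 2 < pnorm X ∧ pnorm X < 2 := by
  have h1 := lt_quart_of_lowCut (by positivity) (left_ne_zero_of_mul h)
  have h2 := quart_lt_of_highCut one_pos (right_ne_zero_of_mul h)
  constructor
  · refine lt_of_pow_lt_pow_left₀ 4 (pnorm_nonneg X) ?_
    have := quart_le X
    have : 0 < κ ^ 4 := by positivity
    rw [div_pow]
    linarith
  · refine lt_of_pow_lt_pow_left₀ 4 zero_le_two ?_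
    have := le_quart X
    linarith

lemma annularCut_eq_one {κ : ℝ} (hκ : 0 < κ) {X : PSpace n} (h1 : κ ≤ pnorm X)
    (h2 : pnorm X ≤ 1) : annularCut κ X = 1 := by
  have h3 := le_quart X
  have h4 := quart_le X
  have h5 := pow_le_pow_left₀ hκ.le h1 4
  have h6 := pow_le_pow_left₀ (pnorm_nonneg X) h2 4
  rw [annularCut, lowCut_eq_one (by positivity) (by linarith), highCut_eq_one one_pos (by linarith),
    one_mul]

lemma annularCut_nonneg (κ : ℝ) (X : PSpace n) : 0 ≤ annularCut κ X :=
  mul_nonneg (lowCut_mem _ _).1 (highCut_mem _ _).1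

lemma hasCompactSupport_annularCut {κ : ℝ} (hκ : 0 < κ) :
    HasCompactSupport (annularCut κ : PSpace n → ℝ) :=
  hasCompactSupport_of_pnorm (X := 0) (R := 2) fun Y hY => by
    simpa using (annularCut_ne_zero hκ hY).2.le

/-- The components of the truncated vector kernel `x φ(x, t)`. -/
noncomputable def coordBump (κ : ℝ) (i : Fin n) (X : PSpace n) : ℝ := X.1 i * annularCut κ X

lemma isOddBump_coordBump {κ : ℝ} (hκ : 0 < κ) (i : Fin n) : IsOddBump (coordBump κ i) := by
  refine isOddBump_of_bounds ?_ (fun x t => ?_) (half_pos hκ) fun X hX =>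
    annularCut_ne_zero hκ (right_ne_zero_of_mul hX)
  · exact ((EuclideanSpace.proj (𝕜 := ℝ) i).contDiff.comp contDiff_fst).mul (contDiff_annularCut κ)
  · simp only [coordBump, annularCut, lowCut, highCut, quart_reflect]
    simp

/-- A lower bound for the mass seen by the annular cutoff. -/
lemma le_integral_annularCut {m : Measure (PSpace n)} {ρ : ℝ≥0∞} (hm : AdrTo C₀ k m ρ)
    (hC₀ : 0 < C₀) (hρ : 1 < ρ) {κ : ℝ} (hκ : 0 < κ) (hκ1 : κ < 1) (hκC : C₀ * κ ≤ C₀⁻¹ / 2)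
    {X : PSpace n} (hX : X ∈ m.support) : C₀⁻¹ / 2 ≤ ∫ Y, annularCut κ (X - Y) ∂m := by
  have := hm.locallyFinite
  have h1 := (hm.regular X hX 1 one_pos (by simpa using hρ)).1
  have h2 := (hm.regular X hX κ hκ ((ENNReal.ofReal_le_one.2 hκ1.le).trans_lt hρ)).2
  have hf1 := (measure_pball_lt_top m X 1).ne
  have hf2 := (measure_pball_lt_top m X κ).ne
  rw [one_pow, mul_one, ENNReal.ofReal_le_iff_le_toReal hf1] at h1
  rw [← ENNReal.ofReal_toReal hf2, ENNReal.ofReal_le_ofReal_iff (by positivity)] at h2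
  have h3 : C₀ * κ ^ (k + 2) ≤ C₀ * κ :=
    mul_le_mul_of_nonneg_left (pow_le_of_le_one hκ.le hκ1.le (by simp)) hC₀.le
  have hint : Integrable (fun Y => annularCut κ (X - Y)) m :=
    integrable_of_hasCompactSupport m ((contDiff_annularCut κ).continuous.comp (by fun_prop))
      ((hasCompactSupport_annularCut hκ).comp_homeomorph (Homeomorph.subLeft X))
  have h4 : m.real (pball X 1 \ pball X κ) ≤ ∫ Y, annularCut κ (X - Y) ∂m := by
    rw [← integral_indicator_one ((measurableSet_pball _ _).diff (measurableSet_pball _ _))]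
    refine integral_mono_of_nonneg (Eventually.of_forall fun Y => indicator_nonneg (by simp) Y) hint
      (Eventually.of_forall fun Y => ?_)
    by_cases hY : Y ∈ pball X 1 \ pball X κ
    · rw [indicator_of_mem hY]
      exact (annularCut_eq_one hκ (not_lt.1 hY.2) (mem_pball.1 hY.1).le).ge
    · rw [indicator_of_notMem hY]
      exact annularCut_nonneg _ _
  rw [measureReal_sdiff (fun Y hY => pball_mono hκ1.le hY) (measurableSet_pball _ _)] at h4
  simp only [Measure.real] at h4
  linarith

/-- The algebra behind the improvement. Here `F` is the singular integral, `h` the offset from the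
old plane, and the affine part `c₁ h + l₁ q - p - l` is the offset from the new plane. -/
lemma norm_affine_part_le {E : Type*} [NormedAddCommGroup E] [NormedSpace ℝ E] {h q F p l e : E}
    {c c₁ l₁ e₁ K H s : ℝ} (hc : 0 < c) (hc₁ : c ≤ c₁) (hs : 0 ≤ s) (hs1 : s ≤ 1) (hK : 0 ≤ K)
    (hF : F = (c₁ + l₁ + e₁) • h - (p + l + e)) (hq : c₁ • q = p)
    (hl₁ : |l₁| ≤ K * s) (he₁ : |e₁| ≤ K * s ^ 2) (hl : ‖l‖ ≤ H * s) (he : ‖e‖ ≤ H * s ^ 2)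
    (hH : 0 ≤ H) (hh : c * ‖h‖ ≤ H + ‖F‖) :
    ‖c₁ • h + l₁ • q - p - l‖ ≤ (1 + 3 * (K / c) + 2 * (K / c) ^ 2) * (‖F‖ + H * s ^ 2) := by
  have hs2 : s ^ 2 ≤ s := by nlinarith
  have hA : c₁ • h + l₁ • q - p - l = F - l₁ • (h - q) - e₁ • h + e := by
    rw [hF]; module
  have hB : c₁ • (h - q) = F - (l₁ + e₁) • h + l + e := by
    rw [smul_sub, hq, hF]; module
  have hle : ‖h‖ ≤ (H + ‖F‖) / c := by rw [le_div_iff₀ hc]; linarith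
  have hB' : c * ‖h - q‖ ≤ ‖F‖ + 2 * K * s * ((H + ‖F‖) / c) + 2 * H * s := by
    calc c * ‖h - q‖ ≤ ‖c₁ • (h - q)‖ := by
          rw [norm_smul, Real.norm_eq_abs]
          exact mul_le_mul_of_nonneg_right (hc₁.trans (le_abs_self _)) (norm_nonneg _)
      _ ≤ ‖F‖ + ‖(l₁ + e₁) • h‖ + ‖l‖ + ‖e‖ := by
          rw [hB]
          refine (norm_add_le _ _).trans (add_le_add ((norm_add_le _ _).trans ?_) le_rfl)
          exact add_le_add (norm_sub_le _ _) le_rfl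
      _ ≤ ‖F‖ + 2 * K * s * ((H + ‖F‖) / c) + H * s + H * s := by
          refine add_le_add (add_le_add (add_le_add le_rfl ?_) hl) (he.trans ?_)
          · rw [norm_smul, Real.norm_eq_abs]
            refine mul_le_mul ((abs_add_le _ _).trans ?_) hle (norm_nonneg _) (by positivity)
            nlinarith
          · exact mul_le_mul_of_nonneg_left hs2 hH
      _ = _ := by ring
  have hB2 : ‖h - q‖ ≤ (‖F‖ + 2 * K * s * ((H + ‖F‖) / c) + 2 * H * s) / c := by
    rw [le_div_iff₀ hc]; linarith
  have hf := norm_nonneg F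
  calc ‖c₁ • h + l₁ • q - p - l‖ ≤ ‖F‖ + ‖l₁ • (h - q)‖ + ‖e₁ • h‖ + ‖e‖ := by
        rw [hA]
        refine (norm_add_le _ _).trans (add_le_add ((norm_sub_le _ _).trans ?_) le_rfl)
        exact add_le_add (norm_sub_le _ _) le_rfl
    _ ≤ ‖F‖ + K * s * ((‖F‖ + 2 * K * s * ((H + ‖F‖) / c) + 2 * H * s) / c) +
        K * s ^ 2 * ((H + ‖F‖) / c) + H * s ^ 2 := by
        refine add_le_add (add_le_add (add_le_add le_rfl ?_) ?_) he
        · rw [norm_smul, Real.norm_eq_abs]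
          exact mul_le_mul hl₁ hB2 (norm_nonneg _) (by positivity)
        · rw [norm_smul, Real.norm_eq_abs]
          exact mul_le_mul he₁ hle (norm_nonneg _) (by positivity)
    _ = ‖F‖ * (1 + (K / c) * s + 2 * (K / c) ^ 2 * s ^ 2 + (K / c) * s ^ 2) +
        H * s ^ 2 * (2 * (K / c) ^ 2 + 3 * (K / c) + 1) := by field_simp; ring
    _ ≤ ‖F‖ * (1 + (K / c) * 1 + 2 * (K / c) ^ 2 * 1 + (K / c) * 1) +
        H * s ^ 2 * (2 * (K / c) ^ 2 + 3 * (K / c) + 1) := by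
        have hs3 : s ^ 2 ≤ 1 := hs2.trans hs1
        gcongr
    _ ≤ _ := by
        have : 0 ≤ K / c := by positivity
        nlinarith [mul_nonneg hf this]

/-- The Cauchy–Schwarz inequality on a ball. -/
lemma sq_setIntegral_norm_le {E : Type*} [NormedAddCommGroup E] {m : Measure (PSpace n)}
    [IsLocallyFiniteMeasure m] {g : PSpace n → E} (hg : Continuous g) (X : PSpace n) (R : ℝ) :
    (∫ Y in pball X R, ‖g Y‖ ∂m) ^ 2 ≤ m.real (pball X R) * ∫ Y in pball X R, ‖g Y‖ ^ 2 ∂m := by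
  have hi1 : IntegrableOn (fun Y => ‖g Y‖) (pball X R) m :=
    integrableOn_pball_of_continuous hg.norm X R
  have hi2 : IntegrableOn (fun Y => ‖g Y‖ ^ 2) (pball X R) m :=
    integrableOn_pball_of_continuous (hg.norm.pow 2) X R
  have hi0 : IntegrableOn (fun _ : PSpace n => (1 : ℝ)) (pball X R) m :=
    integrableOn_pball_of_continuous continuous_const X R
  set b := ∫ Y in pball X R, ‖g Y‖ ∂m
  set M := m.real (pball X R) with hM
  -- the quadratic form `∫ (u ‖g‖ - v)²` is nonnegative
  have key : ∀ u v : ℝ, 0 ≤ u ^ 2 * (∫ Y in pball X R, ‖g Y‖ ^ 2 ∂m) - 2 * u * v * b + v ^ 2 * M := by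
    intro u v
    have h : 0 ≤ ∫ Y in pball X R, (u * ‖g Y‖ - v) ^ 2 ∂m := integral_nonneg fun Y => sq_nonneg _
    have e : ∀ Y, (u * ‖g Y‖ - v) ^ 2 = u ^ 2 * ‖g Y‖ ^ 2 - 2 * u * v * ‖g Y‖ + v ^ 2 * 1 := by
      intro Y; ring
    simp only [e] at h
    rw [integral_add (by exact (hi2.const_mul _).sub (hi1.const_mul _)) (hi0.const_mul _),
      integral_sub (hi2.const_mul _) (hi1.const_mul _), integral_const_mul, integral_const_mul,
      integral_const_mul] at h
    simpa using h
  have hM0 : 0 ≤ M := measureReal_nonneg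
  have h1 := key M b
  rcases hM0.eq_or_lt with h0 | h0
  · have h2 := key (b + 1) ((b + 1) ^ 2 * (∫ Y in pball X R, ‖g Y‖ ^ 2 ∂m) + 1)
    have hb : b = 0 := by
      have : m (pball X R) = 0 := by
        rw [hM, Measure.real, eq_comm, ENNReal.toReal_eq_zero_iff] at h0
        exact h0.resolve_right (measure_pball_lt_top m X R).ne
      simp only [b, Measure.restrict_eq_zero.2 this, integral_zero_measure]
    rw [hb, ← h0]; simp
  · have : 0 ≤ M * (M * (∫ Y in pball X R, ‖g Y‖ ^ 2 ∂m) - b ^ 2) := by nlinarith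
    have := nonneg_of_mul_nonneg_right this h0
    linarith

lemma sq_le_of_le_linear {x A f K H s M β : ℝ} (hx : 0 ≤ x) (h : x ≤ 2 * A * (f + K * H * s ^ 2))
    (hH : H ^ 2 ≤ M * β) (hM : 0 ≤ M) (hβ : 0 ≤ β) :
    x ^ 2 ≤ 8 * A ^ 2 * (1 + K ^ 2 * M) * (f ^ 2 + s ^ 4 * β) := by
  calc x ^ 2 ≤ (2 * A * (f + K * H * s ^ 2)) ^ 2 := pow_le_pow_left₀ hx h 2
    _ = 4 * A ^ 2 * (f + K * H * s ^ 2) ^ 2 := by ring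
    _ ≤ 4 * A ^ 2 * (2 * (f ^ 2 + s ^ 4 * (K ^ 2 * H ^ 2))) := by
        gcongr
        nlinarith [sq_nonneg (f - K * H * s ^ 2)]
    _ ≤ 4 * A ^ 2 * (2 * (f ^ 2 + s ^ 4 * (K ^ 2 * (M * β)))) := by gcongr
    _ ≤ 4 * A ^ 2 * (2 * ((1 + K ^ 2 * M) * (f ^ 2 + s ^ 4 * β))) := by
        gcongr
        have h1 : 0 ≤ K ^ 2 * M * f ^ 2 := by positivity
        have h2 : 0 ≤ s ^ 4 * β := by positivity
        nlinarith
    _ = _ := by ring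

set_option maxHeartbeats 400000 in
/-- If the measure is close to a plane on a ball, then there is a plane that improves the
approximation at the centre, up to the size of the singular integral with the kernel `x φ`. -/
theorem exists_improved_plane (hC₀ : 0 < C₀) (n k : ℕ) : ∃ (Ψ : Fin n → PSpace n → ℝ) (b C : ℝ),
    (∀ i, IsOddBump (Ψ i)) ∧ 0 < b ∧ 0 < C ∧ ∀ m : Measure (PSpace n), AdrTo C₀ k m 10 →
      0 ∈ m.support → ∀ (V : Submodule ℝ (EuclideanSpace ℝ (Fin n))) (a : EuclideanSpace ℝ (Fin n)),
      ∫ Z in pball 0 4, ‖offset V a Z.1‖ ^ 2 ∂m ≤ b →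
      ∃ (W : Submodule ℝ (EuclideanSpace ℝ (Fin n))) (a' : EuclideanSpace ℝ (Fin n)),
        finrank ℝ W = finrank ℝ V ∧ ∀ X ∈ m.support, pnorm X ≤ 1 →
          ‖offset W a' X.1‖ ^ 2 ≤ C * (∑ i, (∫ Y, Ψ i (X - Y) ∂m) ^ 2 +
            pnorm X ^ 4 * ∫ Z in pball 0 4, ‖offset V a Z.1‖ ^ 2 ∂m) := by
  -- a ball of radius `κ` has at most half of the mass of the unit ball, so that the annulus carries
  -- mass at least `c`
  obtain ⟨κ, hκ, hκ1, hκC⟩ : ∃ κ : ℝ, 0 < κ ∧ κ < 1 ∧ C₀ * κ ≤ C₀⁻¹ / 2 := by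
    refine ⟨min (1 / 2) (C₀⁻¹ / 2 / C₀), by positivity, by
      exact (min_le_left _ _).trans_lt (by norm_num), ?_⟩
    calc C₀ * min (1 / 2) (C₀⁻¹ / 2 / C₀) ≤ C₀ * (C₀⁻¹ / 2 / C₀) := by
          gcongr; exact min_le_right _ _
      _ = _ := by field_simp
  obtain ⟨K, hK1, hKb, hKd, hKt⟩ := exists_taylor_bound (contDiff_annularCut κ)
    (hasCompactSupport_annularCut (n := n) hκ)
  have hK0 : 0 < K := by linarith
  set c := C₀⁻¹ / 2 with hcdef
  have hc : 0 < c := by positivity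
  set M := C₀ * 4 ^ (k + 2) with hMdef
  have hM : 0 < M := by positivity
  -- the size of the mean offset `H` that makes the slope `G` of the new plane at most `1 / 2`
  set η := (2 * c⁻¹ * (K * M * (K / c) + K))⁻¹ with hη
  have hη0 : 0 < η := by positivity
  set D := 1 + 3 * (K * M / c) + 2 * (K * M / c) ^ 2 with hD
  have hD0 : 0 < D := by positivity
  refine ⟨coordBump κ, η ^ 2 / M, 8 * (c⁻¹ * D) ^ 2 * (1 + K ^ 2 * M), isOddBump_coordBump hκ,
    by positivity, by positivity, fun m hm h0 V a hb => ?_⟩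
  have := hm.locallyFinite
  set φ : PSpace n → ℝ := annularCut κ with hφ
  set P := Vᗮ.starProjection with hP
  set h : PSpace n → EuclideanSpace ℝ (Fin n) := fun Z => offset V a Z.1 with hh
  have hhc : Continuous h := (continuous_offset V a).comp continuous_fst
  set β := ∫ Z in pball 0 4, ‖h Z‖ ^ 2 ∂m with hβ
  set H := ∫ Z in pball 0 4, ‖h Z‖ ∂m with hH
  have hH0 : 0 ≤ H := integral_nonneg fun _ => norm_nonneg _
  have hmass : m.real (pball 0 4) ≤ M := by
    have := (hm.regular 0 h0 4 (by norm_num) (by simp; norm_num)).2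
    exact ENNReal.toReal_le_of_le_ofReal hM.le this
  have hβ0 : 0 ≤ β := integral_nonneg fun _ => by positivity
  have hHβ : H ^ 2 ≤ M * β :=
    (sq_setIntegral_norm_le hhc 0 4).trans (mul_le_mul_of_nonneg_right hmass hβ0)
  have hHη : H ≤ η := by
    refine (pow_le_pow_iff_left₀ hH0 hη0.le two_ne_zero).1 (hHβ.trans ?_)
    rw [le_div_iff₀ hM] at hb
    linarith
  have hsupp : ∀ X, φ X ≠ 0 → pnorm X < 2 := fun X hX => (annularCut_ne_zero hκ hX).2
  obtain ⟨-, l₁, hl₁n, hl₁⟩ := exists_expansion (m := m) (contDiff_annularCut κ) hsupp hKb hKd hKt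
    (g := fun _ => (1 : ℝ)) continuous_const
  obtain ⟨hPh, l, hln, hl⟩ := exists_expansion (m := m) (contDiff_annularCut κ) hsupp hKb hKd hKt hhc
  simp only [smul_eq_mul, mul_one, norm_one, setIntegral_const] at hl₁n hl₁
  rw [← hH] at hPh hln
  simp only [← hH] at hl
  set p₁ : PSpace n → ℝ := fun X => ∫ Y, φ (X - Y) ∂m with hp₁
  set ph : PSpace n → EuclideanSpace ℝ (Fin n) := fun X => ∫ Y, φ (X - Y) • h Y ∂m with hph
  have hp₁c : ∀ X ∈ m.support, c ≤ p₁ X := fun X hX =>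
    le_integral_annularCut hm hC₀ (by norm_num) hκ hκ1 hκC hX
  have hc₁ := hp₁c 0 h0
  have hc₁0 : 0 < p₁ 0 := hc.trans_le hc₁
  have hKM : K * m.real (pball 0 4) ≤ K * M := by gcongr
  -- the new plane is the zero set of `P (x - a) + G x - q`: the weighted mean `q` of the offsets at the
  -- origin and its first order variation `G`
  set q := (p₁ 0)⁻¹ • ph 0 with hq
  have hqn : ‖q‖ ≤ K / c * H := by
    rw [hq, norm_smul, norm_inv, Real.norm_of_nonneg hc₁0.le]
    calc (p₁ 0)⁻¹ * ‖ph 0‖ ≤ c⁻¹ * (K * H) := by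
          gcongr
          exact hPh 0 (by rw [pnorm_zero]; exact zero_le_one)
      _ = _ := by ring
  set G : EuclideanSpace ℝ (Fin n) →L[ℝ] EuclideanSpace ℝ (Fin n) :=
    (p₁ 0)⁻¹ • (l₁.smulRight q - l) with hG
  have hGn : ‖G‖ ≤ 1 / 2 := by
    rw [hG, norm_smul, norm_inv, Real.norm_of_nonneg hc₁0.le]
    calc (p₁ 0)⁻¹ * ‖l₁.smulRight q - l‖ ≤ c⁻¹ * (K * M * (K / c * H) + K * H) := by
          gcongr
          refine (norm_sub_le _ _).trans (add_le_add ?_ hln)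
          rw [ContinuousLinearMap.norm_smulRight_apply]
          exact mul_le_mul (hl₁n.trans hKM) hqn (norm_nonneg _) (by positivity)
      _ = c⁻¹ * (K * M * (K / c) + K) * H := by ring
      _ ≤ c⁻¹ * (K * M * (K / c) + K) * η := by gcongr
      _ = 1 / 2 := by rw [hη]; field_simp
  -- the definitions of the constants would slow down unification below
  clear_value D η β H c M
  obtain ⟨W, a', hW, hWa⟩ := exists_offset_le_perturbation (V := V) a q G hGn
  refine ⟨W, a', hW, fun X hX hX1 => ?_⟩
  set F : EuclideanSpace ℝ (Fin n) := ∫ Y, φ (X - Y) • (X - Y).1 ∂m with hF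
  have hsX : ∀ Y, φ (X - Y) ≠ 0 → pnorm Y < 4 := fun Y hY => by
    have h1 := hsupp _ hY
    have h2 := pnorm_add_le X (-(X - Y))
    rw [pnorm_neg, show X + -(X - Y) = Y by abel] at h2
    linarith
  have hφX : Continuous fun Y => φ (X - Y) :=
    (contDiff_annularCut κ).continuous.comp (by fun_prop)
  have hFi : Integrable (fun Y => φ (X - Y) • (X - Y).1) m :=
    integrable_weight hφX (by fun_prop) hsX
  have hFn : ‖F‖ ^ 2 = ∑ i, (∫ Y, coordBump κ i (X - Y) ∂m) ^ 2 := by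
    rw [EuclideanSpace.real_norm_sq_eq]
    refine Finset.sum_congr rfl fun i _ => ?_
    congr 1
    have := (EuclideanSpace.proj (𝕜 := ℝ) i).integral_comp_comm hFi
    rw [hF]
    refine Eq.trans this.symm (integral_congr_ae (Eventually.of_forall fun Y => ?_))
    simp [coordBump, hφ, mul_comm]
  -- up to the weight, the normal part of `F` is the offset of `X` minus the mean offset near `X`
  have hPF : P F = p₁ X • h X - ph X := by
    rw [hF, ← P.integral_comp_comm hFi]
    have e : ∀ Y, P (φ (X - Y) • (X - Y).1) = φ (X - Y) • h X - φ (X - Y) • h Y := by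
      intro Y
      rw [map_smul, ← smul_sub]
      congr 1
      simp only [hh, offset, ← map_sub]
      congr 1
      simp
    simp only [e]
    rw [integral_sub (integrable_weight hφX continuous_const hsX) (integrable_weight hφX hhc hsX),
      integral_smul_const]
  have hPle : ∀ x, ‖P x‖ ≤ ‖x‖ := Submodule.norm_starProjection_apply_le _
  set s := pnorm X with hs
  have hs0 : 0 ≤ s := pnorm_nonneg X
  have hxs : ‖X.1‖ ≤ s := norm_fst_le_pnorm X
  have hhX : c * ‖h X‖ ≤ K * H + ‖P F‖ := by
    calc c * ‖h X‖ ≤ ‖p₁ X • h X‖ := by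
          rw [norm_smul, Real.norm_eq_abs]
          exact mul_le_mul_of_nonneg_right ((hp₁c X hX).trans (le_abs_self _)) (norm_nonneg _)
      _ = ‖ph X + P F‖ := by rw [hPF]; congr 1; abel
      _ ≤ _ := (norm_add_le _ _).trans (add_le_add (hPh X hX1) le_rfl)
  have hA := norm_affine_part_le (h := h X) (q := q) (F := P F) (p := ph 0) (l := l X.1)
    (e := ph X - ph 0 - l X.1) (c₁ := p₁ 0) (l₁ := l₁ X.1) (e₁ := p₁ X - p₁ 0 - l₁ X.1)
    (K := K * M) (H := K * H) (s := s) hc hc₁ hs0 hX1 (by positivity)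
    (by
      rw [hPF]
      congr 1
      · congr 1; ring
      · abel)
    (by rw [hq, smul_smul, mul_inv_cancel₀ hc₁0.ne', one_smul])
    (((l₁.le_opNorm _).trans (mul_le_mul (hl₁n.trans hKM) hxs (norm_nonneg _) (by positivity))))
    ((hl₁ X hX1).trans (by
      calc K * s ^ 2 * m.real (pball 0 4) = s ^ 2 * (K * m.real (pball 0 4)) := by ring
        _ ≤ s ^ 2 * (K * M) := by gcongr
        _ = _ := by ring))
    ((l.le_opNorm _).trans (mul_le_mul hln hxs (norm_nonneg _) (by positivity)))
    ((hl X hX1).trans_eq (by ring)) (by positivity) hhX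
  have hlin : P (X.1 - a + G X.1 - q) =
      (p₁ 0)⁻¹ • P (p₁ 0 • h X + l₁ X.1 • q - ph 0 - l X.1) := by
    have hPh' : P (h X) = P (X.1 - a) :=
      Submodule.starProjection_eq_self_iff.2 (Submodule.starProjection_apply_mem _ _)
    have hGx : G X.1 = (p₁ 0)⁻¹ • (l₁ X.1 • q - l X.1) := rfl
    rw [hGx, hq]
    simp only [map_sub, map_add, map_smul, hPh']
    have h2 := smul_inv_smul₀ hc₁0.ne' (P (X.1 - a))
    have h3 := inv_smul_smul₀ hc₁0.ne' (P (X.1 - a))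
    simp only [map_sub] at h3
    simp only [smul_sub, smul_add] at h3 ⊢
    rw [h3]
    abel
  have hoff : ‖offset W a' X.1‖ ≤ 2 * (c⁻¹ * D) * (‖F‖ + K * H * s ^ 2) := by
    refine (hWa X.1).trans ?_
    rw [← hP, hlin, norm_smul, norm_inv, Real.norm_of_nonneg hc₁0.le]
    calc _ ≤ 2 * (c⁻¹ * (D * (‖F‖ + K * H * s ^ 2))) := by
          gcongr
          refine (hPle _).trans (hA.trans ?_)
          rw [← hD]
          gcongr
          exact hPle _
      _ = _ := by ring
  rw [← hFn]
  exact sq_le_of_le_linear (norm_nonneg _) hoff hHβ hM.le hβ0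

end ParabolicUR

/-! ### Flatness coefficients and their decay -/

namespace ParabolicUR

open Module Filter Topology
open scoped ContDiff

variable {n k : ℕ} {C₀ : ℝ} {μ : Measure (PSpace n)} {ρ : ℝ≥0∞}

/-- The mean square offset of `μ` from the plane `(a + V) × ℝ` in the ball `B(Y, r)`, normalised as
for a measure of dimension `k+2`. -/
noncomputable def planeErr (k : ℕ) (μ : Measure (PSpace n))
    (V : Submodule ℝ (EuclideanSpace ℝ (Fin n))) (a : EuclideanSpace ℝ (Fin n)) (Y : PSpace n)
    (r : ℝ) : ℝ≥0∞ :=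
  ENNReal.ofReal (r ^ (k + 2))⁻¹ *
    ∫⁻ Z in pball Y r, ENNReal.ofReal ((‖offset V a Z.1‖ / r) ^ 2) ∂μ

/-- The square of the `β`-number, with the power `r^{k+2}` in place of the measure of the ball. -/
noncomputable def flat (k : ℕ) (μ : Measure (PSpace n)) (Y : PSpace n) (r : ℝ) : ℝ≥0∞ :=
  ⨅ p : {V : Submodule ℝ (EuclideanSpace ℝ (Fin n)) // finrank ℝ V = k} ×
    EuclideanSpace ℝ (Fin n), planeErr k μ p.1.1 p.2 Y r

lemma flat_le_planeErr {V : Submodule ℝ (EuclideanSpace ℝ (Fin n))} (hV : finrank ℝ V = k)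
    (a : EuclideanSpace ℝ (Fin n)) (Y : PSpace n) (r : ℝ) :
    flat k μ Y r ≤ planeErr k μ V a Y r :=
  iInf_le (fun p : {V : Submodule ℝ (EuclideanSpace ℝ (Fin n)) // finrank ℝ V = k} ×
    EuclideanSpace ℝ (Fin n) => planeErr k μ p.1.1 p.2 Y r) (⟨V, hV⟩, a)

lemma planeErr_resc {r : ℝ} (hr : 0 < r) {s : ℝ} (hs : 0 < s) (Y : PSpace n)
    (V : Submodule ℝ (EuclideanSpace ℝ (Fin n))) (a : EuclideanSpace ℝ (Fin n)) :
    planeErr k (resc k μ Y r) V a 0 s = planeErr k μ V (Y.1 + r • a) Y (r * s) := by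
  rw [planeErr, planeErr, setLIntegral_resc_pball hr, ← mul_assoc, ← ENNReal.ofReal_mul (by positivity),
    dil_zero, add_zero, mul_pow, mul_inv, mul_comm (s ^ (k + 2))⁻¹]
  congr 1
  refine lintegral_congr fun Z => ?_
  congr 2
  have : offset V a (dil r⁻¹ (Z - Y)).1 = r⁻¹ • offset V (Y.1 + r • a) Z.1 := by
    rw [offset, offset, ← map_smul]
    congr 1
    rw [dil_fst, smul_sub, smul_add, smul_smul, inv_mul_cancel₀ hr.ne', one_smul]
    simp only [Prod.fst_sub, smul_sub]
    abel
  rw [this, norm_smul, norm_inv, Real.norm_of_nonneg hr.le]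
  field_simp

lemma flat_resc {r : ℝ} (hr : 0 < r) {s : ℝ} (hs : 0 < s) (Y : PSpace n) :
    flat k (resc k μ Y r) 0 s = flat k μ Y (r * s) := by
  refine le_antisymm (le_iInf fun p => ?_) (le_iInf fun p => ?_)
  · have h := planeErr_resc (k := k) (μ := μ) hr hs Y p.1.1 (r⁻¹ • (p.2 - Y.1))
    rw [smul_smul, mul_inv_cancel₀ hr.ne', one_smul, add_sub_cancel] at h
    rw [← h]
    exact flat_le_planeErr p.1.2 _ _ _
  · rw [planeErr_resc hr hs]
    exact flat_le_planeErr p.1.2 _ _ _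

/-- The bound given by a plane through the centre of the ball. -/
lemma flat_le_lintegral (hkn : k ≤ n) (Y : PSpace n) {r : ℝ} (hr : 0 < r) :
    flat k μ Y r ≤ ENNReal.ofReal (r ^ (k + 2))⁻¹ *
      ∫⁻ Z in pball Y r, ENNReal.ofReal ((pnorm (Y - Z) / r) ^ 2) ∂μ := by
  obtain ⟨V, -, hV⟩ := exists_submodule_of_le_finrank (n := n) (W := ⊥) (d := k) (by simp) hkn
  refine (flat_le_planeErr hV Y.1 Y r).trans ?_
  rw [planeErr]
  gcongr with Z
  refine (norm_offset_le V _ _ V.zero_mem).trans ?_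
  rw [sub_zero, ← Prod.fst_sub, ← norm_neg, ← Prod.fst_neg, neg_sub]
  exact norm_fst_le_pnorm _

lemma flat_le_measure (hkn : k ≤ n) (Y : PSpace n) {r : ℝ} (hr : 0 < r) :
    flat k μ Y r ≤ ENNReal.ofReal (r ^ (k + 2))⁻¹ * μ (pball Y r) := by
  refine (flat_le_lintegral hkn Y hr).trans ?_
  gcongr
  rw [← setLIntegral_one]
  refine setLIntegral_mono measurable_const fun Z hZ => ?_
  rw [ENNReal.ofReal_le_one, sq_le_one_iff₀ (div_nonneg (pnorm_nonneg _) hr.le)]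
  exact (div_le_one hr).2 (mem_pball.1 hZ).le

/-- Convolutions with a bump are Lipschitz at scale one, with a constant depending only on the
regularity constant. -/
lemma exists_oscillation_bound (hC₀ : 0 < C₀) (k : ℕ) {ψ : PSpace n → ℝ} (hψ : IsOddBump ψ) :
    ∃ B N : ℝ, 0 ≤ B ∧ 0 ≤ N ∧ ∀ (m : Measure (PSpace n)) (ρ : ℝ≥0∞), AdrTo C₀ k m ρ →
      ENNReal.ofReal N < ρ → ∀ X ∈ m.support, ∀ X', pnorm (X - X') ≤ 1 →
        |∫ Z, ψ (X - Z) ∂m| ≤ |∫ Z, ψ (X' - Z) ∂m| + B * pnorm (X - X') := by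
  obtain ⟨a, ha, hs⟩ := hψ.annular
  obtain ⟨L, hL⟩ := hψ.smooth.lipschitzWith_of_hasCompactSupport hψ.hasCompactSupport (by simp)
  refine ⟨L * (C₀ * (a⁻¹ + 1) ^ (k + 2)), a⁻¹ + 1, by positivity, by positivity,
    fun m ρ hm hρ X hX X' hXX => ?_⟩
  have := hm.locallyFinite
  have hi : ∀ X, Integrable (fun Z => ψ (X - Z)) m := fun X =>
    integrable_of_hasCompactSupport m (hψ.smooth.continuous.comp (by fun_prop))
      (hψ.hasCompactSupport.comp_homeomorph (Homeomorph.subLeft X))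
  have h1 : |∫ Z, (ψ (X - Z) - ψ (X' - Z)) ∂m| ≤
      L * pnorm (X - X') * (C₀ * (a⁻¹ + 1) ^ (k + 2)) := by
    refine abs_integral_le_of_pball m (X := X) (R := a⁻¹ + 1) (fun Z hZ => ?_) (fun Z => ?_)
      (by positivity) (hm.regular X hX _ (by positivity) hρ).2
    · by_contra hlt
      rw [not_lt] at hlt
      refine hZ ?_
      have e1 : ψ (X - Z) = 0 := by
        by_contra h; linarith [(hs _ h).2]
      have e2 : ψ (X' - Z) = 0 := by
        by_contra h
        have := pnorm_add_le (X - X') (X' - Z)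
        rw [sub_add_sub_cancel] at this
        linarith [(hs _ h).2]
      rw [e1, e2, sub_zero]
    · rw [← Real.dist_eq]
      refine (hL.dist_le_mul _ _).trans (mul_le_mul_of_nonneg_left ?_ L.2)
      rw [dist_eq_norm, sub_sub_sub_cancel_right]
      exact norm_le_pnorm hXX
  rw [integral_sub (hi X) (hi X')] at h1
  have := abs_sub_abs_le_abs_sub (∫ Z, ψ (X - Z) ∂m) (∫ Z, ψ (X' - Z) ∂m)
  linarith

/-- If one of the convolutions is large at a point, then its mean square is bounded below. -/
lemma exists_one_le_lintegral (hC₀ : 0 < C₀) (k : ℕ)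
    (S : Finset {ψ : PSpace n → ℝ // IsOddBump ψ}) (N : ℕ) :
    ∃ (N' : ℕ) (A : ℝ≥0), ∀ m : Measure (PSpace n), AdrTo C₀ k m N' →
      ∀ ψ ∈ S, ∀ X ∈ m.support, pnorm X < N → 1 / (N : ℝ) < |∫ Z, ψ.1 (X - Z) ∂m| →
        1 ≤ A * ∫⁻ X in pball 0 N', ∑ ψ ∈ S, ‖∫ Z, ψ.1 (X - Z) ∂m‖ₑ ^ 2 ∂m := by
  choose B N₁ hB hN₁ hosc using fun ψ : {ψ : PSpace n → ℝ // IsOddBump ψ} =>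
    exists_oscillation_bound hC₀ k ψ.2
  set B₀ := 1 + ∑ ψ ∈ S, B ψ with hB₀
  have hB₀1 : 1 ≤ B₀ := le_add_of_nonneg_right (Finset.sum_nonneg fun ψ _ => hB ψ)
  obtain ⟨N', hN'⟩ := exists_nat_gt (N + 2 + ∑ ψ ∈ S, N₁ ψ)
  have hN₁s : 0 ≤ ∑ ψ ∈ S, N₁ ψ := Finset.sum_nonneg fun ψ _ => hN₁ ψ
  rcases Nat.eq_zero_or_pos N with rfl | hN
  · refine ⟨N', 0, fun m _ ψ _ X _ hX => absurd hX ?_⟩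
    simpa using pnorm_nonneg X
  have hN0 : (1 : ℝ) ≤ N := by exact_mod_cast hN
  set η : ℝ := 1 / (2 * N * B₀) with hη
  have hη0 : 0 < η := by positivity
  have hη1 : η ≤ 1 := by
    rw [hη, div_le_one (by positivity)]
    nlinarith
  set c : ℝ := (1 / (2 * N)) ^ 2 * (C₀⁻¹ * η ^ (k + 2)) with hc
  have hc0 : 0 < c := by positivity
  refine ⟨N', (c⁻¹).toNNReal, fun m hm ψ hψ X hX hXN hlarge => ?_⟩
  have hlt : ∀ x : ℝ, x < N' → ENNReal.ofReal x < N' := fun x hx => by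
    rw [← ENNReal.ofReal_natCast]
    exact (ENNReal.ofReal_lt_ofReal_iff (by linarith [(Nat.cast_nonneg N : (0 : ℝ) ≤ N)])).2 hx
  have hψN : N₁ ψ ≤ ∑ ψ ∈ S, N₁ ψ := Finset.single_le_sum (fun ψ _ => hN₁ ψ) hψ
  have hψB : B ψ ≤ B₀ := by
    have := Finset.single_le_sum (f := B) (fun ψ _ => hB ψ) hψ
    linarith
  have hsub : pball X η ⊆ pball 0 N' := by
    refine pball_subset_pball ?_
    rw [zero_sub, pnorm_neg]; linarith
  have hpt : ∀ X' ∈ pball X η, ENNReal.ofReal ((1 / (2 * N)) ^ 2) ≤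
      ∑ ψ ∈ S, ‖∫ Z, ψ.1 (X' - Z) ∂m‖ₑ ^ 2 := by
    intro X' hX'
    have hX' : pnorm (X - X') < η := hX'
    refine le_trans ?_ (Finset.single_le_sum (f := fun ψ : {ψ : PSpace n → ℝ // IsOddBump ψ} =>
      ‖∫ Z, ψ.1 (X' - Z) ∂m‖ₑ ^ 2) (fun _ _ => bot_le) hψ)
    have h1 := hosc ψ m N' hm (hlt _ (by linarith)) X hX X' (by linarith)
    have h2 : B ψ * pnorm (X - X') ≤ 1 / (2 * N) := by
      calc B ψ * pnorm (X - X') ≤ B₀ * η :=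
            mul_le_mul hψB hX'.le (pnorm_nonneg _) (by linarith)
        _ = 1 / (2 * N) := by rw [hη]; field_simp
    have h3 : (1 : ℝ) / N = 1 / (2 * N) + 1 / (2 * N) := by field_simp; norm_num
    have h4 : 1 / (2 * (N : ℝ)) ≤ |∫ Z, ψ.1 (X' - Z) ∂m| := by linarith
    rw [ENNReal.ofReal_pow (by positivity), ← ofReal_norm, Real.norm_eq_abs]
    gcongr
  calc (1 : ℝ≥0∞) = ((c⁻¹).toNNReal : ℝ≥0∞) * ENNReal.ofReal c := by
        change 1 = ENNReal.ofReal c⁻¹ * _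
        rw [← ENNReal.ofReal_mul (by positivity), inv_mul_cancel₀ hc0.ne', ENNReal.ofReal_one]
    _ ≤ ((c⁻¹).toNNReal : ℝ≥0∞) * (ENNReal.ofReal ((1 / (2 * N)) ^ 2) * m (pball X η)) := by
        gcongr
        rw [hc, ENNReal.ofReal_mul (by positivity)]
        gcongr
        exact (hm.regular X hX η hη0 (hlt _ (by linarith))).1
    _ ≤ _ := by
        gcongr
        rw [← setLIntegral_const]
        refine (setLIntegral_mono' (measurableSet_pball _ _) hpt).trans ?_
        exact lintegral_mono_set hsub

/-- The mean square, in a large ball around `Y`, of the convolutions with finitely many bumps. -/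
noncomputable def convoEnergy (k : ℕ) (S : Finset {ψ : PSpace n → ℝ // IsOddBump ψ}) (N : ℕ)
    (μ : Measure (PSpace n)) (Y : PSpace n) (r : ℝ) : ℝ≥0∞ :=
  ENNReal.ofReal (r ^ (k + 2))⁻¹ *
    ∫⁻ Z in pball Y (N * r), ∑ ψ ∈ S, ‖convo k ψ.1 μ r Z‖ₑ ^ 2 ∂μ

lemma lintegral_resc_eq_convoEnergy (S : Finset {ψ : PSpace n → ℝ // IsOddBump ψ}) (N : ℕ)
    {r : ℝ} (hr : 0 < r) (Y : PSpace n) :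
    ∫⁻ X in pball 0 N, ∑ ψ ∈ S, ‖∫ Z, ψ.1 (X - Z) ∂(resc k μ Y r)‖ₑ ^ 2 ∂(resc k μ Y r) =
      convoEnergy k S N μ Y r := by
  rw [setLIntegral_resc_pball hr, dil_zero, add_zero, mul_comm r, convoEnergy]
  congr 1
  refine lintegral_congr fun Z => Finset.sum_congr rfl fun ψ _ => ?_
  rw [integral_resc_sub hr, dil_dil, mul_inv_cancel₀ hr.ne', dil_one, add_sub_cancel]

lemma convoEnergy_mono {S T : Finset {ψ : PSpace n → ℝ // IsOddBump ψ}} (hST : S ⊆ T) {N M : ℕ}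
    (hNM : N ≤ M) (Y : PSpace n) {r : ℝ} (hr : 0 ≤ r) :
    convoEnergy k S N μ Y r ≤ convoEnergy k T M μ Y r := by
  refine mul_le_mul_right (le_trans (lintegral_mono fun Z => ?_) (lintegral_mono_set ?_)) _
  · exact Finset.sum_le_sum_of_subset hST
  · exact pball_mono (by gcongr)

/-- The improvement of approximating planes, for the infimum over all planes. -/
lemma exists_decay_of_flat (hC₀ : 0 < C₀) (n k : ℕ) :
    ∃ (S : Finset {ψ : PSpace n → ℝ // IsOddBump ψ}) (b : ℝ) (q : ℝ≥0), 0 < b ∧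
      ∀ δ : ℝ, 0 < δ → δ ≤ 1 → ∃ A : ℝ≥0, ∀ m : Measure (PSpace n), AdrTo C₀ k m 10 →
        0 ∈ m.support → (∃ V : Submodule ℝ (EuclideanSpace ℝ (Fin n)), finrank ℝ V = k ∧
          ∫⁻ Z in pball 0 4, ENNReal.ofReal (‖offset V 0 Z.1‖ ^ 2) ∂m ≤ ENNReal.ofReal b) →
        flat k m 0 δ ≤ A * ∫⁻ X in pball 0 1, ∑ ψ ∈ S, ‖∫ Z, ψ.1 (X - Z) ∂m‖ₑ ^ 2 ∂m +
          q * ENNReal.ofReal (δ ^ 2) * flat k m 0 4 := by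
  classical
  obtain ⟨Ψ, b, C, hΨ, hb, hC, himp⟩ := exists_improved_plane hC₀ n k
  set S : Finset {ψ : PSpace n → ℝ // IsOddBump ψ} := Finset.univ.image fun i => ⟨Ψ i, hΨ i⟩ with hS
  refine ⟨S, b, (C * C₀ * 4 ^ (k + 4)).toNNReal, hb, fun δ hδ hδ1 => ?_⟩
  refine ⟨((δ ^ (k + 2))⁻¹ * (δ ^ 2)⁻¹ * C).toNNReal * n, fun m hm h0 ⟨V₀, hV₀, hV₀b⟩ => ?_⟩
  have := hm.locallyFinite
  set E := ∫⁻ X in pball 0 1, ∑ ψ ∈ S, ‖∫ Z, ψ.1 (X - Z) ∂m‖ₑ ^ 2 ∂m with hE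
  set β : Submodule ℝ (EuclideanSpace ℝ (Fin n)) → EuclideanSpace ℝ (Fin n) → ℝ := fun V a =>
    ∫ Z in pball 0 4, ‖offset V a Z.1‖ ^ 2 ∂m with hβ
  have hβ0 : ∀ V a, 0 ≤ β V a := fun V a => integral_nonneg fun _ => by positivity
  have hβe : ∀ V a, ENNReal.ofReal (β V a) =
      ∫⁻ Z in pball 0 4, ENNReal.ofReal (‖offset V a Z.1‖ ^ 2) ∂m := fun V a =>
    ofReal_integral_eq_lintegral_ofReal
      (integrableOn_pball_of_continuous (((continuous_offset V a).comp continuous_fst).norm.pow 2)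
        0 4) (Eventually.of_forall fun _ => by positivity)
  have hβp : ∀ V a, ENNReal.ofReal (β V a) = ENNReal.ofReal (4 ^ (k + 4)) * planeErr k m V a 0 4 := by
    intro V a
    have e : ∀ Z : PSpace n, ENNReal.ofReal ((‖offset V a Z.1‖ / 4) ^ 2) =
        ENNReal.ofReal (4 ^ 2)⁻¹ * ENNReal.ofReal (‖offset V a Z.1‖ ^ 2) := fun Z => by
      rw [← ENNReal.ofReal_mul (by positivity), div_pow, div_eq_inv_mul]
    rw [planeErr, ← mul_assoc, ← ENNReal.ofReal_mul (by positivity)]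
    simp only [e]
    rw [lintegral_const_mul' _ _ ENNReal.ofReal_ne_top, ← mul_assoc,
      ← ENNReal.ofReal_mul (by positivity), ← hβe,
      show (4 : ℝ) ^ (k + 4) * (4 ^ (k + 2))⁻¹ * (4 ^ 2)⁻¹ = 1 by field_simp; ring,
      ENNReal.ofReal_one, one_mul]
  set A : ℝ≥0∞ := ((((δ ^ (k + 2))⁻¹ * (δ ^ 2)⁻¹ * C).toNNReal * n : ℝ≥0) : ℝ≥0∞) with hA
  have hplane : ∀ (V : Submodule ℝ (EuclideanSpace ℝ (Fin n))) a, finrank ℝ V = k → β V a ≤ b →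
      flat k m 0 δ ≤ A * E + ENNReal.ofReal (C * C₀ * δ ^ 2) * ENNReal.ofReal (β V a) := by
    intro V a hV hVb
    obtain ⟨W, a', hW, hWa⟩ := himp m hm h0 V a hVb
    have hball := (hm.regular 0 h0 δ hδ (by
      refine (ENNReal.ofReal_le_one.2 hδ1).trans_lt (by norm_num))).2
    have hpt : ∀ᵐ X ∂(m.restrict (pball 0 δ)), ENNReal.ofReal ((‖offset W a' X.1‖ / δ) ^ 2) ≤
        ENNReal.ofReal ((δ ^ 2)⁻¹ * C) * (n * ∑ ψ ∈ S, ‖∫ Z, ψ.1 (X - Z) ∂m‖ₑ ^ 2 +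
          ENNReal.ofReal (δ ^ 4 * β V a)) := by
      filter_upwards [ae_restrict_of_ae (ae_mem_support m), ae_restrict_mem (measurableSet_pball _ _)]
        with X hX hXδ
      rw [mem_pball, zero_sub, pnorm_neg] at hXδ
      have h1 : (‖offset W a' X.1‖ / δ) ^ 2 ≤
          (δ ^ 2)⁻¹ * C * (∑ i, (∫ Y, Ψ i (X - Y) ∂m) ^ 2 + δ ^ 4 * β V a) := by
        rw [div_pow, div_eq_inv_mul, mul_assoc]
        refine mul_le_mul_of_nonneg_left ((hWa X hX (hXδ.le.trans hδ1)).trans ?_) (by positivity)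
        have := pow_le_pow_left₀ (pnorm_nonneg X) hXδ.le 4
        have := mul_le_mul_of_nonneg_right this (hβ0 V a)
        exact mul_le_mul_of_nonneg_left (add_le_add le_rfl this) hC.le
      refine (ENNReal.ofReal_le_ofReal h1).trans ?_
      have hs0 : 0 ≤ ∑ i, (∫ Y, Ψ i (X - Y) ∂m) ^ 2 := Finset.sum_nonneg fun _ _ => sq_nonneg _
      rw [ENNReal.ofReal_mul (by positivity),
        ENNReal.ofReal_add hs0 (mul_nonneg (by positivity) (hβ0 V a)),
        ENNReal.ofReal_sum_of_nonneg fun _ _ => sq_nonneg _]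
      gcongr
      calc ∑ i, ENNReal.ofReal ((∫ Y, Ψ i (X - Y) ∂m) ^ 2)
          ≤ ∑ _i : Fin n, ∑ ψ ∈ S, ‖∫ Z, ψ.1 (X - Z) ∂m‖ₑ ^ 2 := by
            refine Finset.sum_le_sum fun i _ => ?_
            have h2 := Finset.single_le_sum
              (f := fun ψ : {ψ : PSpace n → ℝ // IsOddBump ψ} => ‖∫ Z, ψ.1 (X - Z) ∂m‖ₑ ^ 2)
              (fun _ _ => bot_le)
              (Finset.mem_image_of_mem (fun i => (⟨Ψ i, hΨ i⟩ : {ψ : PSpace n → ℝ // IsOddBump ψ}))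
                (Finset.mem_univ i))
            refine le_trans (le_of_eq ?_) h2
            rw [← ofReal_norm, ← ENNReal.ofReal_pow (norm_nonneg _), Real.norm_eq_abs, sq_abs]
        _ = _ := by simp
    refine (flat_le_planeErr (hW.trans hV) a' 0 δ).trans ?_
    rw [planeErr]
    calc _ ≤ ENNReal.ofReal (δ ^ (k + 2))⁻¹ * ∫⁻ X in pball 0 δ, ENNReal.ofReal ((δ ^ 2)⁻¹ * C) *
          (n * ∑ ψ ∈ S, ‖∫ Z, ψ.1 (X - Z) ∂m‖ₑ ^ 2 + ENNReal.ofReal (δ ^ 4 * β V a)) ∂m :=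
          mul_le_mul_right (lintegral_mono_ae hpt) _
      _ = ENNReal.ofReal (δ ^ (k + 2))⁻¹ * (ENNReal.ofReal ((δ ^ 2)⁻¹ * C) *
          (n * ∫⁻ X in pball 0 δ, ∑ ψ ∈ S, ‖∫ Z, ψ.1 (X - Z) ∂m‖ₑ ^ 2 ∂m +
            ENNReal.ofReal (δ ^ 4 * β V a) * m (pball 0 δ))) := by
          rw [lintegral_const_mul' _ _ ENNReal.ofReal_ne_top,
            lintegral_add_right _ measurable_const, lintegral_const_mul' _ _ (by simp),
            setLIntegral_const]
      _ ≤ ENNReal.ofReal (δ ^ (k + 2))⁻¹ * (ENNReal.ofReal ((δ ^ 2)⁻¹ * C) *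
          (n * E + ENNReal.ofReal (δ ^ 4 * β V a) * ENNReal.ofReal (C₀ * δ ^ (k + 2)))) := by
          gcongr
          exact lintegral_mono_set (pball_mono hδ1)
      _ = _ := by
          rw [mul_add, mul_add]
          congr 1
          · rw [hA, ENNReal.coe_mul, ENNReal.coe_natCast, ← mul_assoc, ← mul_assoc,
              ← ENNReal.ofReal_mul (by positivity), ← mul_assoc (δ ^ (k + 2))⁻¹]
            rfl
          · rw [← ENNReal.ofReal_mul (mul_nonneg (by positivity) (hβ0 V a)),
              ← ENNReal.ofReal_mul (by positivity), ← ENNReal.ofReal_mul (by positivity),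
              ← ENNReal.ofReal_mul (by positivity)]
            congr 1
            field_simp
  have hV₀b' : β V₀ 0 ≤ b := by
    rw [← hβe] at hV₀b
    exact (ENNReal.ofReal_le_ofReal_iff hb.le).1 hV₀b
  -- a plane with a large error does no better than `V₀`
  have hall : ∀ (V : Submodule ℝ (EuclideanSpace ℝ (Fin n))) a, finrank ℝ V = k →
      flat k m 0 δ ≤ A * E + ENNReal.ofReal (C * C₀ * δ ^ 2) * ENNReal.ofReal (β V a) := by
    intro V a hV
    rcases le_total (β V a) b with h | h
    · exact hplane V a hV h
    · refine (hplane V₀ 0 hV₀ hV₀b').trans ?_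
      gcongr
      exact hV₀b'.trans h
  have : Nonempty ({V : Submodule ℝ (EuclideanSpace ℝ (Fin n)) // finrank ℝ V = k} ×
    EuclideanSpace ℝ (Fin n)) := ⟨(⟨V₀, hV₀⟩, 0)⟩
  conv_rhs => rw [flat]
  rw [ENNReal.mul_iInf (fun h => absurd h (ENNReal.mul_ne_top ENNReal.coe_ne_top
    ENNReal.ofReal_ne_top)), ENNReal.add_iInf]
  refine le_iInf fun p => (hall p.1.1 p.2 p.1.2).trans (le_of_eq ?_)
  rw [hβp, ← mul_assoc]
  congr 2
  change _ = ENNReal.ofReal (C * C₀ * 4 ^ (k + 4)) * _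
  rw [← ENNReal.ofReal_mul (by positivity), ← ENNReal.ofReal_mul (by positivity)]
  congr 1
  ring

/-- Decay of the flatness coefficients at the points and scales where no `α`-number of dimension
`k+1` or `k+2` is small: if the convolutions with suitable odd bumps are small, then compactness
gives a good approximating plane, which improves at smaller scales; otherwise their energy is
bounded below. -/
theorem exists_decay (hC₀ : 0 < C₀) (hkn : k ≤ n) (hμ : AdrTo C₀ k μ ρ) {ε : ℝ} (hε : 0 < ε) :
    ∃ q : ℝ≥0, ∀ δ : ℝ, 0 < δ → δ ≤ 1 →
      ∃ (S : Finset {ψ : PSpace n → ℝ // IsOddBump ψ}) (N : ℕ) (A : ℝ≥0), ∀ Y ∈ μ.support, ∀ r : ℝ,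
        0 < r → ENNReal.ofReal (N * r) < ρ →
        (∀ J ≤ N, ∀ m, m = k + 1 ∨ m = k + 2 → ¬ AlphaSmall C₀ k ε μ m J Y r) →
        flat k μ Y (r * δ) ≤ A * convoEnergy k S N μ Y r +
          q * ENNReal.ofReal (δ ^ 2) * flat k μ Y (r * 4) := by
  classical
  have := hμ.locallyFinite
  obtain ⟨S₁, b, q, hb, hdec⟩ := exists_decay_of_flat hC₀ n k
  refine ⟨q, fun δ hδ hδ1 => ?_⟩
  obtain ⟨A₁, hA₁⟩ := hdec δ hδ hδ1
  obtain ⟨S₀, N₀, hflat⟩ := exists_flat hC₀ hkn hμ (M := 4) hε hb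
  obtain ⟨N₁, A₀, hone⟩ := exists_one_le_lintegral hC₀ k S₀ N₀
  set N := max (max N₀ N₁) 10 with hN
  have hN₀ : N₀ ≤ N := (le_max_left _ _).trans (le_max_left _ _)
  have hN₁ : N₁ ≤ N := (le_max_right _ _).trans (le_max_left _ _)
  have hN10 : 10 ≤ N := le_max_right _ _
  refine ⟨S₀ ∪ S₁, N, A₁ + C₀.toNNReal * A₀, fun Y hY r hr hNr hα => ?_⟩
  set m := resc k μ Y r with hm
  have hle : ∀ N' : ℕ, N' ≤ N → ENNReal.ofReal (N' * r) < ρ := fun N' h =>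
    (ENNReal.ofReal_le_ofReal (by gcongr)).trans_lt hNr
  have hmN : ∀ N' : ℕ, N' ≤ N → AdrTo C₀ k m N' := fun N' h => hμ.resc Y hr (by
    rw [mul_comm, ← ENNReal.ofReal_natCast, ← ENNReal.ofReal_mul (by positivity)]
    exact (hle N' h).le)
  have hm10 : AdrTo C₀ k m 10 := hmN 10 hN10
  have h0 : (0 : PSpace n) ∈ m.support := (mem_support_resc hr).2 (by simpa using hY)
  -- if a convolution is large somewhere, then the energy is bounded below, and the trivial bound on
  -- the flatness suffices
  by_cases hsmall : ∀ ψ ∈ S₀, ∀ X ∈ μ.support, pnorm (X - Y) < N₀ * r → |convo k ψ.1 μ r X| ≤ 1 / N₀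
  · have hV := hflat Y hY r hr (hle N₀ hN₀) hsmall fun J hJ => hα J (hJ.trans hN₀)
    have h1 := hA₁ m hm10 h0 hV
    rw [hm, flat_resc hr hδ, flat_resc hr four_pos] at h1
    refine h1.trans (add_le_add_left ?_ _)
    have h2 := lintegral_resc_eq_convoEnergy (k := k) (μ := μ) S₁ 1 hr Y
    rw [Nat.cast_one] at h2
    rw [h2]
    gcongr
    · exact le_add_of_nonneg_right bot_le
    · exact convoEnergy_mono Finset.subset_union_right (by omega) Y hr.le
  · push Not at hsmall
    obtain ⟨ψ, hψ, X, hX, hXY, hlarge⟩ := hsmall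
    have hX' : Y + dil r (dil r⁻¹ (X - Y)) = X := by
      rw [dil_dil, mul_inv_cancel₀ hr.ne', dil_one, add_sub_cancel]
    have h1 := hone m (hmN N₁ hN₁) ψ hψ (dil r⁻¹ (X - Y))
      ((mem_support_resc hr).2 (by rwa [hX']))
      (by rwa [pnorm_dil (inv_nonneg.2 hr.le), inv_mul_lt_iff₀ hr, mul_comm])
      (by rwa [hm, integral_resc_sub hr, hX'])
    rw [hm, lintegral_resc_eq_convoEnergy S₀ N₁ hr Y] at h1
    have h2 : flat k μ Y (r * δ) ≤ C₀.toNNReal := by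
      rw [← flat_resc hr hδ]
      refine (flat_le_measure hkn _ hδ).trans ?_
      refine (mul_le_mul_right (hm10.regular 0 h0 δ hδ
        ((ENNReal.ofReal_le_one.2 hδ1).trans_lt (by norm_num))).2 _).trans ?_
      rw [← ENNReal.ofReal_mul (by positivity)]
      refine (ENNReal.ofReal_le_ofReal (q := C₀) (le_of_eq ?_)).trans le_rfl
      field_simp
    refine le_add_of_le_of_nonneg ?_ bot_le
    calc flat k μ Y (r * δ) ≤ C₀.toNNReal * 1 := by rw [mul_one]; exact h2
      _ ≤ C₀.toNNReal * (A₀ * convoEnergy k S₀ N₁ μ Y r) := by gcongr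
      _ ≤ _ := by
          rw [← mul_assoc, ← ENNReal.coe_mul]
          gcongr
          · exact le_add_of_nonneg_left bot_le
          · exact convoEnergy_mono Finset.subset_union_left hN₁ Y hr.le

end ParabolicUR

/-! ### Carleson packing estimates -/

namespace ParabolicUR

open Module Filter Topology

variable {n k : ℕ} {C₀ : ℝ} {μ : Measure (PSpace n)}

/-- Balls of all centres and radii have the expected upper bound on their mass. If the support is
bounded, the constant depends on `μ`. -/
lemma exists_measure_pball_le (hC₀ : 0 < C₀) (hμ : IsADR C₀ k μ) (hd : pdiam μ.support ≠ 0) :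
    ∃ C : ℝ, 0 < C ∧ ∀ X r, 0 < r → μ (pball X r) ≤ ENNReal.ofReal (C * r ^ (k + 2)) := by
  have := hμ.locallyFinite
  set d := pdiam μ.support with hdef
  have key : ∃ C : ℝ, 0 < C ∧ ∀ X ∈ μ.support, ∀ r, 0 < r →
      μ (pball X r) ≤ ENNReal.ofReal (C * r ^ (k + 2)) := by
    rcases eq_or_ne d ∞ with hinf | hfin
    · exact ⟨C₀, hC₀, fun X hX r hr => (hμ.regular X hX r hr (by
        rw [← hdef, hinf]; exact ENNReal.ofReal_lt_top)).2⟩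
    · have hd0 : 0 < d.toReal := ENNReal.toReal_pos hd hfin
      rcases μ.support.eq_empty_or_nonempty with he | ⟨X₀, hX₀⟩
      · exact ⟨1, one_pos, fun X hX => by simp [he] at hX⟩
      have htot : μ univ ≤ μ (pball X₀ (2 * d.toReal)) := by
        refine measure_mono_ae ?_
        filter_upwards [ae_mem_support μ] with X hX _
        have h1 : ENNReal.ofReal (pnorm (X₀ - X)) ≤ d :=
          le_iSup₂_of_le X₀ hX₀ (le_iSup₂_of_le X hX le_rfl)
        have h2 := (ENNReal.ofReal_le_iff_le_toReal hfin).1 h1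
        change pnorm (X₀ - X) < _
        linarith
      have hfinμ : μ univ ≠ ∞ := (htot.trans_lt (measure_pball_lt_top μ _ _)).ne
      refine ⟨max C₀ ((μ univ).toReal / d.toReal ^ (k + 2)), lt_max_of_lt_left hC₀,
        fun X hX r hr => ?_⟩
      rcases lt_or_ge (ENNReal.ofReal r) d with hlt | hge
      · refine (hμ.regular X hX r hr hlt).2.trans (ENNReal.ofReal_le_ofReal ?_)
        gcongr
        exact le_max_left _ _
      · have hdr : d.toReal ≤ r := ENNReal.toReal_le_of_le_ofReal hr.le hge
        refine (measure_mono (subset_univ _)).trans ?_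
        refine (ENNReal.le_ofReal_iff_toReal_le hfinμ (by positivity)).2 ?_
        calc (μ univ).toReal = (μ univ).toReal / d.toReal ^ (k + 2) * d.toReal ^ (k + 2) := by
              field_simp
          _ ≤ max C₀ ((μ univ).toReal / d.toReal ^ (k + 2)) * r ^ (k + 2) := by
              gcongr
              exact le_max_right _ _
  obtain ⟨C, hC, h⟩ := key
  refine ⟨C * 2 ^ (k + 2), by positivity, fun X r hr => ?_⟩
  rcases eq_or_ne (μ (pball X r)) 0 with h0 | h0
  · rw [h0]; exact bot_le
  obtain ⟨X', hX', hX'r⟩ := exists_mem_support_of_pos h0.bot_lt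
  have hsub : pball X r ⊆ pball X' (2 * r) := by
    refine pball_subset_pball ?_
    have : pnorm (X - X') < r := hX'r
    rw [pnorm_sub_comm] at this
    linarith
  refine (measure_mono hsub).trans ((h X' hX' _ (by positivity)).trans
    (ENNReal.ofReal_le_ofReal (le_of_eq ?_)))
  rw [mul_pow]; ring

section

variable [IsLocallyFiniteMeasure μ]

lemma measurable_convo {ψ : PSpace n → ℝ} (hψ : IsOddBump ψ) (r : ℝ) :
    Measurable (convo k ψ μ r) := by
  have h : StronglyMeasurable fun p : PSpace n × PSpace n => ψ (dil r⁻¹ (p.1 - p.2)) :=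
    (hψ.smooth.continuous.comp ((continuous_dil _).comp (by fun_prop))).stronglyMeasurable
  exact (h.integral_prod_right' (ν := μ)).measurable.const_mul _

/-- The square function estimate for the full convolutions: at scales up to `R`, only the part of `μ`
in a larger ball contributes on `B(X₀, R)`. -/
lemma exists_sum_convo_le {ψ : PSpace n → ℝ} (hψ : IsOddBump ψ)
    (hCZO : ∀ K : PSpace n → ℝ, IsAdmissibleKernel k K → CZOBounded K μ) :
    ∃ (C : ℝ≥0) (c : ℝ), 0 < c ∧ ∀ (X₀ : PSpace n) (R : ℝ), 0 < R → ∀ s : Finset ℤ,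
      (∀ j ∈ s, (2 : ℝ) ^ j ≤ R) →
        ∑ j ∈ s, ∫⁻ X in pball X₀ R, ‖convo k ψ μ (2 ^ j) X‖ₑ ^ 2 ∂μ ≤ C * μ (pball X₀ (c * R)) := by
  obtain ⟨C, hC⟩ := exists_square_bound hψ hCZO
  obtain ⟨ρ, hρ, hψρ⟩ := hψ.annular
  refine ⟨C, 1 + ρ⁻¹, by positivity, fun X₀ R hR s hs => le_trans ?_ (hC X₀ ((1 + ρ⁻¹) * R) s)⟩
  refine Finset.sum_le_sum fun j hj => le_trans ?_ (setLIntegral_le_lintegral (pball X₀ R) _)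
  refine setLIntegral_mono' (measurableSet_pball _ _) fun X hX => le_of_eq ?_
  congr 2
  rw [convo_eq_integral_scaled, localConvo]
  refine (setIntegral_eq_integral_of_forall_compl_eq_zero fun Y hY => ?_).symm
  by_contra hne
  refine hY ?_
  have h1 := (scaled_ne_zero (zpow_pos two_pos j) hψρ hne).2
  have h2 := pnorm_add_le (X₀ - X) (X - Y)
  rw [sub_add_sub_cancel] at h2
  have h3 : (2 : ℝ) ^ j * ρ⁻¹ ≤ R * ρ⁻¹ := by
    have := hs j hj
    gcongr
  have h4 : pnorm (X₀ - X) < R := hX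
  change pnorm (X₀ - Y) < _
  linarith

lemma measurable_lintegral_pball {g : PSpace n → ℝ≥0∞} (hg : Measurable g) (t : ℝ) :
    Measurable fun Y => ∫⁻ Z in pball Y t, g Z ∂μ := by
  have h1 : MeasurableSet {p : PSpace n × PSpace n | pnorm (p.1 - p.2) < t} :=
    (isOpen_lt (continuous_pnorm.comp (by fun_prop)) continuous_const).measurableSet
  have h2 : Measurable (indicator {p : PSpace n × PSpace n | pnorm (p.1 - p.2) < t}
      fun p => g p.2) := (hg.comp measurable_snd).indicator h1
  convert h2.lintegral_prod_right' (ν := μ) using 2 with Y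
  rw [← lintegral_indicator (measurableSet_pball _ _)]
  rfl

/-- Tonelli: each `Z` lies in `B(Y, t)` for a set of `Y` of mass at most `C t^{k+2}`. -/
lemma lintegral_lintegral_pball_le {C t : ℝ} (ht : 0 < t)
    (hC : ∀ X r, 0 < r → μ (pball X r) ≤ ENNReal.ofReal (C * r ^ (k + 2)))
    {g : PSpace n → ℝ≥0∞} (hg : Measurable g) (X₀ : PSpace n) (R : ℝ) :
    ∫⁻ Y in pball X₀ R, ∫⁻ Z in pball Y t, g Z ∂μ ∂μ ≤
      ENNReal.ofReal (C * t ^ (k + 2)) * ∫⁻ Z in pball X₀ (R + t), g Z ∂μ := by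
  have h1 : MeasurableSet {p : PSpace n × PSpace n | pnorm (p.1 - p.2) < t} :=
    (isOpen_lt (continuous_pnorm.comp (by fun_prop)) continuous_const).measurableSet
  have h2 : Measurable (indicator {p : PSpace n × PSpace n | pnorm (p.1 - p.2) < t}
      fun p => g p.2) := (hg.comp measurable_snd).indicator h1
  calc ∫⁻ Y in pball X₀ R, ∫⁻ Z in pball Y t, g Z ∂μ ∂μ
      = ∫⁻ Y in pball X₀ R, ∫⁻ Z, indicator {p : PSpace n × PSpace n | pnorm (p.1 - p.2) < t}
          (fun p => g p.2) (Y, Z) ∂μ ∂μ := by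
        refine lintegral_congr fun Y => ?_
        rw [← lintegral_indicator (measurableSet_pball _ _)]
        rfl
    _ = ∫⁻ Z, ∫⁻ Y in pball X₀ R, indicator {p : PSpace n × PSpace n | pnorm (p.1 - p.2) < t}
          (fun p => g p.2) (Y, Z) ∂μ ∂μ := lintegral_lintegral_swap h2.aemeasurable
    _ ≤ ∫⁻ Z, indicator (pball X₀ (R + t)) (fun Z => ENNReal.ofReal (C * t ^ (k + 2)) * g Z) Z ∂μ := by
        refine lintegral_mono fun Z => ?_
        by_cases hZ : Z ∈ pball X₀ (R + t)
        · rw [indicator_of_mem hZ]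
          calc _ ≤ ∫⁻ Y, indicator (pball Z t) (fun _ => g Z) Y ∂μ := by
                refine (setLIntegral_le_lintegral _ _).trans (lintegral_mono fun Y => ?_)
                simp only [indicator, mem_pball, pnorm_sub_comm Z Y, Set.mem_ofPred_eq]
                rfl
            _ = g Z * μ (pball Z t) := by
                rw [lintegral_indicator (measurableSet_pball _ _), setLIntegral_const]
            _ ≤ _ := by
                rw [mul_comm]
                gcongr
                exact hC Z t ht
        · rw [indicator_of_notMem hZ]
          refine le_of_eq (setLIntegral_eq_zero (measurableSet_pball _ _) fun Y hY => ?_)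
          refine indicator_of_notMem (fun h => hZ ?_) _
          have h3 : pnorm (Y - Z) < t := h
          have h4 : pnorm (X₀ - Y) < R := hY
          have h5 := pnorm_add_le (X₀ - Y) (Y - Z)
          rw [sub_add_sub_cancel] at h5
          change pnorm (X₀ - Z) < _
          linarith
    _ = _ := by
        rw [lintegral_indicator (measurableSet_pball _ _),
          lintegral_const_mul' _ _ ENNReal.ofReal_ne_top]

lemma measurable_convoEnergy (S : Finset {ψ : PSpace n → ℝ // IsOddBump ψ}) (N : ℕ) (r : ℝ) :
    Measurable fun Y => convoEnergy k S N μ Y r :=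
  (measurable_lintegral_pball (Finset.measurable_sum _ fun ψ _ =>
    ((measurable_convo ψ.2 r).enorm.pow_const 2)) _).const_mul _

/-- The Carleson estimate for the energies, by the square function estimate and Tonelli. -/
lemma exists_sum_convoEnergy_le {C : ℝ} (hC0 : 0 ≤ C)
    (hC : ∀ X r, 0 < r → μ (pball X r) ≤ ENNReal.ofReal (C * r ^ (k + 2)))
    (hCZO : ∀ K : PSpace n → ℝ, IsAdmissibleKernel k K → CZOBounded K μ)
    (S : Finset {ψ : PSpace n → ℝ // IsOddBump ψ}) (N : ℕ) :
    ∃ A : ℝ≥0, ∀ (X₀ : PSpace n) (R : ℝ), 0 < R → ∀ s : Finset ℤ, (∀ j ∈ s, (2 : ℝ) ^ j ≤ R) →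
      ∑ j ∈ s, ∫⁻ Y in pball X₀ R, convoEnergy k S N μ Y (2 ^ j) ∂μ ≤
        A * ENNReal.ofReal (R ^ (k + 2)) := by
  choose B c hc hB using fun ψ : {ψ : PSpace n → ℝ // IsOddBump ψ} => exists_sum_convo_le ψ.2 hCZO
  refine ⟨(C * (N + 1) ^ (k + 2)).toNNReal * ∑ ψ ∈ S,
    B ψ * (C * (c ψ * (N + 2)) ^ (k + 2)).toNNReal, fun X₀ R hR s hs => ?_⟩
  have hstep : ∀ j ∈ s, ∫⁻ Y in pball X₀ R, convoEnergy k S N μ Y (2 ^ j) ∂μ ≤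
      ENNReal.ofReal (C * (N + 1) ^ (k + 2)) *
        ∑ ψ ∈ S, ∫⁻ Z in pball X₀ ((N + 2) * R), ‖convo k ψ.1 μ (2 ^ j) Z‖ₑ ^ 2 ∂μ := by
    intro j hj
    have h2 : (0 : ℝ) < 2 ^ j := zpow_pos two_pos j
    have hm : ∀ ψ ∈ S, Measurable fun Z => ‖convo k ψ.1 μ (2 ^ j) Z‖ₑ ^ 2 := fun ψ _ =>
      (measurable_convo ψ.2 _).enorm.pow_const 2
    calc ∫⁻ Y in pball X₀ R, convoEnergy k S N μ Y (2 ^ j) ∂μ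
        ≤ ∫⁻ Y in pball X₀ R, convoEnergy k S (N + 1) μ Y (2 ^ j) ∂μ :=
          lintegral_mono fun Y => convoEnergy_mono subset_rfl (Nat.le_succ N) Y h2.le
      _ = ENNReal.ofReal ((2 ^ j) ^ (k + 2))⁻¹ * ∫⁻ Y in pball X₀ R,
          ∫⁻ Z in pball Y ((N + 1 : ℕ) * 2 ^ j), ∑ ψ ∈ S, ‖convo k ψ.1 μ (2 ^ j) Z‖ₑ ^ 2 ∂μ ∂μ := by
          simp only [convoEnergy]
          rw [lintegral_const_mul' _ _ ENNReal.ofReal_ne_top]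
      _ ≤ ENNReal.ofReal ((2 ^ j) ^ (k + 2))⁻¹ *
          (ENNReal.ofReal (C * ((N + 1 : ℕ) * 2 ^ j) ^ (k + 2)) *
            ∫⁻ Z in pball X₀ (R + (N + 1 : ℕ) * 2 ^ j), ∑ ψ ∈ S, ‖convo k ψ.1 μ (2 ^ j) Z‖ₑ ^ 2 ∂μ) := by
          gcongr
          exact lintegral_lintegral_pball_le (by positivity) hC
            (Finset.measurable_sum _ hm) X₀ R
      _ = ENNReal.ofReal (C * (N + 1) ^ (k + 2)) *
            ∫⁻ Z in pball X₀ (R + (N + 1 : ℕ) * 2 ^ j), ∑ ψ ∈ S, ‖convo k ψ.1 μ (2 ^ j) Z‖ₑ ^ 2 ∂μ := by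
          rw [← mul_assoc, ← ENNReal.ofReal_mul (by positivity)]
          congr 2
          push_cast
          rw [mul_pow]
          field_simp
      _ ≤ _ := by
          rw [← lintegral_finsetSum _ hm]
          refine mul_le_mul_right (lintegral_mono_set (pball_mono ?_)) _
          have := hs j hj
          push_cast
          nlinarith [(Nat.cast_nonneg N : (0 : ℝ) ≤ N)]
  calc ∑ j ∈ s, ∫⁻ Y in pball X₀ R, convoEnergy k S N μ Y (2 ^ j) ∂μ
      ≤ ∑ j ∈ s, ENNReal.ofReal (C * (N + 1) ^ (k + 2)) *
        ∑ ψ ∈ S, ∫⁻ Z in pball X₀ ((N + 2) * R), ‖convo k ψ.1 μ (2 ^ j) Z‖ₑ ^ 2 ∂μ :=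
        Finset.sum_le_sum hstep
    _ = ENNReal.ofReal (C * (N + 1) ^ (k + 2)) *
        ∑ ψ ∈ S, ∑ j ∈ s, ∫⁻ Z in pball X₀ ((N + 2) * R), ‖convo k ψ.1 μ (2 ^ j) Z‖ₑ ^ 2 ∂μ := by
        rw [← Finset.mul_sum, Finset.sum_comm]
    _ ≤ ENNReal.ofReal (C * (N + 1) ^ (k + 2)) * ∑ ψ ∈ S, B ψ *
        ENNReal.ofReal (C * (c ψ * ((N + 2) * R)) ^ (k + 2)) := by
        gcongr with ψ hψ
        refine (hB ψ X₀ ((N + 2) * R) (by positivity) s fun j hj => ?_).trans ?_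
        · have := hs j hj
          nlinarith [(Nat.cast_nonneg N : (0 : ℝ) ≤ N)]
        · have := hc ψ
          gcongr
          exact hC _ _ (by positivity)
    _ = _ := by
        rw [ENNReal.coe_mul, ENNReal.ofNNReal_finsetSum, mul_assoc, Finset.sum_mul]
        congr 1
        refine Finset.sum_congr rfl fun ψ _ => ?_
        rw [ENNReal.coe_mul, mul_assoc]
        congr 1
        change _ = ENNReal.ofReal _ * _
        have := hc ψ
        rw [← ENNReal.ofReal_mul (by positivity), ← mul_assoc (c ψ), mul_pow _ R, mul_assoc]

end

/-- The set of points near which, at the scales just above `2 ^ J * r`, the `α`-numbers of dimension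
`m` are small. It is open by definition. -/
def badSet (C₀ : ℝ) (k : ℕ) (ε : ℝ) (μ : Measure (PSpace n)) (m J : ℕ) (r : ℝ) : Set (PSpace n) :=
  ⋃ Y ∈ {Y | Y ∈ μ.support ∧ AlphaSmall C₀ k ε μ m J Y r}, pball Y (r / 2)

lemma measurableSet_badSet (C₀ : ℝ) (k : ℕ) (ε : ℝ) (μ : Measure (PSpace n)) (m J : ℕ) (r : ℝ) :
    MeasurableSet (badSet C₀ k ε μ m J r) :=
  (isOpen_biUnion fun _ _ => isOpen_pball _ _).measurableSet

/-- The HSDC bounds the total mass of the bad sets, because the ranges of scales `(s, 3s/2)`,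
`s = 2^{J+j}`, are disjoint and each has a fixed mass for `dr / r`. -/
lemma exists_sum_badSet_le {ε : ℝ} (h : HSDC C₀ k ε μ) {m : ℕ} (hm : m = k + 1 ∨ m = k + 2)
    (J : ℕ) : ∃ A : ℝ≥0, ∀ X₀ ∈ μ.support, ∀ R : ℝ, 0 < R → ∀ s : Finset ℤ,
      (∀ j ∈ s, (2 : ℝ) ^ j ≤ R) →
        ∑ j ∈ s, μ (badSet C₀ k ε μ m J (2 ^ j) ∩ pball X₀ R) ≤ A * ENNReal.ofReal (R ^ (k + 2)) := by
  obtain ⟨C, hC⟩ := h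
  refine ⟨3 * C * (2 ^ (J + 1)) ^ (k + 2), fun X₀ hX₀ R hR s hs => ?_⟩
  set R' := 2 ^ (J + 1) * R with hR'
  have hRR : R ≤ R' := le_mul_of_one_le_left hR.le (one_le_pow₀ one_le_two)
  set I : ℤ → Set ℝ := fun j => Ioo (2 ^ J * 2 ^ j) (3 / 2 * (2 ^ J * 2 ^ j)) with hI
  set f : ℝ → ℝ≥0∞ := fun r => (∫⁻ Y in pball X₀ R',
    indicator {Z | alphaNumber C₀ k (k + 1) μ Z r < ENNReal.ofReal ε ∨
      alphaNumber C₀ k (k + 2) μ Z r < ENNReal.ofReal ε} (fun _ => 1) Y ∂μ) / ENNReal.ofReal r with hf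
  have hpos : ∀ j : ℤ, (0 : ℝ) < 2 ^ J * 2 ^ j := fun j => by positivity
  have hlow : ∀ j ∈ s, μ (badSet C₀ k ε μ m J (2 ^ j) ∩ pball X₀ R) ≤ 3 * ∫⁻ r in I j, f r := by
    intro j hj
    set E := badSet C₀ k ε μ m J (2 ^ j) ∩ pball X₀ R with hE
    have hEm : MeasurableSet E := (measurableSet_badSet _ _ _ _ _ _ _).inter (measurableSet_pball _ _)
    have hfr : ∀ r ∈ I j, μ E / ENNReal.ofReal (3 / 2 * (2 ^ J * 2 ^ j)) ≤ f r := by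
      intro r hr
      refine ENNReal.div_le_div ?_ (ENNReal.ofReal_le_ofReal hr.2.le)
      calc μ E = ∫⁻ Y in pball X₀ R', indicator E (fun _ => 1) Y ∂μ := by
            rw [lintegral_indicator hEm, setLIntegral_one, Measure.restrict_apply hEm,
              inter_eq_left.2 (inter_subset_right.trans (pball_mono hRR))]
        _ ≤ _ := by
            refine lintegral_mono fun Y => indicator_le_indicator_of_subset (fun Z hZ => ?_)
              (fun _ => bot_le) Y
            obtain ⟨Y', hY', hZY⟩ := mem_iUnion₂.1 hZ.1
            have := hY'.2 Z hZY r hr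
            rcases hm with rfl | rfl
            · exact Or.inl this
            · exact Or.inr this
    have hvol : volume (I j) = ENNReal.ofReal (1 / 2 * (2 ^ J * 2 ^ j)) := by
      rw [Real.volume_Ioo]; congr 1; ring
    calc μ E = 3 * (μ E / ENNReal.ofReal (3 / 2 * (2 ^ J * 2 ^ j)) * volume (I j)) := by
          rw [hvol, div_eq_mul_inv, ← ENNReal.ofReal_inv_of_pos (by positivity), mul_assoc,
            ← ENNReal.ofReal_mul (by positivity), mul_left_comm]
          have : (3 : ℝ≥0∞) = ENNReal.ofReal 3 := by norm_num
          rw [this, ← ENNReal.ofReal_mul (by positivity)]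
          have e : (3 : ℝ) * ((3 / 2 * (2 ^ J * 2 ^ j))⁻¹ * (1 / 2 * (2 ^ J * 2 ^ j))) = 1 := by
            field_simp
          rw [e, ENNReal.ofReal_one, mul_one]
      _ ≤ 3 * ∫⁻ r in I j, f r := by
          gcongr
          rw [← setLIntegral_const]
          exact setLIntegral_mono' measurableSet_Ioo hfr
  have hdisj : (s : Set ℤ).PairwiseDisjoint I := by
    have : ∀ i j : ℤ, i < j → Disjoint (I i) (I j) := fun i j hij => by
      rw [Set.disjoint_left]
      intro r hri hrj
      have h1 : (2 : ℝ) ^ (i + 1) ≤ 2 ^ j := zpow_le_zpow_right₀ one_le_two hij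
      rw [zpow_add_one₀ two_ne_zero] at h1
      have h2 : (0 : ℝ) < 2 ^ J := by positivity
      have h3 : (0 : ℝ) < 2 ^ i := by positivity
      have h4 := mul_le_mul_of_nonneg_left h1 h2.le
      have h5 := hri.2
      have h6 := hrj.1
      nlinarith [mul_pos h2 h3]
    intro i _ j _ hij
    rcases lt_or_gt_of_ne hij with h | h
    · exact this i j h
    · exact (this j i h).symm
  calc ∑ j ∈ s, μ (badSet C₀ k ε μ m J (2 ^ j) ∩ pball X₀ R)
      ≤ ∑ j ∈ s, 3 * ∫⁻ r in I j, f r := Finset.sum_le_sum hlow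
    _ = 3 * ∫⁻ r in ⋃ j ∈ s, I j, f r := by
        rw [← Finset.mul_sum, lintegral_biUnion_finset hdisj fun _ _ => measurableSet_Ioo]
    _ ≤ 3 * ∫⁻ r in Ioo 0 R', f r := by
        gcongr
        refine iUnion₂_subset fun j hj r hr => ⟨(hpos j).trans hr.1, hr.2.trans ?_⟩
        have h1 := hs j hj
        have h2 : (0 : ℝ) < 2 ^ J := by positivity
        have h3 := mul_le_mul_of_nonneg_left h1 h2.le
        rw [hR', pow_succ]
        nlinarith [mul_pos h2 hR]
    _ ≤ 3 * (C * ENNReal.ofReal (R' ^ (k + 2))) := by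
        gcongr
        exact hC X₀ hX₀ R' (hR.trans_le hRR)
    _ = _ := by
        rw [hR', mul_pow, ENNReal.ofReal_mul (by positivity), ENNReal.ofReal_pow (by positivity),
          ENNReal.ofReal_pow (by positivity)]
        push_cast
        simp only [ENNReal.ofReal_ofNat]
        ring

/-- A geometric sum over the dyadic scales above `e`. -/
lemma sum_sq_div_zpow_le {e : ℝ} (he : 0 < e) (s : Finset ℤ) (hs : ∀ j ∈ s, e ≤ 2 ^ j) :
    ∑ j ∈ s, ENNReal.ofReal ((e / 2 ^ j) ^ 2) ≤ 8 := by
  obtain ⟨i, hi1, hi2⟩ := exists_mem_Ico_zpow he (one_lt_two : (1 : ℝ) < 2)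
  have hij : ∀ j ∈ s, i ≤ j := fun j hj =>
    (zpow_le_zpow_iff_right₀ one_lt_two).1 (hi1.trans (hs j hj))
  have hterm : ∀ j ∈ s, ENNReal.ofReal ((e / 2 ^ j) ^ 2) ≤ 4 * 2⁻¹ ^ (j - i).toNat := by
    intro j hj
    obtain ⟨l, hl⟩ := Int.eq_ofNat_of_zero_le (sub_nonneg.2 (hij j hj))
    have hj : j = i + l := by omega
    have h1 : (e / 2 ^ j) ^ 2 ≤ 4 * 2⁻¹ ^ l := by
      have h2 : e / 2 ^ j ≤ 2 * 2⁻¹ ^ l := by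
        rw [div_le_iff₀ (by positivity), hj, zpow_add₀ two_ne_zero, zpow_natCast]
        rw [zpow_add_one₀ two_ne_zero] at hi2
        have : (2 : ℝ) * 2⁻¹ ^ l * (2 ^ i * 2 ^ l) = 2 ^ i * 2 := by
          rw [inv_pow]; field_simp
        linarith
      have h3 : 0 ≤ e / 2 ^ j := by positivity
      have h4 : (2⁻¹ : ℝ) ^ l ≤ 1 := pow_le_one₀ (by norm_num) (by norm_num)
      have h5 : (0 : ℝ) ≤ 2⁻¹ ^ l := by positivity
      nlinarith
    refine (ENNReal.ofReal_le_ofReal h1).trans (le_of_eq ?_)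
    rw [hl, Int.toNat_natCast, ENNReal.ofReal_mul (by norm_num), ENNReal.ofReal_pow (by norm_num),
      ENNReal.ofReal_inv_of_pos two_pos]
    norm_num
  have hinj : Set.InjOn (fun j : ℤ => (j - i).toNat) s := by
    intro a ha b hb hab
    have h1 := hij a ha
    have h2 := hij b hb
    have hab : (a - i).toNat = (b - i).toNat := hab
    omega
  calc ∑ j ∈ s, ENNReal.ofReal ((e / 2 ^ j) ^ 2) ≤ ∑ j ∈ s, 4 * 2⁻¹ ^ (j - i).toNat :=
        Finset.sum_le_sum hterm
    _ = ∑ l ∈ s.image (fun j : ℤ => (j - i).toNat), 4 * (2⁻¹ : ℝ≥0∞) ^ l :=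
        (Finset.sum_image (f := fun l => 4 * (2⁻¹ : ℝ≥0∞) ^ l) hinj).symm
    _ ≤ ∑' l : ℕ, 4 * (2⁻¹ : ℝ≥0∞) ^ l := ENNReal.sum_le_tsum _
    _ = 8 := by
        rw [ENNReal.tsum_mul_left, ENNReal.tsum_geometric, ENNReal.one_sub_inv_two, inv_inv]
        norm_num

end ParabolicUR

/-! ### The Carleson estimate for the flatness coefficients -/

namespace ParabolicUR

open Module Filter Topology

variable {n k : ℕ} {C₀ : ℝ} {μ : Measure (PSpace n)}

/-- Summing the contribution of the scales above the diameter `d` of the support. -/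
lemma sum_ite_diam_le {d : ℝ≥0∞} (hd : d ≠ 0) {c N : ℝ} (hc : 0 ≤ c) (hN : 0 ≤ N) (s : Finset ℤ) :
    ∑ j ∈ s, (if d ≤ ENNReal.ofReal (N * 2 ^ j) then ENNReal.ofReal (c * (d.toReal / 2 ^ j) ^ 2)
      else 0) ≤ ENNReal.ofReal (c * N ^ 2) * 8 := by
  rw [← Finset.sum_filter]
  rcases hN.eq_or_lt with rfl | hN
  · simp [hd]
  rcases eq_or_ne d ∞ with rfl | hfin
  · simp
  have hd0 : 0 < d.toReal := ENNReal.toReal_pos hd hfin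
  have he : 0 < d.toReal / N := by positivity
  calc _ = ∑ j ∈ s.filter (fun j => d ≤ ENNReal.ofReal (N * 2 ^ j)),
        ENNReal.ofReal (c * N ^ 2) * ENNReal.ofReal ((d.toReal / N / 2 ^ j) ^ 2) := by
        refine Finset.sum_congr rfl fun j _ => ?_
        rw [← ENNReal.ofReal_mul (by positivity)]
        congr 1
        field_simp
    _ ≤ _ := by
        rw [← Finset.mul_sum]
        gcongr
        refine sum_sq_div_zpow_le he _ fun j hj => ?_
        have h1 := (Finset.mem_filter.1 hj).2
        have h2 := ENNReal.toReal_le_of_le_ofReal (by positivity) h1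
        rw [div_le_iff₀ hN]
        linarith

/-- Absorption of a sum over larger scales into the left-hand side. -/
lemma sum_le_of_le_add_half {x y : ℤ → ℝ≥0∞} {c : ℕ} {M B : ℝ≥0∞} {i₀ : ℤ} (hx : ∀ i, x i ≤ M)
    (hM : M ≠ ∞) (h : ∀ i, x i ≤ y i + 2⁻¹ * x (i + c))
    (hy : ∀ s : Finset ℤ, (∀ i ∈ s, i ≤ i₀) → ∑ i ∈ s, y i ≤ B) (s : Finset ℤ)
    (hs : ∀ i ∈ s, i ≤ i₀) : ∑ i ∈ s, x i ≤ 2 * B + c * M := by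
  obtain ⟨l, hl⟩ : ∃ l : ℤ, ∀ i ∈ s, l ≤ i := by
    obtain ⟨l, hl⟩ := s.bddBelow
    exact ⟨l, fun i hi => hl hi⟩
  set T := Finset.Icc l i₀ with hT
  have hsT : s ⊆ T := fun i hi => Finset.mem_Icc.2 ⟨hl i hi, hs i hi⟩
  refine (Finset.sum_le_sum_of_subset hsT).trans ?_
  set X := ∑ i ∈ T, x i with hX
  have hXfin : X ≠ ∞ := by
    refine ne_top_of_le_ne_top ?_ (Finset.sum_le_sum fun i (_ : i ∈ T) => hx i)
    rw [Finset.sum_const, nsmul_eq_mul]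
    exact ENNReal.mul_ne_top (ENNReal.natCast_ne_top _) hM
  have hshift : ∑ i ∈ T, x (i + c) ≤ X + c * M := by
    calc ∑ i ∈ T, x (i + c) = ∑ i ∈ T.image (fun i => i + (c : ℤ)), x i :=
          (Finset.sum_image fun a _ b _ hab => by simpa using hab).symm
      _ ≤ ∑ i ∈ T ∪ Finset.Ioc i₀ (i₀ + c), x i := by
          refine Finset.sum_le_sum_of_subset fun i hi => ?_
          obtain ⟨j, hj, rfl⟩ := Finset.mem_image.1 hi
          rw [hT, Finset.mem_Icc] at hj
          rw [hT, Finset.mem_union, Finset.mem_Icc, Finset.mem_Ioc]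
          omega
      _ ≤ X + ∑ i ∈ Finset.Ioc i₀ (i₀ + c), x i := by
          rw [← Finset.sum_union_inter]
          exact le_self_add
      _ ≤ X + c * M := by
          gcongr
          refine (Finset.sum_le_sum fun i _ => hx i).trans (le_of_eq ?_)
          simp
  have h1 : X ≤ B + 2⁻¹ * (X + c * M) := by
    calc X ≤ ∑ i ∈ T, (y i + 2⁻¹ * x (i + c)) := Finset.sum_le_sum fun i _ => h i
      _ = ∑ i ∈ T, y i + 2⁻¹ * ∑ i ∈ T, x (i + c) := by
          rw [Finset.sum_add_distrib, Finset.mul_sum]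
      _ ≤ _ := by
          gcongr
          exact hy T fun i hi => (Finset.mem_Icc.1 hi).2
  have h2 : X + X ≤ X + (2 * B + c * M) := by
    calc X + X = 2 * X := (two_mul X).symm
      _ ≤ 2 * (B + 2⁻¹ * (X + c * M)) := by gcongr
      _ = X + (2 * B + c * M) := by
          rw [mul_add, ← mul_assoc, ENNReal.mul_inv_cancel two_ne_zero ENNReal.ofNat_ne_top]
          ring
  exact (ENNReal.add_le_add_iff_left hXfin).1 h2

section Bounds

variable {C : ℝ}

lemma flat_le_const (hkn : k ≤ n)
    (hC : ∀ X r, 0 < r → μ (pball X r) ≤ ENNReal.ofReal (C * r ^ (k + 2))) (Y : PSpace n) {r : ℝ}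
    (hr : 0 < r) : flat k μ Y r ≤ ENNReal.ofReal C := by
  refine (flat_le_measure hkn Y hr).trans ((mul_le_mul_right (hC Y r hr) _).trans (le_of_eq ?_))
  rw [← ENNReal.ofReal_mul (by positivity)]
  congr 1
  field_simp

/-- At scales above the diameter the flatness coefficients decay quadratically: all of the support is
within distance `diam` of a plane through the centre. -/
lemma flat_le_diam (hkn : k ≤ n)
    (hC : ∀ X r, 0 < r → μ (pball X r) ≤ ENNReal.ofReal (C * r ^ (k + 2)))
    (hfin : pdiam μ.support ≠ ∞) {Y : PSpace n} (hY : Y ∈ μ.support) {r : ℝ} (hr : 0 < r) :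
    flat k μ Y r ≤ ENNReal.ofReal (C * ((pdiam μ.support).toReal / r) ^ 2) := by
  refine (flat_le_lintegral hkn Y hr).trans ?_
  set d := (pdiam μ.support).toReal
  calc _ ≤ ENNReal.ofReal (r ^ (k + 2))⁻¹ * ∫⁻ Z in pball Y r, ENNReal.ofReal ((d / r) ^ 2) ∂μ := by
        refine mul_le_mul_right (lintegral_mono_ae ?_) _
        filter_upwards [ae_restrict_of_ae (ae_mem_support μ)] with Z hZ
        have h1 : ENNReal.ofReal (pnorm (Y - Z)) ≤ pdiam μ.support :=
          le_iSup₂_of_le Y hY (le_iSup₂_of_le Z hZ le_rfl)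
        have h2 := (ENNReal.ofReal_le_iff_le_toReal hfin).1 h1
        have h3 := pnorm_nonneg (Y - Z)
        gcongr
    _ ≤ ENNReal.ofReal (r ^ (k + 2))⁻¹ *
        (ENNReal.ofReal ((d / r) ^ 2) * ENNReal.ofReal (C * r ^ (k + 2))) := by
        rw [setLIntegral_const]
        gcongr
        exact hC Y r hr
    _ = _ := by
        rw [← ENNReal.ofReal_mul (by positivity), ← ENNReal.ofReal_mul (by positivity)]
        congr 1
        field_simp

end Bounds

/-- The dyadic Carleson estimate for the flatness coefficients. -/
theorem exists_sum_flat_le (hC₀ : 0 < C₀) (hkn : k ≤ n) (hμ : IsADR C₀ k μ)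
    (hd : pdiam μ.support ≠ 0) {ε : ℝ} (hε : 0 < ε) (hH : HSDC C₀ k ε μ)
    (hCZO : ∀ K : PSpace n → ℝ, IsAdmissibleKernel k K → CZOBounded K μ) :
    ∃ A : ℝ≥0, ∀ X₀ ∈ μ.support, ∀ R : ℝ, 0 < R → ∀ s : Finset ℤ, (∀ j ∈ s, (2 : ℝ) ^ j ≤ R) →
      ∑ j ∈ s, ∫⁻ Y in pball X₀ R, flat k μ Y (2 ^ j) ∂μ ≤ A * ENNReal.ofReal (R ^ (k + 2)) := by
  have := hμ.locallyFinite
  obtain ⟨C, hC0, hC⟩ := exists_measure_pball_le hC₀ hμ hd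
  obtain ⟨q, hdecay⟩ := exists_decay hC₀ hkn hμ.adrTo hε
  -- the scale ratio `δ = 2⁻ᵃ` makes the coefficient of the flatness at the larger scale at most `1/2`
  obtain ⟨a, ha⟩ : ∃ a : ℕ, (q : ℝ≥0∞) * ENNReal.ofReal (((2 ^ a)⁻¹ : ℝ) ^ 2) ≤ 2⁻¹ := by
    obtain ⟨a, ha⟩ := exists_pow_lt_of_lt_one (x := 1 / (2 * ((q : ℝ) + 1))) (y := (1 / 2 : ℝ))
      (by positivity) (by norm_num)
    refine ⟨a, ?_⟩
    have h1 : ((2 ^ a)⁻¹ : ℝ) ≤ 1 / (2 * ((q : ℝ) + 1)) := by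
      rw [← inv_pow, ← one_div]; exact ha.le
    have h2 : ((2 ^ a)⁻¹ : ℝ) ≤ 1 := inv_le_one_of_one_le₀ (one_le_pow₀ one_le_two)
    have h3 : (0 : ℝ) ≤ (2 ^ a)⁻¹ := by positivity
    rw [← ENNReal.ofReal_coe_nnreal, ← ENNReal.ofReal_mul (NNReal.coe_nonneg q),
      show (2⁻¹ : ℝ≥0∞) = ENNReal.ofReal 2⁻¹ by rw [ENNReal.ofReal_inv_of_pos two_pos]; norm_num]
    refine ENNReal.ofReal_le_ofReal ?_
    have hq0 : (0 : ℝ) ≤ q := q.2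
    have h5 : (q : ℝ) * (1 / (2 * ((q : ℝ) + 1))) ≤ 2⁻¹ := by
      rw [mul_one_div, div_le_iff₀ (by positivity)]
      linarith
    have h6 : ((2 ^ a)⁻¹ : ℝ) ^ 2 ≤ (2 ^ a)⁻¹ := by nlinarith
    exact (mul_le_mul_of_nonneg_left (h6.trans h1) hq0).trans h5
  set δ : ℝ := (2 ^ a)⁻¹ with hδ
  have hδ0 : 0 < δ := by positivity
  obtain ⟨S, N, A, hdec⟩ := hdecay δ hδ0 (inv_le_one_of_one_le₀ (one_le_pow₀ one_le_two))
  obtain ⟨D, hD⟩ := exists_sum_convoEnergy_le hC0.le hC hCZO S N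
  choose E₁ hE₁ using exists_sum_badSet_le hH (Or.inl rfl : k + 1 = k + 1 ∨ k + 1 = k + 2)
  choose E₂ hE₂ using exists_sum_badSet_le hH (Or.inr rfl : k + 2 = k + 1 ∨ k + 2 = k + 2)
  set d := pdiam μ.support with hdef
  set g : ℤ → ℝ≥0∞ := fun j => if d ≤ ENNReal.ofReal (N * 2 ^ j) then
    ENNReal.ofReal (C / δ ^ 2 * (d.toReal / 2 ^ j) ^ 2) else 0 with hg
  set W : ℕ → ℤ → PSpace n → ℝ≥0∞ := fun J j Y =>
    indicator (badSet C₀ k ε μ (k + 1) J (2 ^ j)) (fun _ => 1) Y +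
      indicator (badSet C₀ k ε μ (k + 2) J (2 ^ j)) (fun _ => 1) Y with hW
  have hWm : ∀ J j, Measurable (W J j) := fun J j =>
    (measurable_const.indicator (measurableSet_badSet _ _ _ _ _ _ _)).add
      (measurable_const.indicator (measurableSet_badSet _ _ _ _ _ _ _))
  have h2pos : ∀ j : ℤ, (0 : ℝ) < 2 ^ j := fun j => zpow_pos two_pos j
  -- the three terms in the parenthesis take care of the scales with the decay estimate, of those with a
  -- small `α`-number, and of those above the diameter
  have hpt : ∀ Y ∈ μ.support, ∀ j : ℤ, flat k μ Y (2 ^ j * δ) ≤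
      (A * convoEnergy k S N μ Y (2 ^ j) + ENNReal.ofReal C * ∑ J ∈ Finset.range (N + 1), W J j Y +
        g j) + 2⁻¹ * flat k μ Y (2 ^ j * 4) := by
    intro Y hY j
    have hδj : 0 < 2 ^ j * δ := mul_pos (h2pos j) hδ0
    by_cases hNd : ENNReal.ofReal (N * 2 ^ j) < d
    · by_cases hα : ∀ J ≤ N, ∀ m, m = k + 1 ∨ m = k + 2 → ¬ AlphaSmall C₀ k ε μ m J Y (2 ^ j)
      · refine (hdec Y hY _ (h2pos j) hNd hα).trans (add_le_add ?_ (mul_le_mul_left ha _))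
        rw [add_assoc]
        exact le_self_add
      · push Not at hα
        obtain ⟨J, hJ, m, hm, hsmall⟩ := hα
        have hmem : Y ∈ badSet C₀ k ε μ m J (2 ^ j) :=
          mem_iUnion₂.2 ⟨Y, ⟨hY, hsmall⟩, mem_pball_self Y (half_pos (h2pos j))⟩
        have h1 : 1 ≤ ∑ J ∈ Finset.range (N + 1), W J j Y := by
          refine le_trans ?_ (Finset.single_le_sum (f := fun J => W J j Y) (fun _ _ => bot_le)
            (Finset.mem_range.2 (Nat.lt_succ_of_le hJ)))
          rcases hm with rfl | rfl
          · simp only [hW, indicator_of_mem hmem]; exact le_self_add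
          · simp only [hW, indicator_of_mem hmem]; exact le_add_self
        calc flat k μ Y (2 ^ j * δ) ≤ ENNReal.ofReal C * 1 := by
              rw [mul_one]; exact flat_le_const hkn hC Y hδj
          _ ≤ ENNReal.ofReal C * ∑ J ∈ Finset.range (N + 1), W J j Y := by gcongr
          _ ≤ _ := (le_add_self.trans le_self_add).trans le_self_add
    · rw [not_lt] at hNd
      have hfin : d ≠ ∞ := ne_top_of_le_ne_top ENNReal.ofReal_ne_top hNd
      calc flat k μ Y (2 ^ j * δ) ≤ g j := by
            refine (flat_le_diam hkn hC hfin hY hδj).trans (le_of_eq ?_)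
            simp only [hg, if_pos hNd]
            congr 1
            field_simp
            rfl
        _ ≤ _ := le_add_self.trans le_self_add
  set Q : ℝ≥0∞ := A * D + ENNReal.ofReal C * ∑ J ∈ Finset.range (N + 1), (E₁ J + E₂ J : ℝ≥0∞) +
    ENNReal.ofReal (C / δ ^ 2 * N ^ 2) * 8 * ENNReal.ofReal C with hQ
  set P : ℝ≥0∞ := 2 * (Q * ENNReal.ofReal ((2 ^ a) ^ (k + 2))) +
    ((a + 2 : ℕ) : ℝ≥0∞) * (ENNReal.ofReal C * ENNReal.ofReal C) with hP
  have hPfin : P ≠ ∞ := by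
    have hQfin : Q ≠ ∞ := by
      refine ENNReal.add_ne_top.2 ⟨ENNReal.add_ne_top.2 ⟨?_, ?_⟩, ?_⟩
      · exact ENNReal.mul_ne_top ENNReal.coe_ne_top ENNReal.coe_ne_top
      · exact ENNReal.mul_ne_top ENNReal.ofReal_ne_top (ENNReal.sum_ne_top.2 fun J _ =>
          ENNReal.add_ne_top.2 ⟨ENNReal.coe_ne_top, ENNReal.coe_ne_top⟩)
      · exact ENNReal.mul_ne_top (ENNReal.mul_ne_top ENNReal.ofReal_ne_top (by norm_num))
          ENNReal.ofReal_ne_top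
    refine ENNReal.add_ne_top.2 ⟨ENNReal.mul_ne_top (by norm_num)
      (ENNReal.mul_ne_top hQfin ENNReal.ofReal_ne_top), ENNReal.mul_ne_top
      (ENNReal.natCast_ne_top _) (ENNReal.mul_ne_top ENNReal.ofReal_ne_top ENNReal.ofReal_ne_top)⟩
  refine ⟨P.toNNReal, fun X₀ hX₀ R hR s hs => ?_⟩
  rw [ENNReal.coe_toNNReal hPfin]
  -- the estimate for the scale `2 ^ i` uses the energy at the scale `2 ^ (i + a)`, up to `2 ^ a * R`
  set R' := 2 ^ a * R with hR'
  have hRR : R ≤ R' := le_mul_of_one_le_left hR.le (one_le_pow₀ one_le_two)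
  have hR'0 : 0 < R' := hR.trans_le hRR
  set x : ℤ → ℝ≥0∞ := fun i => ∫⁻ Y in pball X₀ R, flat k μ Y (2 ^ i) ∂μ with hx
  set y : ℤ → ℝ≥0∞ := fun j => A * ∫⁻ Y in pball X₀ R', convoEnergy k S N μ Y (2 ^ j) ∂μ +
    ENNReal.ofReal C * ∑ J ∈ Finset.range (N + 1),
      (μ (badSet C₀ k ε μ (k + 1) J (2 ^ j) ∩ pball X₀ R') +
        μ (badSet C₀ k ε μ (k + 2) J (2 ^ j) ∩ pball X₀ R')) + g j * μ (pball X₀ R') with hy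
  have hxM : ∀ i, x i ≤ ENNReal.ofReal C * ENNReal.ofReal (C * R ^ (k + 2)) := fun i => by
    calc x i ≤ ∫⁻ _ in pball X₀ R, ENNReal.ofReal C ∂μ :=
          lintegral_mono fun Y => flat_le_const hkn hC Y (h2pos i)
      _ ≤ _ := by
          rw [setLIntegral_const]
          gcongr
          exact hC X₀ R hR
  have hxy : ∀ i, x i ≤ y (i + a) + 2⁻¹ * x (i + (a + 2 : ℕ)) := by
    intro i
    set j : ℤ := i + a with hj
    have e1 : (2 : ℝ) ^ i = 2 ^ j * δ := by
      rw [hj, hδ, zpow_add₀ two_ne_zero, zpow_natCast]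
      field_simp
    have e2 : (2 : ℝ) ^ (i + (a + 2 : ℕ)) = 2 ^ j * 4 := by
      rw [hj, zpow_add₀ two_ne_zero, zpow_add₀ two_ne_zero, zpow_natCast, zpow_natCast, pow_add]
      ring
    have hmE := measurable_convoEnergy (k := k) (μ := μ) S N (2 ^ j)
    have hmW : Measurable fun Y => ENNReal.ofReal C * ∑ J ∈ Finset.range (N + 1), W J j Y :=
      (Finset.measurable_sum _ fun J _ => hWm J j).const_mul _
    calc x i ≤ ∫⁻ Y in pball X₀ R, ((A * convoEnergy k S N μ Y (2 ^ j) +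
          ENNReal.ofReal C * ∑ J ∈ Finset.range (N + 1), W J j Y + g j) +
            2⁻¹ * flat k μ Y (2 ^ j * 4)) ∂μ := by
          refine lintegral_mono_ae ?_
          filter_upwards [ae_restrict_of_ae (ae_mem_support μ)] with Y hY
          rw [e1]
          exact hpt Y hY j
      _ = ∫⁻ Y in pball X₀ R, (A * convoEnergy k S N μ Y (2 ^ j) +
          ENNReal.ofReal C * ∑ J ∈ Finset.range (N + 1), W J j Y + g j) ∂μ +
            2⁻¹ * x (i + (a + 2 : ℕ)) := by
          rw [lintegral_add_left (by exact ((hmE.const_mul _).add hmW).add measurable_const),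
            lintegral_const_mul' _ _ (by norm_num)]
          simp only [hx, e2]
      _ ≤ ∫⁻ Y in pball X₀ R', (A * convoEnergy k S N μ Y (2 ^ j) +
          ENNReal.ofReal C * ∑ J ∈ Finset.range (N + 1), W J j Y + g j) ∂μ +
            2⁻¹ * x (i + (a + 2 : ℕ)) := by
          gcongr
          exact pball_mono hRR
      _ = y j + 2⁻¹ * x (i + (a + 2 : ℕ)) := by
          congr 1
          rw [lintegral_add_right _ measurable_const, lintegral_add_left (hmE.const_mul _),
            lintegral_const_mul' _ _ ENNReal.coe_ne_top, lintegral_const_mul' _ _ ENNReal.ofReal_ne_top,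
            lintegral_finsetSum _ fun J _ => hWm J j, setLIntegral_const]
          simp only [hy]
          congr 3
          refine Finset.sum_congr rfl fun J _ => ?_
          have hb1 := measurableSet_badSet C₀ k ε μ (k + 1) J (2 ^ j)
          have hb2 := measurableSet_badSet C₀ k ε μ (k + 2) J (2 ^ j)
          simp only [hW]
          rw [lintegral_add_left (measurable_const.indicator hb1), lintegral_indicator hb1,
            lintegral_indicator hb2, setLIntegral_one, setLIntegral_one, Measure.restrict_apply hb1,
            Measure.restrict_apply hb2]
  have hyB : ∀ s : Finset ℤ, (∀ j ∈ s, (2 : ℝ) ^ j ≤ R') →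
      ∑ j ∈ s, y j ≤ Q * ENNReal.ofReal (R' ^ (k + 2)) := by
    intro s hs
    calc ∑ j ∈ s, y j = A * ∑ j ∈ s, ∫⁻ Y in pball X₀ R', convoEnergy k S N μ Y (2 ^ j) ∂μ +
          ENNReal.ofReal C * ∑ J ∈ Finset.range (N + 1),
            (∑ j ∈ s, μ (badSet C₀ k ε μ (k + 1) J (2 ^ j) ∩ pball X₀ R') +
              ∑ j ∈ s, μ (badSet C₀ k ε μ (k + 2) J (2 ^ j) ∩ pball X₀ R')) +
          (∑ j ∈ s, g j) * μ (pball X₀ R') := by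
          simp only [hy, Finset.sum_add_distrib, ← Finset.mul_sum, Finset.sum_mul]
          rw [Finset.sum_comm (s := s), Finset.sum_comm (s := s)]
      _ ≤ A * (D * ENNReal.ofReal (R' ^ (k + 2))) + ENNReal.ofReal C * ∑ J ∈ Finset.range (N + 1),
            (E₁ J * ENNReal.ofReal (R' ^ (k + 2)) + E₂ J * ENNReal.ofReal (R' ^ (k + 2))) +
          (ENNReal.ofReal (C / δ ^ 2 * N ^ 2) * 8) * ENNReal.ofReal (C * R' ^ (k + 2)) := by
          gcongr with J hJ
          · exact hD X₀ R' hR'0 s hs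
          · exact hE₁ J X₀ hX₀ R' hR'0 s hs
          · exact hE₂ J X₀ hX₀ R' hR'0 s hs
          · exact sum_ite_diam_le hd (by positivity) (Nat.cast_nonneg N) s
          · exact hC X₀ R' hR'0
      _ = _ := by
          rw [hQ, ENNReal.ofReal_mul hC0.le]
          simp only [← add_mul, ← Finset.sum_mul]
          ring
  obtain ⟨i₀, hi₀, hi₀'⟩ := exists_mem_Ico_zpow hR (one_lt_two : (1 : ℝ) < 2)
  have hle : ∀ i : ℤ, (2 : ℝ) ^ i ≤ R → i ≤ i₀ := fun i hi => by
    have := (zpow_lt_zpow_iff_right₀ (one_lt_two : (1 : ℝ) < 2)).1 (hi.trans_lt hi₀')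
    omega
  have hge : ∀ i : ℤ, i ≤ i₀ → (2 : ℝ) ^ i ≤ R := fun i hi =>
    (zpow_le_zpow_right₀ one_le_two hi).trans hi₀
  have hfinal := sum_le_of_le_add_half (x := x) (y := fun i => y (i + a)) (c := a + 2)
    (B := Q * ENNReal.ofReal (R' ^ (k + 2))) (i₀ := i₀) hxM
    (ENNReal.mul_ne_top ENNReal.ofReal_ne_top ENNReal.ofReal_ne_top) hxy (fun s hs => by
      rw [← Finset.sum_image (f := y) (g := fun i : ℤ => i + (a : ℤ))
        fun a _ b _ hab => by simpa using hab]
      refine hyB _ fun j hj => ?_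
      obtain ⟨i, hi, rfl⟩ := Finset.mem_image.1 hj
      have := hge i (hs i hi)
      rw [zpow_add₀ two_ne_zero, zpow_natCast, mul_comm, hR']
      gcongr) s fun i hi => hle i (hs i hi)
  refine hfinal.trans (le_of_eq ?_)
  rw [hP, hR', mul_pow, ENNReal.ofReal_mul (by positivity), ENNReal.ofReal_mul hC0.le]
  ring

end ParabolicUR

/-! ### From flatness coefficients to `β`-numbers -/

namespace ParabolicUR

open Module Filter Topology

variable {n k : ℕ} {C₀ : ℝ} {μ : Measure (PSpace n)}

/-- The `β`-number is bounded by the mean square distance to the plane `(a + V) × ℝ`; the distance to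
it is at most the spatial offset, since points may be moved at a fixed time. -/
lemma betaSq_le_lintegral {V : Submodule ℝ (EuclideanSpace ℝ (Fin n))} (hV : finrank ℝ V = k)
    (a : EuclideanSpace ℝ (Fin n)) (Y : PSpace n) {r : ℝ} (hr : 0 < r) :
    betaSq k μ Y r ≤ (μ (pball Y r))⁻¹ *
      ∫⁻ Z in pball Y r, ENNReal.ofReal ((‖offset V a Z.1‖ / r) ^ 2) ∂μ := by
  set L : AffineSubspace ℝ (PSpace n) := AffineSubspace.mk' ((a, 0) : PSpace n) (V.prod ⊤) with hL
  have hmem : ∀ x t, (x, t) ∈ L ↔ x - a ∈ V := fun x t => by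
    rw [hL, AffineSubspace.mem_mk']
    simp [Submodule.mem_prod]
  have hvert : IsVerticalPlane k L := by
    refine ⟨?_, a, fun t => (hmem a t).2 (by simp)⟩
    rw [AffineSubspace.map_direction, hL, AffineSubspace.direction_mk', LinearMap.toAffineMap_linear,
      Submodule.prod_map_fst]
    exact hV
  refine (iInf₂_le L hvert).trans ?_
  gcongr with Z
  rw [ENNReal.ofReal_pow (by positivity), ENNReal.ofReal_div_of_pos hr]
  gcongr
  have hW : ((Z.1 - offset V a Z.1, Z.2) : PSpace n) ∈ (L : Set (PSpace n)) := by
    refine (hmem _ _).2 ?_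
    have e : Z.1 - offset V a Z.1 - a = V.starProjection (Z.1 - a) := by
      rw [offset, Submodule.starProjection_orthogonal_val]
      abel
    rw [e]
    exact Submodule.starProjection_apply_mem _ _
  refine (iInf₂_le _ hW).trans (le_of_eq ?_)
  congr 1
  rw [pnorm]
  simp [Real.sqrt_sq (norm_nonneg _)]

lemma betaSq_le_flat (hC₀ : 0 < C₀) {Y : PSpace n} {r s : ℝ} (hr : 0 < r) (hrs : r ≤ s)
    (hsr : s ≤ 2 * r) (hμ : ENNReal.ofReal (C₀⁻¹ * r ^ (k + 2)) ≤ μ (pball Y r)) :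
    betaSq k μ Y r ≤ ENNReal.ofReal (C₀ * 2 ^ (k + 4)) * flat k μ Y s := by
  have hs : 0 < s := hr.trans_le hrs
  rw [flat, ENNReal.mul_iInf_of_ne (by simp only [ne_eq, ENNReal.ofReal_eq_zero, not_le]; positivity)
    ENNReal.ofReal_ne_top]
  refine le_iInf fun p => (betaSq_le_lintegral p.1.2 p.2 Y hr).trans ?_
  have h1 : (μ (pball Y r))⁻¹ ≤ ENNReal.ofReal (C₀ * 2 ^ (k + 2) * (s ^ (k + 2))⁻¹) := by
    refine (ENNReal.inv_le_inv.2 hμ).trans ?_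
    rw [← ENNReal.ofReal_inv_of_pos (by positivity)]
    refine ENNReal.ofReal_le_ofReal ?_
    rw [mul_inv, inv_inv, mul_assoc]
    refine mul_le_mul_of_nonneg_left ?_ hC₀.le
    rw [← div_eq_mul_inv, le_div_iff₀ (by positivity), inv_mul_le_iff₀ (by positivity), ← mul_pow]
    exact pow_le_pow_left₀ hs.le (by linarith) _
  have h2 : ∀ Z : PSpace n, ENNReal.ofReal ((‖offset p.1.1 p.2 Z.1‖ / r) ^ 2) ≤
      ENNReal.ofReal (2 ^ 2) * ENNReal.ofReal ((‖offset p.1.1 p.2 Z.1‖ / s) ^ 2) := fun Z => by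
    rw [← ENNReal.ofReal_mul (by positivity), ← mul_pow]
    refine ENNReal.ofReal_le_ofReal (pow_le_pow_left₀ (by positivity) ?_ 2)
    rw [div_le_iff₀ hr, mul_div_assoc', div_mul_eq_mul_div, le_div_iff₀ hs]
    nlinarith [norm_nonneg (offset p.1.1 p.2 Z.1)]
  calc _ ≤ ENNReal.ofReal (C₀ * 2 ^ (k + 2) * (s ^ (k + 2))⁻¹) * ∫⁻ Z in pball Y s,
        ENNReal.ofReal (2 ^ 2) * ENNReal.ofReal ((‖offset p.1.1 p.2 Z.1‖ / s) ^ 2) ∂μ :=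
        mul_le_mul' h1 ((lintegral_mono h2).trans (lintegral_mono_set (pball_mono hrs)))
    _ = _ := by
        rw [lintegral_const_mul' _ _ ENNReal.ofReal_ne_top, planeErr, ← mul_assoc, ← mul_assoc,
          ← ENNReal.ofReal_mul (by positivity), ← ENNReal.ofReal_mul (by positivity)]
        congr 2
        ring

/-- The bound given by a plane through the centre of the ball, for which the distances are at most
the diameter of the support. -/
lemma betaSq_le_diam (hkn : k ≤ n) (hfin : pdiam μ.support ≠ ∞) {Y : PSpace n}
    (hY : Y ∈ μ.support) {r : ℝ} (hr : 0 < r) :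
    betaSq k μ Y r ≤ ENNReal.ofReal (((pdiam μ.support).toReal / r) ^ 2) := by
  obtain ⟨V, -, hV⟩ := exists_submodule_of_le_finrank (n := n) (W := ⊥) (d := k) (by simp) hkn
  refine (betaSq_le_lintegral hV Y.1 Y hr).trans ?_
  set d := (pdiam μ.support).toReal
  calc _ ≤ (μ (pball Y r))⁻¹ * ∫⁻ Z in pball Y r, ENNReal.ofReal ((d / r) ^ 2) ∂μ := by
        refine mul_le_mul_right (lintegral_mono_ae ?_) _
        filter_upwards [ae_restrict_of_ae (ae_mem_support μ)] with Z hZ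
        have h1 : ENNReal.ofReal (pnorm (Y - Z)) ≤ pdiam μ.support :=
          le_iSup₂_of_le Y hY (le_iSup₂_of_le Z hZ le_rfl)
        have h2 := (ENNReal.ofReal_le_iff_le_toReal hfin).1 h1
        have h3 : ‖offset V Y.1 Z.1‖ ≤ pnorm (Y - Z) := by
          refine (norm_offset_le V _ _ V.zero_mem).trans ?_
          rw [sub_zero, ← Prod.fst_sub, pnorm_sub_comm]
          exact norm_fst_le_pnorm _
        have h4 := h3.trans h2
        gcongr
    _ ≤ _ := by
        rw [setLIntegral_const, mul_left_comm]
        exact mul_le_of_le_one_right' (ENNReal.inv_mul_le_one _)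

/-- On each dyadic range of scales the `β`-numbers are controlled by a single flatness coefficient,
or by the diameter of the support. -/
lemma betaSq_le_dyadic (hC₀ : 0 < C₀) (hkn : k ≤ n) (hμ : IsADR C₀ k μ) {Y : PSpace n}
    (hY : Y ∈ μ.support) {r s : ℝ} (hr : 0 < r) (hrs : r ≤ s) (hsr : s ≤ 2 * r) :
    betaSq k μ Y r ≤ ENNReal.ofReal (C₀ * 2 ^ (k + 4)) * flat k μ Y s +
      if pdiam μ.support ≤ ENNReal.ofReal (1 * s) then
        ENNReal.ofReal (4 * ((pdiam μ.support).toReal / s) ^ 2) else 0 := by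
  have hs : 0 < s := hr.trans_le hrs
  rcases lt_or_ge (ENNReal.ofReal r) (pdiam μ.support) with h | h
  · exact (betaSq_le_flat hC₀ hr hrs hsr (hμ.regular Y hY r hr h).1).trans le_self_add
  · rw [one_mul, if_pos (h.trans (ENNReal.ofReal_le_ofReal hrs))]
    refine ((betaSq_le_diam hkn (ne_top_of_le_ne_top ENNReal.ofReal_ne_top h) hY hr).trans
      (ENNReal.ofReal_le_ofReal ?_)).trans le_add_self
    have h0 : (0 : ℝ) ≤ (pdiam μ.support).toReal := ENNReal.toReal_nonneg
    rw [show (4 : ℝ) = 2 ^ 2 by norm_num, ← mul_pow]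
    refine pow_le_pow_left₀ (by positivity) ?_ 2
    rw [div_le_iff₀ hr, mul_div_assoc', div_mul_eq_mul_div, le_div_iff₀ hs]
    nlinarith

/-- Bounding an integral with respect to `dr / r` by a sum over dyadic scales. -/
lemma lintegral_div_le_of_dyadic {f : ℝ → ℝ≥0∞} {F : ℤ → ℝ≥0∞} {R : ℝ} {B : ℝ≥0∞}
    (hf : ∀ (j : ℤ) (r : ℝ), 2 ^ j / 2 < r → r ≤ 2 ^ j → f r ≤ F j)
    (hF : ∀ s : Finset ℤ, (∀ j ∈ s, (2 : ℝ) ^ j ≤ 2 * R) → ∑ j ∈ s, F j ≤ B) :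
    ∫⁻ r in Ioo (0 : ℝ) R, f r / ENNReal.ofReal r ≤ B := by
  have hcov : Ioo 0 R ⊆ ⋃ j : {j : ℤ // (2 : ℝ) ^ j ≤ 2 * R}, Ioc ((2 : ℝ) ^ j.1 / 2) (2 ^ j.1) := by
    intro r hr
    obtain ⟨i, hi1, hi2⟩ := exists_mem_Ioc_zpow hr.1 (one_lt_two : (1 : ℝ) < 2)
    have e : (2 : ℝ) ^ (i + 1) = 2 * 2 ^ i := by rw [zpow_add_one₀ two_ne_zero, mul_comm]
    refine mem_iUnion.2 ⟨⟨i + 1, ?_⟩, ?_, hi2⟩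
    · rw [e]; linarith [hr.2]
    · rw [e]; linarith
  refine (lintegral_mono_set hcov).trans ((lintegral_iUnion_le _ _).trans ?_)
  rw [ENNReal.tsum_eq_iSup_sum]
  refine iSup_le fun t => ?_
  have hterm : ∀ j : {j : ℤ // (2 : ℝ) ^ j ≤ 2 * R},
      ∫⁻ r in Ioc ((2 : ℝ) ^ j.1 / 2) (2 ^ j.1), f r / ENNReal.ofReal r ≤ F j.1 := by
    intro j
    have h2 : (0 : ℝ) < 2 ^ j.1 := zpow_pos two_pos _
    calc ∫⁻ r in Ioc ((2 : ℝ) ^ j.1 / 2) (2 ^ j.1), f r / ENNReal.ofReal r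
        ≤ ∫⁻ _ in Ioc ((2 : ℝ) ^ j.1 / 2) (2 ^ j.1), F j.1 / ENNReal.ofReal (2 ^ j.1 / 2) :=
          setLIntegral_mono' measurableSet_Ioc fun r hr =>
            ENNReal.div_le_div (hf j.1 r hr.1 hr.2) (ENNReal.ofReal_le_ofReal hr.1.le)
      _ = F j.1 := by
          rw [setLIntegral_const, Real.volume_Ioc, sub_half, ENNReal.div_mul_cancel
            (by simp only [ne_eq, ENNReal.ofReal_eq_zero, not_le]; positivity)
            ENNReal.ofReal_ne_top]
  calc _ ≤ ∑ j ∈ t, F j.1 := Finset.sum_le_sum fun j _ => hterm j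
    _ = ∑ j ∈ t.map (Function.Embedding.subtype _), F j := by simp
    _ ≤ B := hF _ fun j hj => by
        obtain ⟨i, -, rfl⟩ := Finset.mem_map.1 hj
        exact i.2

end ParabolicUR

open ParabolicUR in
theorem theorem1p4 (n k : ℕ) (hk : 1 ≤ k) (hkn : k + 1 ≤ n) (C₀ : ℝ) (hC₀ : 0 < C₀)
    (μ : MeasureTheory.Measure (ParabolicUR.PSpace n))
    (hμ : ParabolicUR.IsADR C₀ k μ)
    (hHSDC : ∃ ε : ℝ, 0 < ε ∧ ParabolicUR.HSDC C₀ k ε μ)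
    (hCZO : ∀ K : ParabolicUR.PSpace n → ℝ,
      ParabolicUR.IsAdmissibleKernel k K → ParabolicUR.CZOBounded K μ) :
    ParabolicUR.IsUniformlyRectifiable k μ := by
  have hkn' : k ≤ n := Nat.le_of_succ_le hkn
  obtain ⟨ε, hε, hH⟩ := hHSDC
  by_cases hd : pdiam μ.support = 0
  · -- the support is at most a point, and all planes through it have vanishing `β`-number
    refine ⟨0, fun X _ R _ => ?_⟩
    rw [ENNReal.coe_zero, zero_mul]
    refine le_of_eq (setLIntegral_eq_zero measurableSet_Ioo fun r hr => ?_)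
    have h0 : ∫⁻ Y in pball X R, betaSq k μ Y r ∂μ = 0 := by
      refine le_antisymm ((lintegral_mono_ae (g := fun _ => 0) ?_).trans_eq lintegral_zero) bot_le
      filter_upwards [ae_restrict_of_ae (ae_mem_support μ)] with Y hY
      refine (betaSq_le_diam hkn' (by simp [hd]) hY hr.1).trans (le_of_eq ?_)
      simp [hd]
    simp [h0]
  obtain ⟨C, hC0, hC⟩ := exists_measure_pball_le hC₀ hμ hd
  obtain ⟨A, hA⟩ := exists_sum_flat_le hC₀ hkn' hμ hd hε hH hCZO
  refine ⟨(C₀ * 2 ^ (k + 4)).toNNReal * A * 2 ^ (k + 2) + 32 * C.toNNReal, fun X hX R hR => ?_⟩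
  set g : ℤ → ℝ≥0∞ := fun j => if pdiam μ.support ≤ ENNReal.ofReal (1 * 2 ^ j) then
    ENNReal.ofReal (4 * ((pdiam μ.support).toReal / 2 ^ j) ^ 2) else 0 with hg
  refine lintegral_div_le_of_dyadic (F := fun j => ENNReal.ofReal (C₀ * 2 ^ (k + 4)) *
    (∫⁻ Y in pball X (2 * R), flat k μ Y (2 ^ j) ∂μ) + g j * μ (pball X R)) (fun j r hjr hrj => ?_)
    fun s hs => ?_
  · have h2 : (0 : ℝ) < 2 ^ j := zpow_pos two_pos j
    calc ∫⁻ Y in pball X R, betaSq k μ Y r ∂μ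
        ≤ ∫⁻ Y in pball X R, (ENNReal.ofReal (C₀ * 2 ^ (k + 4)) * flat k μ Y (2 ^ j) + g j) ∂μ := by
          refine lintegral_mono_ae ?_
          filter_upwards [ae_restrict_of_ae (ae_mem_support μ)] with Y hY
          exact betaSq_le_dyadic hC₀ hkn' hμ hY (by linarith) hrj (by linarith)
      _ = ENNReal.ofReal (C₀ * 2 ^ (k + 4)) * (∫⁻ Y in pball X R, flat k μ Y (2 ^ j) ∂μ) +
          g j * μ (pball X R) := by
          rw [lintegral_add_right _ measurable_const,
            lintegral_const_mul' _ _ ENNReal.ofReal_ne_top, setLIntegral_const]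
      _ ≤ _ := by
          gcongr
          exact pball_mono (by linarith)
  · rw [Finset.sum_add_distrib, ← Finset.mul_sum, ← Finset.sum_mul]
    calc _ ≤ ENNReal.ofReal (C₀ * 2 ^ (k + 4)) * (A * ENNReal.ofReal ((2 * R) ^ (k + 2))) +
          ENNReal.ofReal (4 * 1 ^ 2) * 8 * ENNReal.ofReal (C * R ^ (k + 2)) := by
          gcongr
          · exact hA X hX (2 * R) (by positivity) s hs
          · exact sum_ite_diam_le hd (by norm_num) zero_le_one s
          · exact hC X R hR
      _ = _ := by
          rw [mul_pow, ENNReal.ofReal_mul (p := 2 ^ (k + 2)) (by positivity),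
            ENNReal.ofReal_mul hC0.le, ENNReal.ofReal_pow two_pos.le]
          push_cast
          change _ = (ENNReal.ofReal _ * _ * _ + 32 * ENNReal.ofReal C) * _
          norm_num
          ring
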